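/- **Theorem (analogue of Selberg's formula for Motohashi's product).** Let $T_1,T_2\in\mathbb R$ and $z>1$. For integers $d\ge1$ put \[ \lambda_d(z)=\begin{cases}\mu(d)&\text{if } d<z,\\ \mu(d)\dfrac{\log(z^2/d)}{\log z}&\text{if } z\le d<z^2,\\ 0&\text{otherwise,}\end{cases} \] \[ P_d(s)=\prod_{p\mid d}\left(1-\left(1-p^{-s}\right)\left(1-p^{-(s-iT_1)}\right)\left(1-p^{-(s+iT_2)}\right)\left(1-p^{-(s-i(T_1-T_2))}\right)\left(1-p^{-(2s-i(T_1-T_2))}\right)^{-1}\right), \] \[ J(s)=\frac{\zeta(s)\zeta(s-iT_1)\zeta(s+iT_2)\zeta(s-i(T_1-T_2))}{\zeta(2s-i(T_1-T_2))},\qquad K(s)=\sum_{d\le z^2}\lambda_d(z)P_d(s), \] and let $Z(s)=J(s)K(s)$ (Motohashi's product), a meromorphic function on $\mathbb C$. Then: (a) For $\Re s$ sufficiently large, $\dfrac{Z'}{Z}(s)$ is given by an absolutely convergent Dirichlet series $\dfrac{Z'}{Z}(s)=\sum_{n\ge2}\Sigma(n)n^{-s}$; this defines the coefficients $\Sigma(n)$,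 and $\Sigma(1)=0$. (b) Every pole $\nu$ of $K$ is of the form $\nu=i\left(\frac{\pi k}{\log p}+\frac12(T_1-T_2)\right)$ with $k\in\mathbb Z$ and $p<z^2$ a prime. (c) Let $x>1$ and write \[ \Sigma_x(n)=\begin{cases}\Sigma(n)&\text{for }1\le n\le x,\\[2pt] \Sigma(n)\dfrac{\log^2\frac{x^3}n-2\log^2\frac{x^2}n}{2\log^2x}&\text{for }x\le n\le x^2,\\[6pt] \Sigma(n)\dfrac{\log^2\frac{x^3}n}{2\log^2x}&\text{for }x^2\le n\le x^3.\end{cases} \] Let $\rho$ run over the nontrivial zeros of $\zeta$ (those with $0<\Re\rho<1$), $q$ over $1,2,3,\dots$, $\nu$ over the poles of $K$ and $r$ over the zeros of $K$, and put \begin{align*} S_1&=\{1,\,1+iT_1,\,1-iT_2,\,1+i(T_1-T_2)\},&\overline S_1&=\{\tfrac12+\tfrac i2(T_1-T_2)\},\\ S_\rho&=\{\rho,\,\rho+iT_1,\,\rho-iT_2,\,\rho+i(T_1-T_2)\},&\overline S_\rho&=\{\tfrac\rho2+\tfrac i2(T_1-T_2)\},\\ S_{-2q}&=\{-2q,\,-2q+iT_1,\,-2q-iT_2,\,-2q+i(T_1-T_2)\},&\overline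 S_{-2q}&=\{-q+\tfrac i2(T_1-T_2)\},\\ S_\nu&=\{\nu\},&S_r&=\{r\}. \end{align*} Then for every $s\in\mathbb C$ lying in none of these sets, \[ \frac{Z'}{Z}(s)=\sum_{n<x^3}\frac{\Sigma_x(n)}{n^s} +\sum_{u\in S_1\cup\overline S_\rho\cup\overline S_{-2q}\cup S_\nu}\frac{x^{u-s}(1-x^{u-s})^2}{\log^2x\,(u-s)^3} -\sum_{u\in\overline S_1\cup S_\rho\cup S_{-2q}\cup S_r}\frac{x^{u-s}(1-x^{u-s})^2}{\log^2x\,(u-s)^3}, \] where all the sums converge absolutely and zeros and poles are counted according to their multiplicities: each $\rho$ with its multiplicity as a zero of $\zeta$, each $\nu$ and $r$ with its multiplicity as a pole or zero of $K$, and a point that occurs in several families, or for several of the four shifts, once for each occurrence. -/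

import Mathlib

open Complex Filter Topology

noncomputable section

namespace Motohashi

/-- The weights `ξ(d) = λ_d(z)`. -/
def lam (z : ℝ) (d : ℕ) : ℝ :=
  if (d : ℝ) < z then (ArithmeticFunction.moebius d : ℝ)
  else if (d : ℝ) < z ^ 2 then
    (ArithmeticFunction.moebius d : ℝ) * (Real.log (z ^ 2 / d) / Real.log z)
  else 0

/-- The product `P_d(s, T₁, T₂)` over the primes dividing `d`. -/
def P (T₁ T₂ : ℝ) (d : ℕ) (s : ℂ) : ℂ :=
  ∏ p ∈ d.primeFactors,
    (1 - (1 - 1 / (p : ℂ) ^ s) * (1 - 1 / (p : ℂ) ^ (s - I * T₁))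
        * (1 - 1 / (p : ℂ) ^ (s + I * T₂)) * (1 - 1 / (p : ℂ) ^ (s - I * (T₁ - T₂)))
        * (1 - 1 / (p : ℂ) ^ (2 * s - I * (T₁ - T₂)))⁻¹)

/-- The factor `J(s, T₁, T₂)`. -/
def J (T₁ T₂ : ℝ) (s : ℂ) : ℂ :=
  riemannZeta s * riemannZeta (s - I * T₁) * riemannZeta (s + I * T₂)
    * riemannZeta (s - I * (T₁ - T₂)) / riemannZeta (2 * s - I * (T₁ - T₂))

/-- The factor `K(s, T₁, T₂) = ∑_{d ≤ z²} λ_d(z) P_d(s, T₁, T₂)`. -/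
def K (T₁ T₂ z : ℝ) (s : ℂ) : ℂ :=
  ∑ d ∈ Finset.Icc 1 ⌊z ^ 2⌋₊, (lam z d : ℂ) * P T₁ T₂ d s

theorem meromorphicAt_riemannZeta (w : ℂ) : MeromorphicAt riemannZeta w := by
  by_cases hw : w = 1
  · subst hw
    have h1 : AnalyticAt ℂ (Function.update (fun s : ℂ => (s - 1) * riemannZeta s) 1 1) 1 := by
      apply Complex.analyticAt_of_differentiable_on_punctured_nhds_of_continuousAt
      · filter_upwards [self_mem_nhdsWithin] with s hs
        have : DifferentiableAt ℂ (fun s : ℂ => (s - 1) * riemannZeta s) s :=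
          (differentiableAt_id.sub_const 1).mul (differentiableAt_riemannZeta hs)
        refine this.congr_of_eventuallyEq ?_
        filter_upwards [isOpen_ne.mem_nhds hs] with t ht
        simp [Function.update_of_ne ht]
      · exact continuousAt_update_same.2 riemannZeta_residue_one
    have h2 : MeromorphicAt (fun s : ℂ => (s - 1)⁻¹ * Function.update (fun s : ℂ => (s - 1) * riemannZeta s) 1 1 s) 1 :=
      (MeromorphicAt.inv (by fun_prop)).mul h1.meromorphicAt
    refine h2.congr ?_
    filter_upwards [self_mem_nhdsWithin] with s hs
    have : s - 1 ≠ 0 := sub_ne_zero.2 hs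
    simp [Function.update_of_ne hs]
    field_simp
  · refine AnalyticAt.meromorphicAt ?_
    refine (DifferentiableOn.analyticAt (s := {1}ᶜ) ?_ (isOpen_ne.mem_nhds hw))
    intro s hs
    exact (differentiableAt_riemannZeta hs).differentiableWithinAt

theorem meromorphicOn_J_mul_K (T₁ T₂ z : ℝ) : MeromorphicOn (fun s => J T₁ T₂ s * K T₁ T₂ z s) Set.univ := by
  intro s _
  have e : ∀ a b : ℂ, MeromorphicAt (fun t => riemannZeta (a * t + b)) s := by
    intro a b
    exact (meromorphicAt_riemannZeta _).comp_analyticAt (f := riemannZeta) (g := fun t => a * t + b) (by fun_prop)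
  refine MeromorphicAt.mul ?_ ?_
  · unfold J
    refine MeromorphicAt.div (MeromorphicAt.mul (MeromorphicAt.mul (MeromorphicAt.mul ?_ ?_) ?_) ?_) ?_
    · exact meromorphicAt_riemannZeta s
    · simpa [sub_eq_add_neg] using e 1 (-(I * T₁))
    · simpa using e 1 (I * T₂)
    · simpa [sub_eq_add_neg] using e 1 (-(I * (T₁ - T₂)))
    · simpa [sub_eq_add_neg] using e 2 (-(I * (T₁ - T₂)))
  · unfold K P
    refine MeromorphicAt.fun_sum fun d _ => ?_
    refine MeromorphicAt.mul (MeromorphicAt.const _ _) (MeromorphicAt.fun_prod fun p hp => ?_)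
    have hp0 : (p : ℂ) ≠ 0 := by exact_mod_cast (Nat.prime_of_mem_primeFactors hp).ne_zero
    have hc : ∀ g : ℂ → ℂ, Differentiable ℂ g → MeromorphicAt (fun t => 1 - 1 / (p : ℂ) ^ g t) s := by
      intro g hg
      have : AnalyticAt ℂ (fun t => (p : ℂ) ^ g t) s :=
        Differentiable.analyticAt (hg.const_cpow (Or.inl hp0)) s
      exact (MeromorphicAt.const _ _).sub ((MeromorphicAt.const _ _).div this.meromorphicAt)
    refine (MeromorphicAt.const _ _).sub (((((hc _ ?_).mul (hc _ ?_)).mul (hc _ ?_)).mul (hc _ ?_)).mul (hc _ ?_).inv) <;> fun_prop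

/-- Motohashi's product `Z = J K` as a meromorphic function on `ℂ`. The normal form changes the
pointwise product only on a discrete set: it gives removable singularities their limit value
(the bare Lean expression takes a junk value wherever a zeta factor or a `P_d` divides by zero). -/
def Z (T₁ T₂ z : ℝ) : ℂ → ℂ :=
  toMeromorphicNFOn (fun s => J T₁ T₂ s * K T₁ T₂ z s) Set.univ

/-- `c` is the sequence of coefficients of the Dirichlet series of `Z'/Z`: the series
`∑ c(n) n^{-s}` converges absolutely to `Z'/Z (s)` for all `s` of sufficiently large real part. -/
def IsLogDerivCoeff (T₁ T₂ z : ℝ) (c : ℕ → ℂ) : Prop :=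
  ∃ σ₀ : ℝ, ∀ s : ℂ, σ₀ < s.re → LSeriesHasSum c s (logDeriv (Z T₁ T₂ z) s)

/-- The smoothed coefficients `Σ_x(n)` made from the coefficients `c(n) = Σ(n)`. -/
def smoothed (x : ℝ) (c : ℕ → ℂ) (n : ℕ) : ℂ :=
  if (n : ℝ) ≤ x then c n
  else if (n : ℝ) ≤ x ^ 2 then
    c n * (((Real.log (x ^ 3 / n) ^ 2 - 2 * Real.log (x ^ 2 / n) ^ 2)
      / (2 * Real.log x ^ 2) : ℝ) : ℂ)
  else if (n : ℝ) ≤ x ^ 3 then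
    c n * ((Real.log (x ^ 3 / n) ^ 2 / (2 * Real.log x ^ 2) : ℝ) : ℂ)
  else 0

/-- The kernel `x^{u-s} (1 - x^{u-s})² / (log² x · (u-s)³)`. -/
def kernel (x : ℝ) (s u : ℂ) : ℂ :=
  (x : ℂ) ^ (u - s) * (1 - (x : ℂ) ^ (u - s)) ^ 2 / ((Real.log x : ℂ) ^ 2 * (u - s) ^ 3)

/-- Multiplicity of `u` as a zero of `f` (`0` if `u` is not a zero). -/
def zeroMult (f : ℂ → ℂ) (u : ℂ) : ℕ := (meromorphicOrderAt f u).untop₀.toNat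

/-- Multiplicity of `u` as a pole of `f` (`0` if `u` is not a pole). -/
def poleMult (f : ℂ → ℂ) (u : ℂ) : ℕ := (-(meromorphicOrderAt f u).untop₀).toNat

/-- The complex (nontrivial) zeros `ρ` of the zeta function. -/
def zetaZeros : Set ℂ := {ρ | riemannZeta ρ = 0 ∧ 0 < ρ.re ∧ ρ.re < 1}

/-- The zeros `r` of `K`, as a meromorphic function. -/
def zerosK (T₁ T₂ z : ℝ) : Set ℂ := {r | 0 < meromorphicOrderAt (K T₁ T₂ z) r}

/-- The poles `ν` of `K`, as a meromorphic function. -/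
def polesK (T₁ T₂ z : ℝ) : Set ℂ := {ν | meromorphicOrderAt (K T₁ T₂ z) ν < 0}

/-- The four shifts `0, iT₁, -iT₂, i(T₁-T₂)` of the zeta factors in the numerator of `J`. -/
def shift (T₁ T₂ : ℝ) : Fin 4 → ℂ := ![0, I * T₁, -(I * T₂), I * (T₁ - T₂)]

/-- The point `w/2 + (i/2)(T₁-T₂)` at which the denominator of `J` is `ζ(w)`. -/
def half (T₁ T₂ : ℝ) (w : ℂ) : ℂ := w / 2 + I / 2 * (T₁ - T₂)

/-- The trivial zero `-2q` of the zeta function, where `q = 1, 2, 3, …`. -/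
def trivialZero (q : ℕ+) : ℂ := -2 * ((q : ℕ) : ℂ)

end Motohashi

end

/-!
An entire function `f` with `f w = exp (O(|w|²))` has zeros sparse enough for `f'/f` to be a
Mittag-Leffler series of simple poles in which the Taylor polynomial of degree two at `s` is
subtracted from each term. `ζ(w) (w - 1)` and the finite Euler products in `K` have this growth, so
`Z` is a quotient of two such functions, and
`Z'/Z (s + p) = Z'/Z (s) + A p + B p² + ∑ m(u) p³ / ((p - (u - s)) (u - s)³)`,
where `u` runs over the zeros and poles of `Z` and `m(u)` is the order of `Z` at `u`.

For large `Re p` the left side is also the Dirichlet series `∑ Σ(n) n^{-s-p}`. After division by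
`p³` both sides are Laplace transforms in `t = log x`: the left one of the Riesz sum
`∑ Σ(n) n^{-s} (t - log n)₊² / 2`, the right one of
`Z'/Z (s) t² / 2 + A t + B + ∑ m(u) e^{(u-s)t} / (u-s)³`. By uniqueness of Laplace transforms the
two agree for every `t > 0`.

In the combination of this identity at `t`, `2 t`, `3 t` with coefficients `1, -2, 1`, the linear
part cancels, `Z'/Z (s) t² / 2` becomes `Z'/Z (s) t²`, the weights of the Riesz sum become those of
`Σ_x(n)`, and each exponential becomes `e^{(u-s)t} (1 - e^{(u-s)t})²`, the numerator of the kernel.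
-/

namespace Motohashi

/-- Entire functions `f` with `f w = exp (O((1 + |w|) ^ k))`. For these the zeros are sparse enough
for `f'/f` to be a Mittag-Leffler series normalised by a polynomial of degree `k`; the case `k = 2`
covers `ζ(w) (w - 1)`. -/
structure EntireOfGrowth (k : ℕ) (f : ℂ → ℂ) : Prop where
  differentiable : Differentiable ℂ f
  norm_le : ∃ C : ℝ, 0 ≤ C ∧ ∀ w, ‖f w‖ ≤ Real.exp (C * (1 + ‖w‖) ^ k)

namespace EntireOfGrowth

variable {k l : ℕ} {f g : ℂ → ℂ}

theorem of_norm_le (hf : Differentiable ℂ f) {C R : ℝ}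
    (h : ∀ w, R ≤ ‖w‖ → ‖f w‖ ≤ Real.exp (C * (1 + ‖w‖) ^ k)) : EntireOfGrowth k f := by
  obtain ⟨B, hB⟩ := (isCompact_closedBall (0 : ℂ) R).exists_bound_of_continuousOn
    hf.continuous.continuousOn
  refine ⟨hf, |C| + |B|, by positivity, fun w => ?_⟩
  have one_le : 1 ≤ (1 + ‖w‖) ^ k := one_le_pow₀ (by linarith [norm_nonneg w])
  rcases le_total R ‖w‖ with hR | hR
  · refine (h w hR).trans (Real.exp_le_exp.2 ?_)
    gcongr
    linarith [le_abs_self C, abs_nonneg B]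
  · calc ‖f w‖ ≤ B := hB w (by simpa using hR)
      _ ≤ |B| * 1 := by simpa using le_abs_self B
      _ ≤ (|C| + |B|) * (1 + ‖w‖) ^ k := by gcongr; linarith [abs_nonneg C]
      _ ≤ _ := by linarith [Real.add_one_le_exp ((|C| + |B|) * (1 + ‖w‖) ^ k)]

theorem const (k : ℕ) (a : ℂ) : EntireOfGrowth k fun _ => a := by
  refine of_norm_le (C := ‖a‖) (R := 0) (differentiable_const a) fun w _ => ?_
  have : ‖a‖ * 1 ≤ ‖a‖ * (1 + ‖w‖) ^ k := by
    gcongr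
    exact one_le_pow₀ (by linarith [norm_nonneg w])
  linarith [Real.add_one_le_exp (‖a‖ * (1 + ‖w‖) ^ k)]

theorem mono (hf : EntireOfGrowth k f) (hkl : k ≤ l) : EntireOfGrowth l f := by
  obtain ⟨C, hC, hfC⟩ := hf.norm_le
  refine ⟨hf.differentiable, C, hC, fun w => (hfC w).trans (Real.exp_le_exp.2 ?_)⟩
  gcongr
  linarith [norm_nonneg w]

theorem mul (hf : EntireOfGrowth k f) (hg : EntireOfGrowth k g) :
    EntireOfGrowth k fun w => f w * g w := by
  obtain ⟨C, hC, hfC⟩ := hf.norm_le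
  obtain ⟨D, hD, hgD⟩ := hg.norm_le
  refine ⟨hf.differentiable.mul hg.differentiable, C + D, by positivity, fun w => ?_⟩
  rw [norm_mul, add_mul, Real.exp_add]
  gcongr
  exacts [hfC w, hgD w]

theorem add (hf : EntireOfGrowth k f) (hg : EntireOfGrowth k g) :
    EntireOfGrowth k fun w => f w + g w := by
  obtain ⟨C, hC, hfC⟩ := hf.norm_le
  obtain ⟨D, hD, hgD⟩ := hg.norm_le
  refine ⟨hf.differentiable.add hg.differentiable, C + D + 1, by positivity, fun w => ?_⟩
  set E := (1 + ‖w‖) ^ k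
  have one_le : 1 ≤ E := one_le_pow₀ (by linarith [norm_nonneg w])
  have le_left : Real.exp (C * E) ≤ Real.exp ((C + D) * E) :=
    Real.exp_le_exp.2 (by gcongr; linarith)
  have le_right : Real.exp (D * E) ≤ Real.exp ((C + D) * E) :=
    Real.exp_le_exp.2 (by gcongr; linarith)
  calc ‖f w + g w‖ ≤ ‖f w‖ + ‖g w‖ := norm_add_le _ _
    _ ≤ Real.exp ((C + D) * E) * 2 := by linarith [hfC w, hgD w]
    _ ≤ Real.exp ((C + D) * E) * Real.exp E := by
        gcongr
        linarith [Real.add_one_le_exp E]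
    _ = Real.exp ((C + D + 1) * E) := by rw [← Real.exp_add]; ring_nf

theorem neg (hf : EntireOfGrowth k f) : EntireOfGrowth k fun w => -f w :=
  ⟨hf.differentiable.neg, by simpa only [norm_neg] using hf.norm_le⟩

theorem sub (hf : EntireOfGrowth k f) (hg : EntireOfGrowth k g) :
    EntireOfGrowth k fun w => f w - g w := by
  simpa only [sub_eq_add_neg] using hf.add hg.neg

theorem comp_affine (hf : EntireOfGrowth k f) (a b : ℂ) :
    EntireOfGrowth k fun w => f (a * w + b) := by
  obtain ⟨C, hC, hfC⟩ := hf.norm_le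
  refine ⟨hf.differentiable.comp (by fun_prop), C * (1 + ‖a‖ + ‖b‖) ^ k, by positivity,
    fun w => (hfC _).trans (Real.exp_le_exp.2 ?_)⟩
  rw [mul_assoc, ← mul_pow]
  gcongr
  calc 1 + ‖a * w + b‖ ≤ 1 + (‖a‖ * ‖w‖ + ‖b‖) := by
        gcongr
        exact (norm_add_le _ _).trans (by rw [norm_mul])
    _ ≤ (1 + ‖a‖ + ‖b‖) * (1 + ‖w‖) := by
        linarith [norm_nonneg w, norm_nonneg a, mul_nonneg (norm_nonneg b) (norm_nonneg w)]

end EntireOfGrowth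

theorem entireOfGrowth_exp : EntireOfGrowth 1 Complex.exp := by
  refine .of_norm_le (C := 1) (R := 0) Complex.differentiable_exp fun w _ => ?_
  rw [Complex.norm_exp]
  exact Real.exp_le_exp.2 ((Complex.re_le_norm w).trans (by linarith))

section Divisibility

variable {f g p : ℂ → ℂ} {z : ℂ}

theorem analyticOrderAt_ne_top_of_apply_ne_zero (hf : Differentiable ℂ f) (hz : f z ≠ 0) (u : ℂ) :
    analyticOrderAt f u ≠ ⊤ := by
  intro htop
  have hzero := AnalyticOnNhd.eqOn_zero_of_preconnected_of_eventuallyEq_zero (U := Set.univ)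
    (fun x _ => hf.analyticAt x) isPreconnected_univ (Set.mem_univ u)
    (analyticOrderAt_eq_top.1 htop)
  exact hz (hzero (Set.mem_univ z))

theorem analyticOrderNatAt_eq_zero_of_apply_ne_zero (hz : f z ≠ 0) : analyticOrderNatAt f z = 0 :=
  not_not.1 (mt apply_eq_zero_of_analyticOrderNatAt_ne_zero hz)

theorem exists_eq_mul_of_analyticOrderAt_le (hf : Differentiable ℂ f) (hp : Differentiable ℂ p)
    (hz : p z ≠ 0) (hle : ∀ u, analyticOrderAt p u ≤ analyticOrderAt f u) :
    ∃ g : ℂ → ℂ, Differentiable ℂ g ∧ ∀ w, f w = p w * g w := by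
  have hfp : MeromorphicOn (f / p) Set.univ := fun u _ =>
    (hf.analyticAt u).meromorphicAt.div (hp.analyticAt u).meromorphicAt
  have order_nonneg (u : ℂ) : 0 ≤ meromorphicOrderAt (f / p) u := by
    rw [meromorphicOrderAt_div (hf.analyticAt u).meromorphicAt (hp.analyticAt u).meromorphicAt,
      (hf.analyticAt u).meromorphicOrderAt_eq, (hp.analyticAt u).meromorphicOrderAt_eq]
    refine LinearOrderedAddCommGroupWithTop.sub_self_nonneg.trans
      ((LinearOrderedAddCommGroupWithTop.sub_le_sub_iff_left_of_ne_top ?_).2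
        (ENat.monotone_map_iff.2 Nat.mono_cast (hle u)))
    simpa using analyticOrderAt_ne_top_of_apply_ne_zero hp hz u
  set g := toMeromorphicNFOn (f / p) Set.univ
  have hg : Differentiable ℂ g := fun u => by
    refine ((meromorphicNFOn_toMeromorphicNFOn (f / p) Set.univ
      (Set.mem_univ u)).meromorphicOrderAt_nonneg_iff_analyticAt.1 ?_).differentiableAt
    rw [meromorphicOrderAt_toMeromorphicNFOn hfp (Set.mem_univ u)]
    exact order_nonneg u
  refine ⟨g, hg, fun w => ?_⟩
  have punctured : f =ᶠ[𝓝[≠] w] fun v => p v * g v := by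
    filter_upwards [hfp.toMeromorphicNFOn_eq_self_on_nhdsNE (Set.mem_univ w),
      (hp.analyticAt w).eventually_eq_zero_or_eventually_ne_zero.resolve_left
        (mt analyticOrderAt_eq_top.2 (analyticOrderAt_ne_top_of_apply_ne_zero hp hz w))]
      with v hgv hpv
    simp only [g, hgv, Pi.div_apply]
    field_simp
  exact tendsto_nhds_unique (hf.continuous.continuousAt.mono_left nhdsWithin_le_nhds)
    (((hp.mul hg).continuous.continuousAt.mono_left nhdsWithin_le_nhds).congr' punctured.symm)

theorem analyticOrderAt_one_sub_div {u : ℂ} (hu : u ≠ 0) (v : ℂ) :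
    analyticOrderAt (fun w : ℂ => 1 - w / u) v = if v = u then 1 else 0 := by
  split_ifs with h
  · refine AnalyticAt.analyticOrderAt_eq_one_of_zero_deriv_ne_zero (by fun_prop) ?_ ?_
    · rw [h, div_self hu, sub_self]
    · simpa using hu
  · refine (AnalyticAt.analyticOrderAt_eq_zero (by fun_prop)).2 fun h0 => h ?_
    rwa [sub_eq_zero, eq_div_iff hu, one_mul, eq_comm] at h0

/-- The polynomial with the zeros of `f` in `S`, normalised to the value `1` at the origin. The
origin must not be a zero of `f`. -/
noncomputable def zeroFactor (f : ℂ → ℂ) (S : Finset ℂ) (w : ℂ) : ℂ :=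
  ∏ u ∈ S, (1 - w / u) ^ analyticOrderNatAt f u

theorem analyticOrderAt_finset_prod {ι : Type*} (S : Finset ι) {F : ι → ℂ → ℂ} {v : ℂ}
    (hF : ∀ i ∈ S, AnalyticAt ℂ (F i) v) :
    analyticOrderAt (fun w => ∏ i ∈ S, F i w) v = ∑ i ∈ S, analyticOrderAt (F i) v := by
  classical
  induction S using Finset.induction_on with
  | empty =>
    simpa using (analyticAt_const (v := (1 : ℂ))).analyticOrderAt_eq_zero.2 one_ne_zero
  | insert i S hi ih =>
    have hS : ∀ j ∈ S, AnalyticAt ℂ (F j) v := fun j hj => hF j (Finset.mem_insert_of_mem hj)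
    simp only [Finset.prod_insert hi, Finset.sum_insert hi]
    rw [← ih hS]
    exact analyticOrderAt_mul (hF i (Finset.mem_insert_self i S)) (S.analyticAt_fun_prod hS)

theorem differentiable_zeroFactor (f : ℂ → ℂ) (S : Finset ℂ) :
    Differentiable ℂ (zeroFactor f S) := by
  unfold zeroFactor
  fun_prop

theorem zeroFactor_apply_zero (f : ℂ → ℂ) (S : Finset ℂ) : zeroFactor f S 0 = 1 := by
  simp [zeroFactor]

theorem analyticOrderAt_zeroFactor (hf : Differentiable ℂ f) (h0 : f 0 ≠ 0) (S : Finset ℂ) (v : ℂ) :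
    analyticOrderAt (zeroFactor f S) v = if v ∈ S then analyticOrderAt f v else 0 := by
  unfold zeroFactor
  rw [analyticOrderAt_finset_prod S fun u _ => by fun_prop]
  have order_factor (u : ℂ) : analyticOrderAt (fun w => (1 - w / u) ^ analyticOrderNatAt f u) v =
      if v = u then analyticOrderAt f v else 0 := by
    rcases eq_or_ne u 0 with rfl | hu
    · simp only [analyticOrderNatAt_eq_zero_of_apply_ne_zero h0, pow_zero]
      rw [analyticAt_const.analyticOrderAt_eq_zero.2 one_ne_zero]
      split_ifs with hv
      · rw [hv, (hf.analyticAt 0).analyticOrderAt_eq_zero.2 h0]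
      · rfl
    · refine (analyticOrderAt_pow (f := fun w => 1 - w / u) (by fun_prop) _).trans ?_
      rw [analyticOrderAt_one_sub_div hu]
      split_ifs with hvu
      · rw [hvu, nsmul_one, Nat.cast_analyticOrderNatAt
          (analyticOrderAt_ne_top_of_apply_ne_zero hf h0 u)]
      · exact smul_zero _
  simp only [order_factor, Finset.sum_ite_eq]

theorem exists_eq_zeroFactor_mul (hf : Differentiable ℂ f) (h0 : f 0 ≠ 0) (S : Finset ℂ) :
    ∃ g : ℂ → ℂ, Differentiable ℂ g ∧ (∀ w, f w = zeroFactor f S w * g w) ∧ ∀ u ∈ S, g u ≠ 0 := by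
  have hp : Differentiable ℂ (zeroFactor f S) := differentiable_zeroFactor f S
  have order_le (u : ℂ) : analyticOrderAt (zeroFactor f S) u ≤ analyticOrderAt f u := by
    rw [analyticOrderAt_zeroFactor hf h0]
    split_ifs
    exacts [le_rfl, zero_le]
  obtain ⟨g, hg, hfac⟩ := exists_eq_mul_of_analyticOrderAt_le hf hp
    (zeroFactor_apply_zero f S ▸ one_ne_zero) order_le
  refine ⟨g, hg, hfac, fun u hu => (hg.analyticAt u).analyticOrderAt_eq_zero.1 ?_⟩
  have order_mul := analyticOrderAt_mul (hp.analyticAt u) (hg.analyticAt u)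
  rw [show zeroFactor f S * g = f from (funext hfac).symm, analyticOrderAt_zeroFactor hf h0,
    if_pos hu] at order_mul
  exact ENat.add_right_injective_of_ne_top (analyticOrderAt_ne_top_of_apply_ne_zero hf h0 u)
    (order_mul.symm.trans (add_zero _).symm)

end Divisibility

section CountingZeros

variable {k : ℕ} {f g : ℂ → ℂ} {R : ℝ} {S : Finset ℂ}

theorem finite_zeros_norm_le (hf : Differentiable ℂ f) {z : ℂ} (hz : f z ≠ 0) (R : ℝ) :
    {u | f u = 0 ∧ ‖u‖ ≤ R}.Finite := by
  have hcodiscrete := mem_codiscrete'.1 <|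
    AnalyticOnNhd.preimage_zero_mem_codiscrete (x := z) (fun x _ => hf.analyticAt x) hz
  have hclosed : IsClosed (f ⁻¹' {0}) := by simpa using hcodiscrete.1
  have hdiscrete : IsDiscrete (f ⁻¹' {0}) := by simpa using hcodiscrete.2
  refine (((isCompact_closedBall (0 : ℂ) R).inter_right hclosed).finite
    (hdiscrete.mono Set.inter_subset_right)).subset ?_
  rintro u ⟨hu, huR⟩
  exact ⟨by simpa using huR, hu⟩

theorem two_pow_le_norm_zeroFactor (hS : ∀ u ∈ S, u ≠ 0 ∧ ‖u‖ ≤ R) {v : ℂ} (hv : 3 * R ≤ ‖v‖) :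
    2 ^ (∑ u ∈ S, analyticOrderNatAt f u) ≤ ‖zeroFactor f S v‖ := by
  rw [zeroFactor, norm_prod, ← Finset.prod_pow_eq_pow_sum]
  gcongr with u hu
  rw [norm_pow]
  gcongr
  have three_le : 3 ≤ ‖v / u‖ := by
    rw [norm_div, le_div_iff₀ (norm_pos_iff.2 (hS u hu).1)]
    linarith [(hS u hu).2]
  have := norm_sub_norm_le (v / u) 1
  rw [norm_one, norm_sub_rev] at this
  linarith

/-- Each factor `1 - w / u` with `‖u‖ ≤ R` has modulus at least `2` on the circle `‖w‖ = 3 R`;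
the maximum principle carries the resulting bound for `g` into the disc. -/
theorem two_pow_mul_norm_le {C : ℝ} (hf : ∀ w, ‖f w‖ ≤ Real.exp (C * (1 + ‖w‖) ^ k))
    (hg : Differentiable ℂ g) (hfac : ∀ w, f w = zeroFactor f S w * g w) (hR : 0 < R)
    (hS : ∀ u ∈ S, u ≠ 0 ∧ ‖u‖ ≤ R) {w : ℂ} (hw : ‖w‖ ≤ 3 * R) :
    2 ^ (∑ u ∈ S, analyticOrderNatAt f u) * ‖g w‖ ≤ Real.exp (C * (1 + 3 * R) ^ k) := by
  have h3R : 3 * R ≠ 0 := by positivity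
  have le_on_circle : ∀ v ∈ frontier (Metric.ball (0 : ℂ) (3 * R)), ‖g v‖ ≤
      Real.exp (C * (1 + 3 * R) ^ k) / 2 ^ ∑ u ∈ S, analyticOrderNatAt f u := by
    intro v hv
    rw [frontier_ball _ h3R, mem_sphere_zero_iff_norm] at hv
    rw [le_div_iff₀ (by positivity), mul_comm]
    refine le_trans ?_ (hv ▸ hf v)
    rw [hfac v, norm_mul]
    gcongr
    exact two_pow_le_norm_zeroFactor hS hv.ge
  have := Complex.norm_le_of_forall_mem_frontier_norm_le Metric.isBounded_ball
    hg.diffContOnCl le_on_circle (z := w) (by rwa [closure_ball _ h3R, mem_closedBall_zero_iff])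
  rwa [le_div_iff₀ (by positivity), mul_comm] at this

namespace EntireOfGrowth

theorem exists_sum_analyticOrderNatAt_le (hf : EntireOfGrowth k f) (h0 : f 0 ≠ 0) :
    ∃ D : ℝ, 0 ≤ D ∧ ∀ R : ℝ, 1 ≤ R → ∀ S : Finset ℂ, (∀ u ∈ S, f u = 0 ∧ ‖u‖ ≤ R) →
      ∑ u ∈ S, (analyticOrderNatAt f u : ℝ) ≤ D * R ^ k := by
  obtain ⟨C, hC, hfC⟩ := hf.norm_le
  refine ⟨(C * 4 ^ k + |Real.log ‖f 0‖|) / Real.log 2, by positivity, fun R hR S hS => ?_⟩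
  obtain ⟨g, hg, hfac, -⟩ := exists_eq_zeroFactor_mul hf.differentiable h0 S
  have hpos : 0 < ‖f 0‖ := norm_pos_iff.2 h0
  have hg0 : g 0 = f 0 := by rw [hfac 0, zeroFactor_apply_zero, one_mul]
  have hcount := two_pow_mul_norm_le hfC hg hfac (one_pos.trans_le hR)
    (fun u hu => ⟨fun h => h0 (h ▸ (hS u hu).1), (hS u hu).2⟩) (w := 0)
    (by rw [norm_zero]; positivity)
  have hlog := Real.log_le_log (by rw [hg0]; positivity) hcount
  rw [hg0, Real.log_exp, Real.log_mul (by positivity) hpos.ne', Real.log_pow] at hlog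
  rw [← Nat.cast_sum, div_mul_eq_mul_div, le_div_iff₀ (Real.log_pos one_lt_two)]
  have growth_le : C * (1 + 3 * R) ^ k ≤ C * 4 ^ k * R ^ k := by
    rw [mul_assoc, ← mul_pow]
    gcongr
    linarith
  have log_le : |Real.log ‖f 0‖| * 1 ≤ |Real.log ‖f 0‖| * R ^ k := by
    gcongr
    exact one_le_pow₀ hR
  linarith [neg_abs_le (Real.log ‖f 0‖)]

end EntireOfGrowth

theorem summable_div_pow_succ_of_sum_le {ι : Type*} {m ρ : ι → ℝ} (hm : ∀ i, 0 ≤ m i)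
    (hρ : ∀ i, 1 ≤ ρ i) {D : ℝ}
    (hD : ∀ R : ℝ, 1 ≤ R → ∀ S : Finset ι, (∀ i ∈ S, ρ i ≤ R) → ∑ i ∈ S, m i ≤ D * R ^ k) :
    Summable fun i => m i / ρ i ^ (k + 1) := by
  classical
  have D_nonneg : 0 ≤ D := by simpa using hD 1 le_rfl ∅ (by simp)
  have hdyadic (i : ι) : ∃ n : ℕ, 2 ^ n ≤ ρ i ∧ ρ i < 2 ^ (n + 1) :=
    exists_nat_pow_near (hρ i) one_lt_two
  choose n hle hlt using hdyadic
  have shell_le (S : Finset ι) (j : ℕ) :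
      ∑ i ∈ S with n i = j, m i / ρ i ^ (k + 1) ≤ D * 2 ^ k * (1 / 2) ^ j := by
    calc ∑ i ∈ S with n i = j, m i / ρ i ^ (k + 1)
        ≤ ∑ i ∈ S with n i = j, m i / (2 ^ j) ^ (k + 1) := by
          gcongr with i hi
          · exact hm i
          · exact (Finset.mem_filter.1 hi).2 ▸ hle i
      _ = (∑ i ∈ S with n i = j, m i) / (2 ^ j) ^ (k + 1) := by rw [Finset.sum_div]
      _ ≤ D * (2 ^ (j + 1)) ^ k / (2 ^ j) ^ (k + 1) := by
          gcongr
          exact hD _ (one_le_pow₀ one_le_two) _ fun i hi =>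
            ((Finset.mem_filter.1 hi).2 ▸ hlt i).le
      _ = D * 2 ^ k * (1 / 2) ^ j := by
          rw [pow_succ 2 j, mul_pow, one_div_pow, pow_succ]
          field_simp
  refine summable_of_sum_le (c := D * 2 ^ k * 2)
    (fun i => div_nonneg (hm i) (pow_nonneg (zero_le_one.trans (hρ i)) _)) fun S => ?_
  rw [← Finset.sum_fiberwise_of_maps_to (t := S.image n) fun i hi => Finset.mem_image_of_mem n hi]
  calc ∑ j ∈ S.image n, ∑ i ∈ S with n i = j, m i / ρ i ^ (k + 1)
      ≤ ∑ j ∈ S.image n, D * 2 ^ k * (1 / 2) ^ j := Finset.sum_le_sum fun j _ => shell_le S j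
    _ = D * 2 ^ k * ∑ j ∈ S.image n, (1 / 2) ^ j := by rw [Finset.mul_sum]
    _ ≤ D * 2 ^ k * 2 := by
        gcongr
        exact (summable_geometric_two.sum_le_tsum _ fun _ _ => by positivity).trans
          tsum_geometric_two.le

theorem exists_pos_forall_le_norm_sub (hf : Continuous f) {w : ℂ} (hw : f w ≠ 0) :
    ∃ δ : ℝ, 0 < δ ∧ ∀ u, f u = 0 → δ ≤ ‖u - w‖ := by
  obtain ⟨δ, hδ, hball⟩ := Metric.isOpen_iff.1 (isOpen_ne.preimage hf) w hw
  refine ⟨δ, hδ, fun u hu => ?_⟩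
  by_contra! hlt
  exact hball (mem_ball_iff_norm.2 hlt) hu

namespace EntireOfGrowth

theorem summable_analyticOrderNatAt_div_norm_pow (hf : EntireOfGrowth k f) (h0 : f 0 ≠ 0) :
    Summable fun u : ℂ => (analyticOrderNatAt f u : ℝ) / ‖u‖ ^ (k + 1) := by
  obtain ⟨D, _, hcount⟩ := hf.exists_sum_analyticOrderNatAt_le h0
  have hsum : Summable fun u : ℂ => (analyticOrderNatAt f u : ℝ) / (1 + ‖u‖) ^ (k + 1) := by
    refine summable_div_pow_succ_of_sum_le (D := D) (fun u => by positivity)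
      (fun u => by simp) fun R hR S hS => ?_
    rw [← Finset.sum_filter_of_ne (p := fun u => f u = 0) fun u _ hu => by
      by_contra hfu; simp [analyticOrderNatAt_eq_zero_of_apply_ne_zero hfu] at hu]
    refine hcount R hR _ fun u hu => ?_
    rw [Finset.mem_filter] at hu
    exact ⟨hu.2, by linarith [hS u hu.1]⟩
  obtain ⟨δ, hδ, hzero⟩ := exists_pos_forall_le_norm_sub hf.differentiable.continuous h0
  refine .of_nonneg_of_le (fun u => by positivity) (fun u => ?_)
    (hsum.mul_left ((1 / δ + 1) ^ (k + 1)))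
  by_cases hu : f u = 0
  · have hδu : δ ≤ ‖u‖ := by simpa using hzero u hu
    have hu0 : 0 < ‖u‖ := hδ.trans_le hδu
    have : 1 + ‖u‖ ≤ (1 / δ + 1) * ‖u‖ := by
      rw [add_mul, one_mul, one_div_mul_eq_div]
      gcongr
      exact (one_le_div hδ).2 hδu
    calc (analyticOrderNatAt f u : ℝ) / ‖u‖ ^ (k + 1)
        = (1 / δ + 1) ^ (k + 1) * (analyticOrderNatAt f u / ((1 / δ + 1) * ‖u‖) ^ (k + 1)) := by
          rw [mul_pow]
          field_simp
      _ ≤ (1 / δ + 1) ^ (k + 1) * (analyticOrderNatAt f u / (1 + ‖u‖) ^ (k + 1)) := by gcongr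
  · simp [analyticOrderNatAt_eq_zero_of_apply_ne_zero hu]

theorem summable_analyticOrderNatAt_div (hf : EntireOfGrowth k f) (h0 : f 0 ≠ 0) {w : ℂ}
    (hw : f w ≠ 0) :
    Summable fun u : ℂ => (analyticOrderNatAt f u : ℂ) / (u ^ (k + 1) * (w - u)) := by
  obtain ⟨δ, hδ, hzero⟩ := exists_pos_forall_le_norm_sub hf.differentiable.continuous hw
  refine .of_norm_bounded ((hf.summable_analyticOrderNatAt_div_norm_pow h0).mul_left (1 / δ))
    fun u => ?_
  by_cases hu : f u = 0
  · have hu0 : 0 < ‖u‖ := norm_pos_iff.2 fun h => h0 (h ▸ hu)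
    rw [norm_div, norm_mul, norm_pow, Complex.norm_natCast, div_mul_div_comm, one_mul, mul_comm δ,
      norm_sub_rev]
    gcongr
    exact hzero u hu
  · simp [analyticOrderNatAt_eq_zero_of_apply_ne_zero hu]

end EntireOfGrowth

end CountingZeros

section TaylorRemainder

variable {φ ψ : ℂ → ℂ} {U : Set ℂ}

/-- The `n`-th Taylor remainder `(φ w - ∑_{i < n} aᵢ wⁱ) / wⁿ` of `φ` at the origin, where the `aᵢ`
are the Taylor coefficients; as an iterated `dslope` it has the right value at `w = 0` too. -/
noncomputable def taylorRem (n : ℕ) (φ : ℂ → ℂ) : ℂ → ℂ := (fun ψ => dslope ψ 0)^[n] φ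

theorem taylorRem_succ (n : ℕ) (φ : ℂ → ℂ) : taylorRem (n + 1) φ = dslope (taylorRem n φ) 0 :=
  Function.iterate_succ_apply' _ _ _

theorem eq_sum_add_pow_mul_taylorRem (n : ℕ) (φ : ℂ → ℂ) (w : ℂ) :
    φ w = ∑ i ∈ Finset.range n, taylorRem i φ 0 * w ^ i + w ^ n * taylorRem n φ w := by
  induction n with
  | zero => simp [taylorRem]
  | succ n ih =>
    have hslope := sub_smul_dslope (taylorRem n φ) 0 w
    rw [sub_zero, smul_eq_mul] at hslope
    rw [Finset.sum_range_succ, taylorRem_succ]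
    linear_combination ih - w ^ n * hslope

theorem eqOn_dslope (hU : U ∈ 𝓝 0) (h : Set.EqOn φ ψ U) :
    Set.EqOn (dslope φ 0) (dslope ψ 0) U := by
  intro w hw
  rcases eq_or_ne w 0 with rfl | hw0
  · rw [dslope_same, dslope_same]
    exact (h.eventuallyEq_of_mem hU).deriv_eq
  · rw [dslope_of_ne _ hw0, dslope_of_ne _ hw0, slope_def_field, slope_def_field, h hw,
      h (mem_of_mem_nhds hU)]

theorem eqOn_taylorRem (n : ℕ) (hU : U ∈ 𝓝 0) (h : Set.EqOn φ ψ U) :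
    Set.EqOn (taylorRem n φ) (taylorRem n ψ) U := by
  induction n with
  | zero => exact h
  | succ n ih => simpa only [taylorRem_succ] using eqOn_dslope hU ih

theorem differentiableOn_taylorRem (n : ℕ) (hU : U ∈ 𝓝 0) (hφ : DifferentiableOn ℂ φ U) :
    DifferentiableOn ℂ (taylorRem n φ) U := by
  induction n with
  | zero => exact hφ
  | succ n ih => simpa only [taylorRem_succ] using (Complex.differentiableOn_dslope hU).2 ih

theorem dslope_add (hφ : DifferentiableAt ℂ φ 0) (hψ : DifferentiableAt ℂ ψ 0) :
    dslope (fun w => φ w + ψ w) 0 = fun w => dslope φ 0 w + dslope ψ 0 w := by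
  funext w
  rcases eq_or_ne w 0 with rfl | hw0
  · rw [dslope_same, dslope_same, dslope_same, deriv_fun_add hφ hψ]
  · simp only [dslope_of_ne _ hw0, slope_def_field]
    ring

theorem taylorRem_add (n : ℕ) (hU : U ∈ 𝓝 0) (hφ : DifferentiableOn ℂ φ U)
    (hψ : DifferentiableOn ℂ ψ U) :
    taylorRem n (fun w => φ w + ψ w) = fun w => taylorRem n φ w + taylorRem n ψ w := by
  induction n with
  | zero => rfl
  | succ n ih =>
    rw [taylorRem_succ, taylorRem_succ, taylorRem_succ, ih,
      dslope_add ((differentiableOn_taylorRem n hU hφ).differentiableAt hU)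
        ((differentiableOn_taylorRem n hU hψ).differentiableAt hU)]

theorem taylorRem_zero_fun (n : ℕ) : taylorRem n (fun _ => 0) = fun _ => 0 := by
  induction n with
  | zero => rfl
  | succ n ih =>
    rw [taylorRem_succ, ih]
    funext w
    rcases eq_or_ne w 0 with rfl | hw0
    · rw [dslope_same, deriv_const]
    · rw [dslope_of_ne _ hw0, slope_def_field, sub_self, zero_div]

theorem taylorRem_sum (n : ℕ) {ι : Type*} (S : Finset ι) {F : ι → ℂ → ℂ} (hU : U ∈ 𝓝 0)
    (hF : ∀ i ∈ S, DifferentiableOn ℂ (F i) U) :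
    taylorRem n (fun w => ∑ i ∈ S, F i w) = fun w => ∑ i ∈ S, taylorRem n (F i) w := by
  classical
  induction S using Finset.induction_on with
  | empty => exact taylorRem_zero_fun n
  | insert i S hi ih =>
    have hS : ∀ j ∈ S, DifferentiableOn ℂ (F j) U := fun j hj => hF j (Finset.mem_insert_of_mem hj)
    simp only [Finset.sum_insert hi]
    rw [taylorRem_add n hU (hF i (Finset.mem_insert_self i S)) (DifferentiableOn.fun_sum hS), ih hS]

theorem eqOn_dslope_div_sub (c : ℂ) {u : ℂ} (hu : u ≠ 0) :
    Set.EqOn (dslope (fun w => c / (w - u)) 0) (fun w => c / u / (w - u)) {u}ᶜ := by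
  intro w hw
  have hwu : w - u ≠ 0 := sub_ne_zero.2 hw
  rcases eq_or_ne w 0 with rfl | hw0
  · have hderiv : HasDerivAt (fun w : ℂ => c / (w - u)) (c / u / (0 - u)) 0 := by
      have hinv := ((hasDerivAt_id (0 : ℂ)).sub_const u).inv hwu
      refine (hinv.const_mul c).congr_deriv ?_
      simp only [id, zero_sub]
      field_simp
    rw [dslope_same, hderiv.deriv]
  · rw [dslope_of_ne _ hw0, slope_def_field]
    field_simp
    ring

theorem eqOn_taylorRem_div_sub (n : ℕ) (c : ℂ) {u : ℂ} (hu : u ≠ 0) :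
    Set.EqOn (taylorRem n fun w => c / (w - u)) (fun w => c / (u ^ n * (w - u))) {u}ᶜ := by
  induction n generalizing c with
  | zero => exact fun w _ => by simp [taylorRem]
  | succ n ih =>
    have hU : ({u}ᶜ : Set ℂ) ∈ 𝓝 0 := isOpen_compl_singleton.mem_nhds hu.symm
    rw [taylorRem_succ]
    refine (eqOn_dslope hU (ih c)).trans ?_
    simp only [← div_div]
    exact (eqOn_dslope_div_sub _ hu).trans fun w _ => by simp only [pow_succ, div_div]

theorem norm_dslope_le {r A : ℝ} (hr : 0 < r) (hφ : DifferentiableOn ℂ φ (Metric.closedBall 0 r))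
    (hA : ∀ w, ‖w‖ ≤ r → ‖φ w‖ ≤ A) {w : ℂ} (hw : ‖w‖ ≤ r) : ‖dslope φ 0 w‖ ≤ 2 * A / r := by
  have hdiff : DiffContOnCl ℂ (dslope φ 0) (Metric.ball 0 r) := by
    refine DifferentiableOn.diffContOnCl ?_
    rw [closure_ball _ hr.ne']
    exact (Complex.differentiableOn_dslope (Metric.closedBall_mem_nhds _ hr)).2 hφ
  refine Complex.norm_le_of_forall_mem_frontier_norm_le Metric.isBounded_ball hdiff ?_
    (by rw [closure_ball _ hr.ne']; exact mem_closedBall_zero_iff.2 hw)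
  intro v hv
  rw [frontier_ball _ hr.ne', mem_sphere_zero_iff_norm] at hv
  have hv0 : v ≠ 0 := norm_pos_iff.1 (hv ▸ hr)
  rw [dslope_of_ne _ hv0, slope_def_field, sub_zero, norm_div, hv]
  gcongr
  calc ‖φ v - φ 0‖ ≤ ‖φ v‖ + ‖φ 0‖ := norm_sub_le _ _
    _ ≤ 2 * A := by linarith [hA v hv.le, hA 0 (norm_zero.trans_le hr.le)]

theorem norm_taylorRem_le (n : ℕ) {r A : ℝ} (hr : 0 < r)
    (hφ : DifferentiableOn ℂ φ (Metric.closedBall 0 r)) (hA : ∀ w, ‖w‖ ≤ r → ‖φ w‖ ≤ A) {w : ℂ}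
    (hw : ‖w‖ ≤ r) : ‖taylorRem n φ w‖ ≤ 2 ^ n * A / r ^ n := by
  induction n generalizing w with
  | zero => simpa [taylorRem] using hA w hw
  | succ n ih =>
    have hdiff := differentiableOn_taylorRem n (Metric.closedBall_mem_nhds _ hr) hφ
    rw [taylorRem_succ]
    refine (norm_dslope_le hr hdiff (fun v hv => ih hv) hw).trans_eq ?_
    field_simp
    ring

end TaylorRemainder

section LogDeriv

variable {f g : ℂ → ℂ} {R : ℝ}

theorem differentiableAt_logDeriv (hg : Differentiable ℂ g) {w : ℂ} (hw : g w ≠ 0) :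
    DifferentiableAt ℂ (logDeriv g) w :=
  (hg.deriv w).div (hg w) hw

theorem exists_log_on_ball (hg : Differentiable ℂ g) (hg0 : ∀ w, ‖w‖ < R → g w ≠ 0) :
    ∃ h : ℂ → ℂ, h 0 = 0 ∧ (∀ w, ‖w‖ < R → HasDerivAt h (logDeriv g w) w) ∧
      ∀ w, ‖w‖ < R → g w = g 0 * Complex.exp (h w) := by
  have hlogDeriv : DifferentiableOn ℂ (logDeriv g) (Metric.ball 0 R) := fun w hw =>
    (differentiableAt_logDeriv hg (hg0 w (mem_ball_zero_iff.1 hw))).differentiableWithinAt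
  obtain ⟨h, hh0, hh⟩ := hlogDeriv.isExactOn_ball.with_val_at 0 0
  refine ⟨h, hh0, fun w hw => hh w (mem_ball_zero_iff.2 hw), fun w hw => ?_⟩
  have hexp : ∀ v ∈ Metric.ball (0 : ℂ) R,
      HasDerivAt (fun w => Complex.exp (h w)) (Complex.exp (h v) * logDeriv g v) v :=
    fun v hv => (hh v hv).cexp
  obtain ⟨c, -, hc⟩ := (logDeriv_eqOn_iff hg.differentiableOn
    (fun v hv => (hexp v hv).differentiableAt.differentiableWithinAt) Metric.isOpen_ball
    (convex_ball 0 R).isPreconnected (fun v _ => Complex.exp_ne_zero (h v))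
    (fun v hv => hg0 v (mem_ball_zero_iff.1 hv))).1 fun v hv => by
      rw [logDeriv_apply (fun w => Complex.exp (h w)), (hexp v hv).deriv,
        mul_div_cancel_left₀ _ (Complex.exp_ne_zero _)]
  have hc0 : g 0 = c := by
    simpa [hh0] using hc (mem_ball_zero_iff.2 (norm_zero.trans_lt ((norm_nonneg w).trans_lt hw)))
  rw [hc (mem_ball_zero_iff.2 hw), hc0, Pi.smul_apply, smul_eq_mul]

theorem norm_logDeriv_le {M : ℝ} (hM : 0 < M) (hR : 0 < R) (hg : Differentiable ℂ g)
    (hg0 : ∀ w, ‖w‖ < R → g w ≠ 0) (hb : ∀ w, ‖w‖ < R → ‖g w‖ ≤ Real.exp M * ‖g 0‖) {w : ℂ}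
    (hw : ‖w‖ ≤ R / 4) : ‖logDeriv g w‖ ≤ 8 * M / R := by
  obtain ⟨h, hh0, hh, hexp⟩ := exists_log_on_ball hg hg0
  have hdiff : DifferentiableOn ℂ h (Metric.ball 0 R) := fun v hv =>
    (hh v (mem_ball_zero_iff.1 hv)).differentiableAt.differentiableWithinAt
  have hre : Set.MapsTo h (Metric.ball 0 R) {z | z.re ≤ M} := fun v hv => by
    have hv := mem_ball_zero_iff.1 hv
    have hbv := hb v hv
    rw [hexp v hv, norm_mul, Complex.norm_exp, mul_comm] at hbv
    exact Real.exp_le_exp.1 (le_of_mul_le_mul_right hbv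
      (norm_pos_iff.2 (hg0 0 (norm_zero.trans_lt hR))))
  have hle : ∀ v, ‖v‖ ≤ R / 2 → ‖h v‖ ≤ 2 * M := fun v hv => by
    refine (Complex.borelCaratheodory_zero hM hdiff hre hR
      (mem_ball_zero_iff.2 (by linarith)) hh0).trans ?_
    rw [div_le_iff₀ (by linarith)]
    nlinarith
  have hnorm : ∀ v ∈ Metric.closedBall w (R / 4), ‖v‖ ≤ R / 2 := fun v hv => by
    have := norm_le_norm_sub_add v w
    linarith [mem_closedBall_iff_norm.1 hv]
  rw [← (hh w (by linarith)).deriv]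
  refine (Complex.norm_deriv_le_of_forall_mem_sphere_norm_le (by positivity) ?_
    fun v hv => hle v (hnorm v (Metric.sphere_subset_closedBall hv))).trans_eq
    (by field_simp; ring)
  refine DifferentiableOn.diffContOnCl (hdiff.mono fun v hv => mem_ball_zero_iff.2 ?_)
  rw [closure_ball _ (by positivity)] at hv
  linarith [hnorm v hv]

theorem norm_taylorRem_logDeriv_le (n : ℕ) {M : ℝ} (hM : 0 < M) (hR : 0 < R)
    (hg : Differentiable ℂ g) (hg0 : ∀ w, ‖w‖ < R → g w ≠ 0)
    (hb : ∀ w, ‖w‖ < R → ‖g w‖ ≤ Real.exp M * ‖g 0‖) {w : ℂ} (hw : ‖w‖ ≤ R / 4) :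
    ‖taylorRem n (logDeriv g) w‖ ≤ 8 ^ (n + 1) * M / R ^ (n + 1) := by
  have hdiff : DifferentiableOn ℂ (logDeriv g) (Metric.closedBall 0 (R / 4)) := fun v hv =>
    (differentiableAt_logDeriv hg (hg0 v
      (by linarith [mem_closedBall_zero_iff.1 hv]))).differentiableWithinAt
  refine (norm_taylorRem_le n (by positivity) hdiff
    (fun v hv => norm_logDeriv_le hM hR hg hg0 hb hv) hw).trans_eq ?_
  rw [div_pow, show (8 : ℝ) = 2 * 4 by norm_num, mul_pow, pow_succ, pow_succ, pow_succ]
  field_simp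

theorem logDeriv_zeroFactor {S : Finset ℂ} (hS : ∀ u ∈ S, u ≠ 0) {w : ℂ} (hw : w ∉ S) :
    logDeriv (zeroFactor f S) w = ∑ u ∈ S, (analyticOrderNatAt f u : ℂ) / (w - u) := by
  have hwu : ∀ u ∈ S, w - u ≠ 0 := fun u hu => sub_ne_zero.2 fun h => hw (h ▸ hu)
  have hfactor : ∀ u ∈ S, 1 - w / u = -(w - u) / u := fun u hu => by
    field_simp [hS u hu]
    ring
  have hne : ∀ u ∈ S, 1 - w / u ≠ 0 := fun u hu => by
    rw [hfactor u hu]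
    exact div_ne_zero (neg_ne_zero.2 (hwu u hu)) (hS u hu)
  unfold zeroFactor
  rw [logDeriv_prod (f := fun u (w : ℂ) => (1 - w / u) ^ analyticOrderNatAt f u)
    (fun u hu => pow_ne_zero _ (hne u hu)) (fun u _ => by fun_prop)]
  refine Finset.sum_congr rfl fun u hu => ?_
  have hderiv : HasDerivAt (fun w : ℂ => 1 - w / u) (-(1 / u)) w :=
    ((hasDerivAt_id w).div_const u).const_sub 1
  rw [logDeriv_fun_pow (by fun_prop), logDeriv_apply, hderiv.deriv, hfactor u hu]
  have hu0 := hS u hu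
  have := hwu u hu
  field_simp

end LogDeriv

section HasMittagLefflerExpansion

theorem hasSum_of_eq {ι α : Type*} [AddCommMonoid α] [TopologicalSpace α] {F G : ι → α} {a b : α}
    (h : HasSum F a) (hF : ∀ i, G i = F i) (hab : b = a) : HasSum G b := by
  rwa [hab, funext hF]

variable {f : ℂ → ℂ} {k : ℕ}

theorem taylorRem_logDeriv_eq (n : ℕ) (hf : Differentiable ℂ f) (h0 : f 0 ≠ 0) {S : Finset ℂ}
    (hS : ∀ u ∈ S, f u = 0) {g : ℂ → ℂ} (hg : Differentiable ℂ g)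
    (hfac : ∀ w, f w = zeroFactor f S w * g w) {w : ℂ} (hw : f w ≠ 0) :
    taylorRem n (logDeriv f) w =
      ∑ u ∈ S, (analyticOrderNatAt f u : ℂ) / (u ^ n * (w - u)) + taylorRem n (logDeriv g) w := by
  have hU : {v | f v ≠ 0} ∈ 𝓝 (0 : ℂ) := (isOpen_ne.preimage hf.continuous).mem_nhds h0
  have hS0 : ∀ u ∈ S, u ≠ 0 := fun u hu h => h0 (h ▸ hS u hu)
  have hUS : ∀ v, f v ≠ 0 → v ∉ S := fun v hv h => hv (hS v h)
  have hfac0 : ∀ v, f v ≠ 0 → zeroFactor f S v ≠ 0 ∧ g v ≠ 0 := fun v hv =>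
    mul_ne_zero_iff.1 (hfac v ▸ hv)
  have hlogDeriv : Set.EqOn (logDeriv f)
      (fun v => ∑ u ∈ S, (analyticOrderNatAt f u : ℂ) / (v - u) + logDeriv g v)
      {v | f v ≠ 0} := fun v hv => by
    have hmul := logDeriv_mul v (hfac0 v hv).1 (hfac0 v hv).2
      (differentiable_zeroFactor f S v) (hg v)
    beta_reduce
    rw [← logDeriv_zeroFactor hS0 (hUS v hv), ← hmul, ← funext hfac]
  have hterm : ∀ u ∈ S,
      DifferentiableOn ℂ (fun v => (analyticOrderNatAt f u : ℂ) / (v - u)) {v | f v ≠ 0} :=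
    fun u hu => DifferentiableOn.div (by fun_prop) (by fun_prop) fun v hv =>
      sub_ne_zero.2 fun h => hUS v hv (h ▸ hu)
  rw [eqOn_taylorRem n hU hlogDeriv hw, taylorRem_add n hU (DifferentiableOn.fun_sum hterm)
    fun v hv => (differentiableAt_logDeriv hg (hfac0 v hv).2).differentiableWithinAt,
    taylorRem_sum n S hU hterm]
  beta_reduce
  congr 1
  exact Finset.sum_congr rfl fun u hu =>
    eqOn_taylorRem_div_sub n _ (hS0 u hu) (show w ≠ u from fun h => hUS w hw (h ▸ hu))

theorem EntireOfGrowth.exists_norm_taylorRem_logDeriv_sub_le (hf : EntireOfGrowth k f)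
    (h0 : f 0 ≠ 0) :
    ∃ A : ℝ, ∀ R : ℝ, 1 ≤ R → ∀ S : Finset ℂ, (∀ u, u ∈ S ↔ f u = 0 ∧ ‖u‖ ≤ R) →
      ∀ w, f w ≠ 0 → ‖w‖ ≤ R / 4 →
        ‖taylorRem (k + 1) (logDeriv f) w -
          ∑ u ∈ S, (analyticOrderNatAt f u : ℂ) / (u ^ (k + 1) * (w - u))‖ ≤ A / R ^ 2 := by
  obtain ⟨C, hC, hle⟩ := hf.norm_le
  refine ⟨8 ^ (k + 2) * (C * 4 ^ k + |Real.log ‖f 0‖| + 1), fun R hR S hS w hw hwR => ?_⟩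
  have hR0 : 0 < R := by linarith
  obtain ⟨g, hg, hfac, hgS⟩ := exists_eq_zeroFactor_mul hf.differentiable h0 S
  have hS0 : ∀ u ∈ S, u ≠ 0 ∧ ‖u‖ ≤ R := fun u hu =>
    ⟨fun h => h0 (h ▸ ((hS u).1 hu).1), ((hS u).1 hu).2⟩
  have hg0 : ∀ v, ‖v‖ < R → g v ≠ 0 := fun v hv hgv =>
    hgS v ((hS v).2 ⟨by rw [hfac, hgv, mul_zero], hv.le⟩) hgv
  have hf0 : g 0 = f 0 := by rw [hfac 0, zeroFactor_apply_zero, one_mul]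
  set M : ℝ := C * (1 + 3 * R) ^ k + |Real.log ‖f 0‖| + 1
  have hgb : ∀ v, ‖v‖ < R → ‖g v‖ ≤ Real.exp M * ‖g 0‖ := fun v hv => by
    have hquot : ‖g v‖ ≤ Real.exp (C * (1 + 3 * R) ^ k) :=
      (le_mul_of_one_le_left (norm_nonneg _) (one_le_pow₀ one_le_two)).trans
        (two_pow_mul_norm_le hle hg hfac hR0 hS0 (by linarith))
    refine hquot.trans ?_
    conv_rhs => rw [hf0, ← Real.exp_log (norm_pos_iff.2 h0), ← Real.exp_add]
    exact Real.exp_le_exp.2 (by linarith [neg_abs_le (Real.log ‖f 0‖)])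
  have hMR : M ≤ (C * 4 ^ k + |Real.log ‖f 0‖| + 1) * R ^ k := by
    have hpow : (1 + 3 * R) ^ k ≤ 4 ^ k * R ^ k := by
      rw [← mul_pow]
      exact pow_le_pow_left₀ (by positivity) (by linarith) k
    have hlog : |Real.log ‖f 0‖| + 1 ≤ (|Real.log ‖f 0‖| + 1) * R ^ k :=
      le_mul_of_one_le_right (by positivity) (one_le_pow₀ hR)
    linarith [mul_le_mul_of_nonneg_left hpow hC]
  rw [taylorRem_logDeriv_eq (k + 1) hf.differentiable h0 (fun u hu => ((hS u).1 hu).1) hg hfac hw,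
    add_sub_cancel_left]
  refine (norm_taylorRem_logDeriv_le (k + 1) (by positivity) hR0 hg hg0 hgb hwR).trans ?_
  rw [div_le_div_iff₀ (by positivity) (by positivity)]
  calc 8 ^ (k + 1 + 1) * M * R ^ 2
      ≤ 8 ^ (k + 2) * ((C * 4 ^ k + |Real.log ‖f 0‖| + 1) * R ^ k) * R ^ 2 := by gcongr
    _ = _ := by ring

theorem EntireOfGrowth.hasSum_taylorRem_logDeriv (hf : EntireOfGrowth k f) (h0 : f 0 ≠ 0) {w : ℂ}
    (hw : f w ≠ 0) :
    HasSum (fun u : ℂ => (analyticOrderNatAt f u : ℂ) / (u ^ (k + 1) * (w - u)))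
      (taylorRem (k + 1) (logDeriv f) w) := by
  have hsum := hf.summable_analyticOrderNatAt_div h0 hw
  set F : ℂ → ℂ := fun u => (analyticOrderNatAt f u : ℂ) / (u ^ (k + 1) * (w - u)) with hF
  obtain ⟨A, hA⟩ := hf.exists_norm_taylorRem_logDeriv_sub_le h0
  set T : ℕ → Finset ℂ := fun n => (finite_zeros_norm_le hf.differentiable h0 n).toFinset
  have hmem : ∀ n u, u ∈ T n ↔ f u = 0 ∧ ‖u‖ ≤ n := fun n u => Set.Finite.mem_toFinset _
  have hremainder : Tendsto (fun n => ∑ u ∈ T n, F u) atTop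
      (𝓝 (taylorRem (k + 1) (logDeriv f) w)) := by
    rw [← tendsto_sub_nhds_zero_iff]
    refine squeeze_zero_norm' ?_ ((tendsto_const_nhds (x := A)).div_atTop
      ((tendsto_pow_atTop two_ne_zero).comp tendsto_natCast_atTop_atTop))
    filter_upwards [eventually_ge_atTop 1, eventually_ge_atTop ⌈4 * ‖w‖⌉₊] with n hn hnw
    rw [norm_sub_rev]
    exact hA n (by exact_mod_cast hn) (T n) (hmem n) w hw (by linarith [Nat.ceil_le.1 hnw])
  have hexhaust : Tendsto (fun n => ∑' u, (T n : Set ℂ).indicator F u) atTop (𝓝 (∑' u, F u)) := by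
    refine tendsto_tsum_of_dominated_convergence hsum.norm (fun u => ?_)
      (Eventually.of_forall fun n u => norm_indicator_le_norm_self F u)
    rcases eq_or_ne (f u) 0 with hu | hu
    · refine tendsto_const_nhds.congr' ?_
      filter_upwards [eventually_ge_atTop ⌈‖u‖⌉₊] with n hn
      exact (Set.indicator_of_mem ((hmem n u).2 ⟨hu, Nat.ceil_le.1 hn⟩) F).symm
    · have hFu : F u = 0 := by simp [hF, analyticOrderNatAt_eq_zero_of_apply_ne_zero hu]
      simp [Set.indicator_apply, hFu]
  simp only [← sum_eq_tsum_indicator] at hexhaust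
  exact tendsto_nhds_unique hexhaust hremainder ▸ hsum.hasSum

/-- `HasMittagLefflerExpansion s B L m` says that in the half-plane `Re w > B` the function `L` is
a Mittag-Leffler series of simple poles with residue `m u` at `u`, where the Taylor polynomial of
degree two at `s` is subtracted from each term. The constant term at `s` is required to be `L s`. -/
structure HasMittagLefflerExpansion (s : ℂ) (B : ℝ) (L m : ℂ → ℂ) : Prop where
  summable : Summable fun u : ℂ => ‖m u‖ / ‖u - s‖ ^ 3
  center : m s = 0
  re_le : ∀ u, m u ≠ 0 → u.re ≤ B
  expansion : ∃ a b : ℂ, ∀ w : ℂ, B < w.re →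
    HasSum (fun u => m u / ((u - s) ^ 3 * (w - u)) * (w - s) ^ 3)
      (L w - (L s + a * (w - s) + b * (w - s) ^ 2))

theorem analyticOrderNatAt_comp_affine (f : ℂ → ℂ) {a : ℂ} (ha : a ≠ 0) (b u : ℂ) :
    analyticOrderNatAt (fun w => f (a * w + b)) u = analyticOrderNatAt f (a * u + b) := by
  have hderiv : HasDerivAt (fun w : ℂ => a * w + b) a u := by
    simpa using ((hasDerivAt_id u).const_mul a).add_const b
  exact congrArg ENat.toNat (analyticOrderAt_comp_of_deriv_ne_zero (f := f)
    (g := fun w : ℂ => a * w + b) (by fun_prop) (by rwa [hderiv.deriv]))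

theorem EntireOfGrowth.hasMittagLefflerExpansion (hf : EntireOfGrowth 2 f) {s : ℂ} (hs : f s ≠ 0)
    {B : ℝ} (hB : ∀ w : ℂ, B < w.re → f w ≠ 0) :
    HasMittagLefflerExpansion s B (logDeriv f) fun u => (analyticOrderNatAt f u : ℂ) := by
  have hF : EntireOfGrowth 2 fun w => f (w + s) := by simpa using hf.comp_affine 1 s
  have hF0 : f (0 + s) ≠ 0 := by simpa using hs
  have hord : ∀ u, analyticOrderNatAt (fun w => f (w + s)) u = analyticOrderNatAt f (u + s) :=
    fun u => by simpa using analyticOrderNatAt_comp_affine f one_ne_zero s u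
  have hlog : ∀ w, logDeriv (fun w => f (w + s)) w = logDeriv f (w + s) := fun w => by
    rw [logDeriv_apply, logDeriv_apply, deriv_comp_add_const]
  refine ⟨?_, by simp [analyticOrderNatAt_eq_zero_of_apply_ne_zero hs], fun u hu => ?_,
    taylorRem 1 (logDeriv fun w => f (w + s)) 0, taylorRem 2 (logDeriv fun w => f (w + s)) 0,
    fun w hw => ?_⟩
  · rw [← (Equiv.addRight s).summable_iff]
    refine (hF.summable_analyticOrderNatAt_div_norm_pow hF0).congr fun u => ?_
    simp [hord]
  · by_contra! h
    exact hu (by simp [analyticOrderNatAt_eq_zero_of_apply_ne_zero (hB u h)])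
  · have hw0 : f (w - s + s) ≠ 0 := by simpa using hB w hw
    have htaylor := eq_sum_add_pow_mul_taylorRem 3 (logDeriv fun w => f (w + s)) (w - s)
    rw [hlog, sub_add_cancel] at htaylor
    rw [← (Equiv.addRight s).hasSum_iff]
    refine hasSum_of_eq ((hF.hasSum_taylorRem_logDeriv hF0 hw0).mul_right ((w - s) ^ 3))
      (fun u => ?_) ?_
    · simp [hord, sub_sub, add_comm s u]
    · have h0 : taylorRem 0 (logDeriv fun w => f (w + s)) 0 = logDeriv f s := by
        rw [taylorRem, Function.iterate_zero_apply, hlog, zero_add]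
      rw [htaylor, Finset.sum_range_succ, Finset.sum_range_succ, Finset.sum_range_one, h0]
      ring

namespace HasMittagLefflerExpansion

variable {s : ℂ} {B : ℝ} {L L' m m' : ℂ → ℂ}

theorem congr (h : HasMittagLefflerExpansion s B L m) (hs : L' s = L s)
    (hL : ∀ w : ℂ, B < w.re → L' w = L w) (hm : ∀ u, m' u = m u) :
    HasMittagLefflerExpansion s B L' m' := by
  obtain rfl : m' = m := funext hm
  obtain ⟨a, b, hab⟩ := h.expansion
  exact ⟨h.summable, h.center, h.re_le, a, b, fun w hw => by rw [hL w hw, hs]; exact hab w hw⟩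

theorem const_mul (h : HasMittagLefflerExpansion s B L m) (c : ℂ) :
    HasMittagLefflerExpansion s B (fun w => c * L w) fun u => c * m u := by
  obtain ⟨a, b, hab⟩ := h.expansion
  refine ⟨by simpa [mul_div_assoc] using h.summable.mul_left ‖c‖, by simp [h.center],
    fun u hu => h.re_le u (right_ne_zero_of_mul hu), c * a, c * b, fun w hw => ?_⟩
  exact hasSum_of_eq ((hab w hw).mul_left c) (fun u => by ring) (by ring)

theorem add (h : HasMittagLefflerExpansion s B L m) (h' : HasMittagLefflerExpansion s B L' m') :
    HasMittagLefflerExpansion s B (fun w => L w + L' w) fun u => m u + m' u := by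
  obtain ⟨a, b, hab⟩ := h.expansion
  obtain ⟨a', b', hab'⟩ := h'.expansion
  refine ⟨?_, by simp [h.center, h'.center], fun u hu => ?_, a + a', b + b', fun w hw => ?_⟩
  · refine Summable.of_nonneg_of_le (fun u => by positivity) (fun u => ?_)
      (h.summable.add h'.summable)
    rw [← add_div]
    gcongr
    exact norm_add_le _ _
  · by_cases hm : m u = 0
    · exact h'.re_le u (by simpa [hm] using hu)
    · exact h.re_le u hm
  · exact hasSum_of_eq ((hab w hw).add (hab' w hw)) (fun u => by ring) (by ring)

theorem sub (h : HasMittagLefflerExpansion s B L m) (h' : HasMittagLefflerExpansion s B L' m') :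
    HasMittagLefflerExpansion s B (fun w => L w - L' w) fun u => m u - m' u :=
  (h.add (h'.const_mul (-1))).congr (by ring) (fun _ _ => by ring) fun _ => by ring

theorem sum {ι : Type*} (S : Finset ι) {L m : ι → ℂ → ℂ}
    (h : ∀ i ∈ S, HasMittagLefflerExpansion s B (L i) (m i)) :
    HasMittagLefflerExpansion s B (fun w => ∑ i ∈ S, L i w) fun u => ∑ i ∈ S, m i u := by
  classical
  induction S using Finset.induction_on with
  | empty => exact ⟨by simp, by simp, by simp, 0, 0, fun w _ => by simp⟩
  | insert i S hi ih =>
    simpa only [Finset.sum_insert hi] using (h i (Finset.mem_insert_self i S)).add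
      (ih fun j hj => h j (Finset.mem_insert_of_mem hj))

end HasMittagLefflerExpansion

theorem hasMittagLefflerExpansion_one_div_sub {s a : ℂ} (hs : s ≠ a) {B : ℝ} (ha : a.re ≤ B) :
    HasMittagLefflerExpansion s B (fun w => 1 / (w - a)) fun u => if u = a then 1 else 0 := by
  refine ⟨summable_of_ne_finset_zero (s := {a}) fun u hu => ?_, by simp [hs], fun u hu => ?_,
    -1 / (s - a) ^ 2, 1 / (s - a) ^ 3, fun w hw => ?_⟩
  · simp [Finset.mem_singleton.not.1 hu]
  · rwa [show u = a by simpa using hu]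
  · have hwa : w - a ≠ 0 := fun h => by
      rw [sub_eq_zero.1 h] at hw
      linarith
    refine hasSum_of_eq (hasSum_ite_eq a (1 / ((a - s) ^ 3 * (w - a)) * (w - s) ^ 3))
      (fun u => ?_) ?_
    · by_cases h : u = a <;> simp [h]
    · have has : a - s ≠ 0 := sub_ne_zero.2 hs.symm
      rw [← neg_sub a s]
      field_simp
      ring

end HasMittagLefflerExpansion

section LaplaceTransform

open MeasureTheory Set

variable {κ : ℝ} {h k : ℝ → ℂ} {H K : ℂ → ℂ}

/-- `H` is the Laplace transform of `h` on the line `Re p = κ`. The growth bound on `h` makes the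
integral absolutely convergent there, with an exponential factor to spare. -/
structure HasLaplaceTransform (κ : ℝ) (h : ℝ → ℂ) (H : ℂ → ℂ) : Prop where
  continuousOn : ContinuousOn h (Ioi 0)
  norm_le : ∃ C : ℝ, ∀ t, 0 < t → ‖h t‖ ≤ C * Real.exp ((κ - 1) * t)
  integral_eq : ∀ p : ℂ, p.re = κ → ∫ t in Ioi (0 : ℝ), cexp (-p * t) * h t = H p

theorem norm_exp_mul_le {C t : ℝ} (ht : ‖h t‖ ≤ C * Real.exp ((κ - 1) * t)) {p : ℂ}
    (hp : p.re = κ) : ‖cexp (-p * t) * h t‖ ≤ C * Real.exp (-1 * t) := by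
  have hre : (-p * t).re = -κ * t := by simp [hp]
  rw [norm_mul, Complex.norm_exp, hre]
  calc Real.exp (-κ * t) * ‖h t‖ ≤ Real.exp (-κ * t) * (C * Real.exp ((κ - 1) * t)) := by gcongr
    _ = C * Real.exp (-κ * t + (κ - 1) * t) := by rw [Real.exp_add]; ring
    _ = C * Real.exp (-1 * t) := by ring_nf

theorem integrableOn_exp_mul {C : ℝ} (hh : ContinuousOn h (Ioi 0))
    (hC : ∀ t, 0 < t → ‖h t‖ ≤ C * Real.exp ((κ - 1) * t)) {p : ℂ} (hp : p.re = κ) :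
    IntegrableOn (fun t : ℝ => cexp (-p * t) * h t) (Ioi 0) :=
  Integrable.mono' ((integrableOn_exp_mul_Ioi (a := -1) (by norm_num) 0).const_mul C)
    (ContinuousOn.aestronglyMeasurable (ContinuousOn.mul (by fun_prop) hh) measurableSet_Ioi)
    ((ae_restrict_mem measurableSet_Ioi).mono fun t ht => norm_exp_mul_le (hC t ht) hp)

theorem continuousOn_tsum_Ioi {ι : Type*} {h : ι → ℝ → ℂ} {b : ι → ℝ} (hb : Summable b)
    (hh : ∀ i, ContinuousOn (h i) (Ioi 0))
    (hbound : ∀ i t, 0 < t → ‖h i t‖ ≤ b i * Real.exp ((κ - 1) * t)) :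
    ContinuousOn (fun t => ∑' i, h i t) (Ioi 0) := by
  rw [isOpen_Ioi.continuousOn_iff]
  intro t ht
  have hb0 : ∀ i, 0 ≤ b i := fun i =>
    nonneg_of_mul_nonneg_left ((norm_nonneg _).trans (hbound i t ht)) (Real.exp_pos _)
  refine (continuousOn_tsum (u := fun i => b i * Real.exp (|κ - 1| * (t + 1)))
    (fun i => (hh i).mono Ioo_subset_Ioi_self) (hb.mul_right _) fun i r hr => ?_).continuousAt
    (Ioo_mem_nhds ht (lt_add_one t))
  refine (hbound i r hr.1).trans ?_
  gcongr
  · exact hb0 i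
  · exact hr.1.le
  · exact le_abs_self _
  · exact hr.2.le

namespace HasLaplaceTransform

theorem integrableOn (hh : HasLaplaceTransform κ h H) {p : ℂ} (hp : p.re = κ) :
    IntegrableOn (fun t : ℝ => cexp (-p * t) * h t) (Ioi 0) := by
  obtain ⟨C, hC⟩ := hh.norm_le
  exact integrableOn_exp_mul hh.continuousOn hC hp

theorem congr (hh : HasLaplaceTransform κ h H) (hk : ∀ t, k t = h t)
    (hK : ∀ p : ℂ, p.re = κ → K p = H p) : HasLaplaceTransform κ k K := by
  obtain rfl : k = h := funext hk
  exact ⟨hh.continuousOn, hh.norm_le, fun p hp => (hh.integral_eq p hp).trans (hK p hp).symm⟩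

theorem const_mul (c : ℂ) (hh : HasLaplaceTransform κ h H) :
    HasLaplaceTransform κ (fun t => c * h t) fun p => c * H p := by
  obtain ⟨C, hC⟩ := hh.norm_le
  refine ⟨hh.continuousOn.const_mul c, ⟨‖c‖ * C, fun t ht => ?_⟩, fun p hp => ?_⟩
  · rw [norm_mul, mul_assoc]
    exact mul_le_mul_of_nonneg_left (hC t ht) (norm_nonneg c)
  · simp only [mul_left_comm _ c, integral_const_mul, hh.integral_eq p hp]

theorem add (hh : HasLaplaceTransform κ h H) (hk : HasLaplaceTransform κ k K) :
    HasLaplaceTransform κ (fun t => h t + k t) fun p => H p + K p := by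
  obtain ⟨C, hC⟩ := hh.norm_le
  obtain ⟨D, hD⟩ := hk.norm_le
  refine ⟨hh.continuousOn.add hk.continuousOn, ⟨C + D, fun t ht => ?_⟩, fun p hp => ?_⟩
  · exact (norm_add_le _ _).trans (by linarith [hC t ht, hD t ht])
  · rw [← hh.integral_eq p hp, ← hk.integral_eq p hp,
      ← integral_add (hh.integrableOn hp) (hk.integrableOn hp)]
    simp only [mul_add]

theorem tsum {ι : Type*} {h : ι → ℝ → ℂ} {H : ι → ℂ → ℂ} {b : ι → ℝ} (hb : Summable b)
    (hh : ∀ i, HasLaplaceTransform κ (h i) (H i))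
    (hbound : ∀ i t, 0 < t → ‖h i t‖ ≤ b i * Real.exp ((κ - 1) * t))
    (hK : ∀ p : ℂ, p.re = κ → HasSum (fun i => H i p) (K p)) :
    HasLaplaceTransform κ (fun t => ∑' i, h i t) K := by
  refine ⟨continuousOn_tsum_Ioi hb (fun i => (hh i).continuousOn) hbound,
    ⟨∑' i, b i, fun t ht => ?_⟩, fun p hp => ?_⟩
  · rw [← tsum_mul_right]
    exact tsum_of_norm_bounded (hb.mul_right _).hasSum fun i => hbound i t ht
  -- Termwise integration needs a countable index set: the support of the summable majorant.
  have hzero : ∀ i, b i = 0 → ∀ t, 0 < t → h i t = 0 := fun i hi t ht => by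
    simpa [hi] using hbound i t ht
  have hzero' : ∀ i, b i = 0 → H i p = 0 := fun i hi => by
    rw [← (hh i).integral_eq p hp]
    exact setIntegral_eq_zero_of_forall_eq_zero fun t ht => by simp [hzero i hi t ht]
  have : Countable (Function.support b) := hb.countable_support.to_subtype
  have hsum := hasSum_integral_of_dominated_convergence (μ := volume.restrict (Ioi (0 : ℝ)))
    (F := fun (i : Function.support b) t => cexp (-p * t) * h i t)
    (f := fun t => cexp (-p * t) * ∑' i, h i t) (fun i t => b i * Real.exp (-1 * t))
    (fun i => ((hh i).integrableOn hp).aestronglyMeasurable)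
    (fun i => (ae_restrict_mem measurableSet_Ioi).mono fun t ht =>
      norm_exp_mul_le (hbound i t ht) hp)
    (ae_of_all _ fun t => (hb.subtype _).mul_right _)
    (by simpa only [tsum_mul_right, IntegrableOn] using
      (integrableOn_exp_mul_Ioi (a := -1) (by norm_num) 0).const_mul _)
    ((ae_restrict_mem measurableSet_Ioi).mono fun t ht => ?_)
  · simp only [(hh _).integral_eq p hp] at hsum
    rw [← Function.comp_def (fun i => H i p),
      hasSum_subtype_iff_of_support_subset (s := Function.support b)
        fun i hi hbi => hi (hzero' i hbi)] at hsum
    exact hsum.unique (hK p hp)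
  · refine HasSum.mul_left _ ?_
    rw [← Function.comp_def (fun i => h i t),
      hasSum_subtype_iff_of_support_subset (s := Function.support b)
        fun i hi hbi => hi (hzero i hbi t ht)]
    exact (Summable.of_norm_bounded (hb.mul_right _) fun i => hbound i t ht).hasSum

theorem fourier_indicator (hh : HasLaplaceTransform κ h H) (y : ℝ) :
    FourierTransform.fourier ((Ioi (0 : ℝ)).indicator fun t => cexp (-κ * t) * h t) y =
      H (κ + 2 * Real.pi * y * I) := by
  rw [Real.fourier_real_eq_integral_exp_smul, ← hh.integral_eq _ (by simp),
    ← integral_indicator measurableSet_Ioi]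
  congr 1
  funext v
  by_cases hv : v ∈ Ioi (0 : ℝ)
  · simp only [indicator_of_mem hv]
    rw [smul_eq_mul, ← mul_assoc, ← Complex.exp_add]
    push_cast
    ring_nf
  · simp only [indicator_of_notMem hv, smul_zero]

theorem eq_of_eq (hh : HasLaplaceTransform κ h H) (hk : HasLaplaceTransform κ k H) {t : ℝ}
    (ht : 0 < t) : h t = k t := by
  set g : ℝ → ℂ := fun t => h t + -1 * k t
  have hg : HasLaplaceTransform κ g fun _ => 0 :=
    (hh.add (hk.const_mul (-1))).congr (fun _ => rfl) fun p _ => by ring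
  set f : ℝ → ℂ := (Ioi (0 : ℝ)).indicator fun t => cexp (-κ * t) * g t with hfdef
  have hft : f t = cexp (-κ * t) * g t := indicator_of_mem (mem_Ioi.2 ht) _
  have hfourier : FourierTransform.fourier f = 0 := funext hg.fourier_indicator
  have hcont : ContinuousAt f t := by
    refine (((by fun_prop : Continuous fun t : ℝ => cexp (-κ * t)).continuousAt).mul
      (hg.continuousOn.continuousAt (Ioi_mem_nhds ht))).congr ?_
    filter_upwards [Ioi_mem_nhds ht] with r hr using (indicator_of_mem hr _).symm
  have hinv := ((integrable_indicator_iff measurableSet_Ioi).2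
    (hg.integrableOn (by simp))).fourierInv_fourier_eq
    (by rw [hfourier]; exact integrable_zero _ _ _) hcont
  have hinv0 : FourierTransformInv.fourierInv (0 : ℝ → ℂ) t = 0 := by
    simp [Real.fourierInv_eq']
  rw [hfourier, hinv0, ← hfdef, hft] at hinv
  linear_combination (mul_eq_zero.1 hinv.symm).resolve_left (Complex.exp_ne_zero _)

end HasLaplaceTransform

theorem hasLaplaceTransform_exp {a : ℂ} (ha : a.re ≤ κ - 1) :
    HasLaplaceTransform κ (fun t => cexp (a * t)) fun p => 1 / (p - a) := by
  refine ⟨by fun_prop, ⟨1, fun t ht => ?_⟩, fun p hp => ?_⟩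
  · rw [one_mul, Complex.norm_exp, re_mul_ofReal]
    gcongr
  · have hre : (a - p).re < 0 := by rw [sub_re, hp]; linarith
    simp only [← Complex.exp_add, ← add_mul, neg_add_eq_sub]
    rw [integral_exp_mul_complex_Ioi hre, ofReal_zero, mul_zero, Complex.exp_zero,
      neg_div, ← div_neg, neg_sub]

theorem norm_pow_div_factorial_le (hκ : 2 ≤ κ) (n : ℕ) {t : ℝ} (ht : 0 < t) :
    ‖(t : ℂ) ^ n / (n.factorial : ℂ)‖ ≤ 1 * Real.exp ((κ - 1) * t) := by
  rw [one_mul, norm_div, norm_pow, norm_real, Real.norm_of_nonneg ht.le, norm_natCast]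
  exact (Real.pow_div_factorial_le_exp t ht.le n).trans (Real.exp_le_exp.2 (by nlinarith))

theorem hasDerivAt_exp_mul_pow_div_factorial (p : ℂ) (n : ℕ) (t : ℝ) :
    HasDerivAt (fun t : ℝ => cexp (-p * t) * ((t : ℂ) ^ (n + 1) / ((n + 1).factorial : ℂ)))
      (cexp (-p * t) * (t ^ n / (n.factorial : ℂ)) -
        p * (cexp (-p * t) * (t ^ (n + 1) / ((n + 1).factorial : ℂ)))) t := by
  have hexp : HasDerivAt (fun z : ℂ => cexp (-p * z)) (cexp (-p * t) * -p) t := by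
    simpa using ((hasDerivAt_id (t : ℂ)).const_mul (-p)).cexp
  have hpow := (hasDerivAt_pow (n + 1) (t : ℂ)).div_const ((n + 1).factorial : ℂ)
  refine (hexp.mul hpow).comp_ofReal.congr_deriv ?_
  have hfact : (n.factorial : ℂ) ≠ 0 := by exact_mod_cast n.factorial_ne_zero
  have hn : (n + 1 : ℂ) ≠ 0 := by exact_mod_cast n.succ_ne_zero
  rw [Nat.factorial_succ, Nat.add_sub_cancel]
  push_cast
  field_simp
  ring

theorem hasLaplaceTransform_pow_div_factorial (hκ : 2 ≤ κ) (n : ℕ) :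
    HasLaplaceTransform κ (fun t => (t : ℂ) ^ n / (n.factorial : ℂ)) fun p => 1 / p ^ (n + 1) := by
  have hcont : ∀ n : ℕ, ContinuousOn (fun t : ℝ => (t : ℂ) ^ n / (n.factorial : ℂ)) (Ioi 0) :=
    fun n => by fun_prop
  induction n with
  | zero =>
    exact (hasLaplaceTransform_exp (a := 0) (by rw [zero_re]; linarith)).congr (by simp) (by simp)
  | succ n ih =>
    refine ⟨hcont _, ⟨1, fun t => norm_pow_div_factorial_le hκ _⟩, fun p hp => ?_⟩
    have hp0 : p ≠ 0 := fun h => by rw [h, zero_re] at hp; linarith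
    set q : ℝ → ℂ := fun t => cexp (-p * t) * (t ^ (n + 1) / ((n + 1).factorial : ℂ))
    have hlim : Tendsto q atTop (𝓝 0) := by
      refine squeeze_zero_norm' (a := fun t => 1 * Real.exp (-1 * t))
        (eventually_gt_atTop 0 |>.mono fun t ht => norm_exp_mul_le
          (h := fun t => (t : ℂ) ^ (n + 1) / ((n + 1).factorial : ℂ))
          (norm_pow_div_factorial_le hκ _ ht) hp) ?_
      simpa using Real.tendsto_exp_neg_atTop_nhds_zero
    have hint : IntegrableOn q (Ioi 0) :=
      integrableOn_exp_mul (hcont _) (fun t => norm_pow_div_factorial_le hκ _) hp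
    have hparts := integral_Ioi_of_hasDerivAt_of_tendsto'
      (fun t _ => hasDerivAt_exp_mul_pow_div_factorial p n t)
      ((ih.integrableOn hp).sub (hint.const_mul p)) hlim
    rw [integral_sub (ih.integrableOn hp) (hint.const_mul p), ih.integral_eq p hp,
      integral_const_mul, ofReal_zero, zero_pow n.succ_ne_zero, zero_div, mul_zero, sub_zero,
      sub_eq_zero] at hparts
    rw [pow_succ, ← div_div, hparts, mul_div_cancel_left₀ _ hp0]

/-- The Riesz kernel of order two, whose Laplace transform is `1 / p ^ 3`. -/
noncomputable def truncatedSq (t : ℝ) : ℝ := max t 0 ^ 2 / 2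

theorem truncatedSq_of_nonneg {t : ℝ} (ht : 0 ≤ t) : truncatedSq t = t ^ 2 / 2 := by
  rw [truncatedSq, max_eq_left ht]

theorem truncatedSq_of_nonpos {t : ℝ} (ht : t ≤ 0) : truncatedSq t = 0 := by
  simp [truncatedSq, max_eq_right ht]

theorem norm_truncatedSq_le {b : ℝ} (hb : 1 ≤ b) (t : ℝ) :
    ‖(truncatedSq t : ℂ)‖ ≤ Real.exp (b * t) := by
  rw [norm_real]
  rcases le_total t 0 with ht | ht
  · simpa [truncatedSq_of_nonpos ht] using (Real.exp_pos _).le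
  · rw [truncatedSq_of_nonneg ht, Real.norm_of_nonneg (by positivity)]
    calc t ^ 2 / 2 ≤ Real.exp t := by linarith [Real.quadratic_le_exp_of_nonneg ht]
      _ ≤ Real.exp (b * t) := Real.exp_le_exp.2 (by nlinarith)

theorem norm_truncatedSq_sub_le (hκ : 2 ≤ κ) (l t : ℝ) :
    ‖(truncatedSq (t - l) : ℂ)‖ ≤ Real.exp (-(κ - 1) * l) * Real.exp ((κ - 1) * t) := by
  rw [← Real.exp_add]
  exact (norm_truncatedSq_le (b := κ - 1) (by linarith) _).trans (le_of_eq (by ring_nf))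

theorem hasLaplaceTransform_truncatedSq (hκ : 2 ≤ κ) {l : ℝ} (hl : 0 ≤ l) :
    HasLaplaceTransform κ (fun t => (truncatedSq (t - l) : ℂ)) fun p => cexp (-p * l) / p ^ 3 := by
  refine ⟨?_, ⟨_, fun t _ => norm_truncatedSq_sub_le hκ l t⟩, fun p hp => ?_⟩
  · simp only [truncatedSq]
    fun_prop
  have hsq := (hasLaplaceTransform_pow_div_factorial hκ 2).integral_eq p hp
  rw [← integral_indicator measurableSet_Ioi] at hsq ⊢
  rw [div_eq_mul_one_div, ← hsq, ← integral_sub_right_eq_self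
    ((Ioi (0 : ℝ)).indicator fun t => cexp (-p * t) * ((t : ℂ) ^ 2 / (Nat.factorial 2 : ℂ))) l,
    ← integral_const_mul]
  congr 1
  funext t
  by_cases ht : 0 < t - l
  · rw [indicator_of_mem (mem_Ioi.2 ht), indicator_of_mem (mem_Ioi.2 (by linarith)),
      truncatedSq_of_nonneg ht.le, ← mul_assoc, ← Complex.exp_add]
    push_cast [Nat.factorial]
    ring_nf
  · rw [indicator_of_notMem (mem_Ioi.not.2 ht : t - l ∉ _), mul_zero,
      indicator_apply_eq_zero.2 fun _ => by simp [truncatedSq_of_nonpos (not_lt.1 ht)]]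

end LaplaceTransform

section ExplicitFormula

variable {s : ℂ} {B σ κ x : ℝ} {L m : ℂ → ℂ} {c : ℕ → ℂ}

/-- The Riesz sum `∑ c n n ^ (-s) (t - log n)² / 2` over `n ≤ exp t`. -/
noncomputable def rieszSum (c : ℕ → ℂ) (s : ℂ) (t : ℝ) : ℂ :=
  ∑' n, LSeries.term c s n * truncatedSq (t - Real.log n)

/-- The exponential sum over the poles `u` with residue `m u` that is dual to `rieszSum`. -/
noncomputable def poleSum (m : ℂ → ℂ) (s : ℂ) (t : ℝ) : ℂ :=
  ∑' u, m u / (u - s) ^ 3 * cexp ((u - s) * t)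

theorem term_mul_exp_log (c : ℕ → ℂ) (s p : ℂ) (n : ℕ) :
    LSeries.term c s n * cexp (-p * Real.log n) = LSeries.term c (s + p) n := by
  rcases eq_or_ne n 0 with rfl | hn
  · simp
  have hn0 : (n : ℂ) ≠ 0 := by exact_mod_cast hn
  rw [LSeries.term_of_ne_zero hn, LSeries.term_of_ne_zero hn, cpow_add _ _ hn0, neg_mul,
    Complex.exp_neg, cpow_def_of_ne_zero hn0 p, natCast_log, mul_comm p, div_mul_eq_div_div,
    div_eq_mul_inv (c n / _)]

theorem hasLaplaceTransform_rieszSum (hc : ∀ w : ℂ, σ < w.re → LSeriesHasSum c w (L w))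
    (hκ : 2 ≤ κ) (hσ : σ < s.re + κ - 1) :
    HasLaplaceTransform κ (rieszSum c s) fun p => L (s + p) / p ^ 3 := by
  refine HasLaplaceTransform.tsum (b := fun n => ‖LSeries.term c (s + (κ - 1 : ℝ)) n‖) ?_
    (fun n => (hasLaplaceTransform_truncatedSq hκ (Real.log_natCast_nonneg n)).const_mul _)
    (fun n t _ => ?_) fun p hp => ?_
  · refine (hc _ ?_).summable.norm
    rw [add_re, ofReal_re]
    linarith
  · rw [← term_mul_exp_log, norm_mul, norm_mul, mul_assoc, Complex.norm_exp, re_mul_ofReal,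
      neg_re, ofReal_re]
    exact mul_le_mul_of_nonneg_left (norm_truncatedSq_sub_le hκ _ t) (norm_nonneg _)
  · have hsum : LSeriesHasSum c (s + p) (L (s + p)) := hc _ (by rw [add_re, hp]; linarith)
    refine hasSum_of_eq (hsum.div_const (p ^ 3)) (fun n => ?_) rfl
    rw [← term_mul_exp_log, mul_div_assoc]

theorem hasLaplaceTransform_quadratic (hκ : 2 ≤ κ) (a b c : ℂ) :
    HasLaplaceTransform κ (fun t => b + a * t + c * t ^ 2 / 2)
      fun p => (c + a * p + b * p ^ 2) / p ^ 3 := by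
  refine ((((hasLaplaceTransform_pow_div_factorial hκ 0).const_mul b).add
    ((hasLaplaceTransform_pow_div_factorial hκ 1).const_mul a)).add
    ((hasLaplaceTransform_pow_div_factorial hκ 2).const_mul c)).congr (fun t => ?_) fun p hp => ?_
  · simp only [pow_zero, Nat.factorial, Nat.cast_one, pow_one]
    push_cast
    ring
  · have hp0 : p ≠ 0 := fun h => by rw [h, zero_re] at hp; linarith
    field_simp
    ring

namespace HasMittagLefflerExpansion

theorem norm_pole_term_le (h : HasMittagLefflerExpansion s B L m) (hB : B ≤ s.re + κ - 1) (u : ℂ)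
    {t : ℝ} (ht : 0 < t) : ‖m u / (u - s) ^ 3 * cexp ((u - s) * t)‖ ≤
      ‖m u‖ / ‖u - s‖ ^ 3 * Real.exp ((κ - 1) * t) := by
  rcases eq_or_ne (m u) 0 with hu | hu
  · simp [hu]
  · rw [norm_mul, norm_div, norm_pow, Complex.norm_exp, re_mul_ofReal, sub_re]
    have hre : u.re - s.re ≤ κ - 1 := by linarith [h.re_le u hu]
    exact mul_le_mul_of_nonneg_left
      (Real.exp_le_exp.2 (mul_le_mul_of_nonneg_right hre ht.le)) (by positivity)

theorem summable_pole_term (h : HasMittagLefflerExpansion s B L m) {t : ℝ} (ht : 0 < t) :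
    Summable fun u => m u / (u - s) ^ 3 * cexp ((u - s) * t) :=
  Summable.of_norm_bounded (h.summable.mul_right _)
    fun u => h.norm_pole_term_le (κ := B - s.re + 1) (by linarith) u ht

theorem hasLaplaceTransform_poleSum (h : HasMittagLefflerExpansion s B L m) {a b : ℂ}
    (hab : ∀ w : ℂ, B < w.re → HasSum (fun u => m u / ((u - s) ^ 3 * (w - u)) * (w - s) ^ 3)
      (L w - (L s + a * (w - s) + b * (w - s) ^ 2)))
    (hκ : 2 ≤ κ) (hB : B ≤ s.re + κ - 1) :
    HasLaplaceTransform κ (poleSum m s)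
      fun p => L (s + p) / p ^ 3 - (L s + a * p + b * p ^ 2) / p ^ 3 := by
  have hterm : ∀ u, HasLaplaceTransform κ (fun t => m u / (u - s) ^ 3 * cexp ((u - s) * t))
      fun p => m u / ((u - s) ^ 3 * (s + p - u)) := fun u => by
    rcases eq_or_ne (m u) 0 with hu | hu
    · exact ((hasLaplaceTransform_pow_div_factorial hκ 0).const_mul 0).congr
        (by simp [hu]) (by simp [hu])
    · refine ((hasLaplaceTransform_exp ?_).const_mul _).congr (fun _ => rfl) fun p _ => ?_
      · rw [sub_re]
        linarith [h.re_le u hu]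
      · rw [div_mul_div_comm, mul_one, sub_sub_eq_add_sub, add_comm]
  refine HasLaplaceTransform.tsum h.summable hterm
    (fun u t ht => h.norm_pole_term_le hB u ht) fun p hp => ?_
  have hp0 : p ≠ 0 := fun h => by rw [h, zero_re] at hp; linarith
  refine hasSum_of_eq ((hab (s + p) (by rw [add_re, hp]; linarith)).div_const (p ^ 3))
    (fun u => ?_) ?_ <;> rw [add_sub_cancel_left]
  · rw [mul_div_cancel_right₀ _ (pow_ne_zero 3 hp0)]
  · rw [sub_div]

theorem exists_rieszSum_eq (h : HasMittagLefflerExpansion s B L m)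
    (hc : ∀ w : ℂ, σ < w.re → LSeriesHasSum c w (L w)) :
    ∃ a b : ℂ, ∀ t : ℝ, 0 < t →
      rieszSum c s t = b + a * t + L s * t ^ 2 / 2 + poleSum m s t := by
  obtain ⟨a, b, hab⟩ := h.expansion
  obtain ⟨κ, hκ, hB, hσ⟩ : ∃ κ : ℝ, 2 ≤ κ ∧ B ≤ s.re + κ - 1 ∧ σ < s.re + κ - 1 := by
    refine ⟨max 2 (max B σ - s.re + 2), le_max_left _ _, ?_, ?_⟩ <;>
      linarith [le_max_right 2 (max B σ - s.re + 2), le_max_left B σ, le_max_right B σ]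
  have hsum := ((hasLaplaceTransform_quadratic hκ a b (L s)).add
    (h.hasLaplaceTransform_poleSum hab hκ hB)).congr (fun _ => rfl)
    fun p _ => (add_sub_cancel _ (L (s + p) / p ^ 3)).symm
  exact ⟨a, b, fun t ht => (hasLaplaceTransform_rieszSum hc hκ hσ).eq_of_eq hsum ht⟩

end HasMittagLefflerExpansion

theorem rieszSum_eq_sum (c : ℕ → ℂ) (s : ℂ) {t : ℝ} {N : ℕ} (ht : t ≤ Real.log N) :
    rieszSum c s t =
      ∑ n ∈ Finset.Ico 1 N, c n / (n : ℂ) ^ s * truncatedSq (t - Real.log n) := by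
  rw [rieszSum, tsum_eq_sum (s := Finset.Ico 1 N) fun n hn => ?_]
  · refine Finset.sum_congr rfl fun n hn => ?_
    rw [LSeries.term_of_ne_zero (Nat.one_le_iff_ne_zero.1 (Finset.mem_Ico.1 hn).1)]
  · rcases Nat.eq_zero_or_pos n with rfl | hn0
    · simp
    · have hNn : N ≤ n := not_lt.1 fun h => hn (Finset.mem_Ico.2 ⟨hn0, h⟩)
      have hlog : Real.log N ≤ Real.log n := by
        rcases Nat.eq_zero_or_pos N with rfl | hN
        · simpa using Real.log_natCast_nonneg n
        · gcongr
      rw [truncatedSq_of_nonpos (by linarith), ofReal_zero, mul_zero]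

theorem log_pow_div_natCast (hx : 0 < x) {n : ℕ} (hn : 0 < n) (k : ℕ) :
    Real.log (x ^ k / n) = k * Real.log x - Real.log n := by
  rw [Real.log_div (by positivity) (by positivity), Real.log_pow]

theorem truncatedSq_sub_log_of_le (hx : 0 < x) {n : ℕ} (hn : 0 < n) {k : ℕ}
    (h : (n : ℝ) ≤ x ^ k) :
    truncatedSq (k * Real.log x - Real.log n) = Real.log (x ^ k / n) ^ 2 / 2 := by
  have hn0 : (0 : ℝ) < n := Nat.cast_pos.2 hn
  rw [← log_pow_div_natCast hx hn,
    truncatedSq_of_nonneg (Real.log_nonneg ((one_le_div hn0).2 h))]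

theorem truncatedSq_sub_log_of_ge (hx : 0 < x) {n : ℕ} (hn : 0 < n) {k : ℕ}
    (h : x ^ k ≤ n) : truncatedSq (k * Real.log x - Real.log n) = 0 := by
  have hn0 : (0 : ℝ) < n := Nat.cast_pos.2 hn
  rw [← log_pow_div_natCast hx hn,
    truncatedSq_of_nonpos (Real.log_nonpos (by positivity) ((div_le_one hn0).2 h))]

theorem log_sq_mul_smoothed (hx : 1 < x) (c : ℕ → ℂ) {n : ℕ} (hn : 0 < n) (hnx : (n : ℝ) < x ^ 3) :
    (Real.log x : ℂ) ^ 2 * smoothed x c n =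
      c n * ((truncatedSq (Real.log x - Real.log n)
        - 2 * truncatedSq (2 * Real.log x - Real.log n)
        + truncatedSq (3 * Real.log x - Real.log n) : ℝ) : ℂ) := by
  have hx0 : 0 < x := one_pos.trans hx
  have hT : (Real.log x : ℂ) ≠ 0 := ofReal_ne_zero.2 (Real.log_pos hx).ne'
  have hle := fun k => truncatedSq_sub_log_of_le (k := k) hx0 hn
  have hge := fun k => truncatedSq_sub_log_of_ge (k := k) hx0 hn
  have hx12 : x ^ 1 ≤ x ^ 2 := pow_le_pow_right₀ hx.le one_le_two
  have h3 := hle 3 hnx.le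
  rw [smoothed, if_pos hnx.le]
  split_ifs with h1 h2
  · have h1 := hle 1 (by rwa [pow_one])
    have h2 := hle 2 (by linarith)
    simp only [log_pow_div_natCast hx0 hn, Nat.cast_one, one_mul, Nat.cast_ofNat] at h1 h2 h3
    rw [h1, h2, h3]
    push_cast
    ring
  · have h1 := hge 1 (by rw [pow_one]; exact (not_le.1 h1).le)
    have h2 := hle 2 h2
    simp only [Nat.cast_one, one_mul, Nat.cast_ofNat] at h1 h2 h3
    rw [h1, h2, h3]
    push_cast
    field_simp
    ring
  · have h2 := hge 2 (not_le.1 h2).le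
    have h1 := hge 1 (hx12.trans (not_le.1 ‹_›).le)
    simp only [Nat.cast_one, one_mul, Nat.cast_ofNat] at h1 h2 h3
    rw [h1, h2, h3]
    push_cast
    field_simp
    ring

theorem log_sq_mul_sum_smoothed (hx : 1 < x) (c : ℕ → ℂ) (s : ℂ) :
    (Real.log x : ℂ) ^ 2 * ∑ n ∈ Finset.Ico 1 ⌈x ^ 3⌉₊, smoothed x c n / (n : ℂ) ^ s =
      rieszSum c s (Real.log x) - 2 * rieszSum c s (2 * Real.log x) +
        rieszSum c s (3 * Real.log x) := by
  have hT := Real.log_pos hx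
  have hlog : 3 * Real.log x ≤ Real.log ⌈x ^ 3⌉₊ := by
    refine le_trans (le_of_eq ?_) (Real.log_le_log (by positivity) (Nat.le_ceil (x ^ 3)))
    rw [Real.log_pow, Nat.cast_ofNat]
  rw [rieszSum_eq_sum c s (by linarith), rieszSum_eq_sum c s (by linarith),
    rieszSum_eq_sum c s hlog, Finset.mul_sum, Finset.mul_sum, ← Finset.sum_sub_distrib,
    ← Finset.sum_add_distrib]
  refine Finset.sum_congr rfl fun n hn => ?_
  obtain ⟨hn1, hnx⟩ := Finset.mem_Ico.1 hn
  rw [← mul_div_assoc, log_sq_mul_smoothed hx c hn1 (Nat.lt_ceil.1 hnx)]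
  push_cast
  ring

theorem log_sq_mul_kernel (hx : 1 < x) (s u m : ℂ) :
    (Real.log x : ℂ) ^ 2 * (m * kernel x s u) =
      m / (u - s) ^ 3 * cexp ((u - s) * Real.log x)
        - 2 * (m / (u - s) ^ 3 * cexp ((u - s) * (2 * Real.log x : ℝ)))
        + m / (u - s) ^ 3 * cexp ((u - s) * (3 * Real.log x : ℝ)) := by
  have hx0 : (x : ℂ) ≠ 0 := by exact_mod_cast (by linarith : x ≠ 0)
  have hT : (Real.log x : ℂ) ≠ 0 := by exact_mod_cast (Real.log_pos hx).ne'
  have hpow : (x : ℂ) ^ (u - s) = cexp ((u - s) * Real.log x) := by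
    rw [cpow_def_of_ne_zero hx0, ← ofReal_log (by linarith), mul_comm]
  have hexp : ∀ k : ℕ, cexp ((u - s) * (k * Real.log x : ℝ)) = ((x : ℂ) ^ (u - s)) ^ k :=
    fun k => by
      rw [hpow, ← Complex.exp_nat_mul]
      push_cast
      ring_nf
  have hexp2 := hexp 2
  have hexp3 := hexp 3
  rw [Nat.cast_ofNat] at hexp2 hexp3
  rw [kernel, hexp2, hexp3, ← hpow]
  field_simp
  ring

namespace HasMittagLefflerExpansion

theorem hasSum_log_sq_mul_kernel (h : HasMittagLefflerExpansion s B L m) (hx : 1 < x) :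
    HasSum (fun u => (Real.log x : ℂ) ^ 2 * (m u * kernel x s u))
      (poleSum m s (Real.log x) - 2 * poleSum m s (2 * Real.log x) +
        poleSum m s (3 * Real.log x)) := by
  have hT := Real.log_pos hx
  have hterm : ∀ t : ℝ, 0 < t →
      HasSum (fun u => m u / (u - s) ^ 3 * cexp ((u - s) * t)) (poleSum m s t) :=
    fun t ht => (h.summable_pole_term ht).hasSum
  exact hasSum_of_eq (((hterm _ hT).sub ((hterm _ (by linarith)).mul_left 2)).add
    (hterm _ (by linarith))) (fun u => log_sq_mul_kernel hx s u (m u)) rfl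

theorem summable_kernel (h : HasMittagLefflerExpansion s B L m) (hx : 1 < x) :
    Summable fun u => m u * kernel x s u :=
  (summable_mul_left_iff (pow_ne_zero 2 (ofReal_ne_zero.2 (Real.log_pos hx).ne'))).1
    (h.hasSum_log_sq_mul_kernel hx).summable

theorem explicit_formula (h : HasMittagLefflerExpansion s B L m)
    (hc : ∀ w : ℂ, σ < w.re → LSeriesHasSum c w (L w)) (hx : 1 < x) :
    L s = (∑ n ∈ Finset.Ico 1 ⌈x ^ 3⌉₊, smoothed x c n / (n : ℂ) ^ s) -
      ∑' u, m u * kernel x s u := by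
  obtain ⟨a, b, hab⟩ := h.exists_rieszSum_eq hc
  have hT := Real.log_pos hx
  have hTC : (Real.log x : ℂ) ≠ 0 := ofReal_ne_zero.2 hT.ne'
  have hkernel := (h.hasSum_log_sq_mul_kernel hx).tsum_eq
  have hsmoothed := log_sq_mul_sum_smoothed hx c s
  rw [tsum_mul_left] at hkernel
  -- The third difference annihilates the linear part and multiplies the quadratic one by `log² x`.
  rw [hab _ hT, hab _ (by linarith), hab _ (by linarith)] at hsmoothed
  push_cast at hsmoothed
  refine mul_left_cancel₀ (pow_ne_zero 2 hTC) ?_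
  linear_combination hkernel - hsmoothed

end HasMittagLefflerExpansion

end ExplicitFormula

section RiemannZeta

open MeasureTheory Set

/-- The fractional part, cut off to `(1, ∞)` so that it has a Mellin transform:
`ζ(s) = s/(s - 1) - s * mellin fractTail (-s)` for `0 < re s`. -/
noncomputable def fractTail : ℝ → ℂ := (Ioi (1 : ℝ)).indicator fun t => ((Int.fract t : ℝ) : ℂ)

theorem norm_ofReal_fract_le (t : ℝ) : ‖((Int.fract t : ℝ) : ℂ)‖ ≤ 1 := by
  rw [norm_real, Real.norm_of_nonneg (Int.fract_nonneg t)]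
  exact (Int.fract_lt_one t).le

theorem norm_fractTail_le (t : ℝ) : ‖fractTail t‖ ≤ 1 :=
  (norm_indicator_le_norm_self _ _).trans (norm_ofReal_fract_le t)

theorem measurable_fractTail : Measurable fractTail :=
  (measurable_ofReal.comp measurable_fract).indicator measurableSet_Ioi

theorem fractTail_of_le_one {t : ℝ} (ht : t ≤ 1) : fractTail t = 0 :=
  indicator_of_notMem (by simpa using ht) _

theorem differentiableAt_mellin_fractTail {s : ℂ} (hs : s.re < 0) :
    DifferentiableAt ℂ (mellin fractTail) s := by
  refine mellin_differentiableAt_of_isBigO_rpow (a := 0) (b := s.re - 1) ?_ ?_ hs ?_ (by linarith)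
  · exact ((locallyIntegrable_const (1 : ℝ)).mono measurable_fractTail.aestronglyMeasurable
      (ae_of_all _ fun t => by simpa using norm_fractTail_le t)).locallyIntegrableOn _
  · exact .of_bound 1 (.of_forall fun t => by simpa using norm_fractTail_le t)
  · refine .of_bound 1 ?_
    filter_upwards [mem_nhdsWithin_of_mem_nhds (Iio_mem_nhds (zero_lt_one (α := ℝ)))] with t ht
    rw [fractTail_of_le_one (mem_Iio.1 ht).le, norm_zero]
    positivity

theorem mellin_fractTail_neg (s : ℂ) :
    mellin fractTail (-s) =
      ∫ t in Ioi (1 : ℝ), ((Int.fract t : ℝ) : ℂ) * (t : ℂ) ^ (-(s + 1)) := by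
  have integrand_eq (t : ℝ) : (t : ℂ) ^ (-s - 1) • fractTail t =
      (Ioi 1).indicator (fun t : ℝ => ((Int.fract t : ℝ) : ℂ) * (t : ℂ) ^ (-(s + 1))) t := by
    rw [fractTail, smul_eq_mul, ← indicator_mul_right _ fun t : ℝ => (t : ℂ) ^ (-s - 1)]
    exact congrArg (fun g => (Ioi (1 : ℝ)).indicator g t)
      (funext fun t => by rw [mul_comm, neg_add'])
  simp only [mellin, integrand_eq]
  rw [setIntegral_indicator measurableSet_Ioi, Ioi_inter_Ioi, sup_of_le_right zero_le_one]

theorem integrableOn_fract_mul_cpow {s : ℂ} (hs : 0 < s.re) :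
    IntegrableOn (fun t : ℝ => ((Int.fract t : ℝ) : ℂ) * (t : ℂ) ^ (-(s + 1))) (Ioi 1) :=
  (integrableOn_Ioi_cpow_of_lt (by simpa using hs) one_pos).bdd_mul (c := 1)
    (measurable_ofReal.comp measurable_fract).aestronglyMeasurable
    (ae_of_all _ norm_ofReal_fract_le)

theorem integral_floor_mul_cpow {s : ℂ} (hs : 1 < s.re) :
    ∫ t in Ioi (1 : ℝ), (⌊t⌋₊ : ℂ) * (t : ℂ) ^ (-(s + 1)) =
      1 / (s - 1) - mellin fractTail (-s) := by
  have hs' : (-s).re < -1 := by simpa using hs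
  have integral_cpow : ∫ t in Ioi (1 : ℝ), (t : ℂ) ^ (-s) = 1 / (s - 1) := by
    rw [integral_Ioi_cpow_of_lt hs' one_pos, ofReal_one, one_cpow, neg_div, ← div_neg]
    ring_nf
  rw [← integral_cpow, mellin_fractTail_neg,
    ← integral_sub (integrableOn_Ioi_cpow_of_lt hs' one_pos)
      (integrableOn_fract_mul_cpow (by linarith))]
  refine setIntegral_congr_fun measurableSet_Ioi fun t ht => ?_
  have ht0 : (0 : ℝ) < t := one_pos.trans ht
  have cpow_eq : (t : ℂ) ^ (-s) = t * (t : ℂ) ^ (-(s + 1)) := by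
    rw [show -s = 1 + -(s + 1) by ring, cpow_add _ _ (by exact_mod_cast ht0.ne'), cpow_one]
  have fract_eq : ((Int.fract t : ℝ) : ℂ) = t - (⌊t⌋₊ : ℂ) := by
    rw [Int.fract, ofReal_sub, ← natCast_floor_eq_intCast_floor ht0.le, ofReal_natCast]
  simp only [cpow_eq, fract_eq]
  ring

theorem riemannZeta₁_eq_sub_one_mul {s : ℂ} (hs : s ≠ 1) :
    riemannZeta₁ s = (s - 1) * riemannZeta s := by
  rw [riemannZeta_eq_inv_sub_mul hs, mul_inv_cancel_left₀ (sub_ne_zero.2 hs)]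

theorem riemannZeta₁_eq_of_one_lt_re {s : ℂ} (hs : 1 < s.re) :
    riemannZeta₁ s = s - s * (s - 1) * mellin fractTail (-s) := by
  have s_ne_one : s ≠ 1 := fun h => by simp [h] at hs
  have zeta_eq : riemannZeta s = s * ∫ t in Ioi (1 : ℝ), (⌊t⌋₊ : ℂ) * (t : ℂ) ^ (-(s + 1)) := by
    rw [← LSeries_one_eq_riemannZeta hs, LSeries_eq_mul_integral 1 zero_le_one hs
      (LSeriesSummable_one_iff.2 hs) (.of_bound 1 (.of_forall fun n => by simp))]
    simp
  rw [riemannZeta₁_eq_sub_one_mul s_ne_one, zeta_eq, integral_floor_mul_cpow hs]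
  field_simp [sub_ne_zero.2 s_ne_one]

theorem riemannZeta₁_eq_of_re_pos {s : ℂ} (hs : 0 < s.re) :
    riemannZeta₁ s = s - s * (s - 1) * mellin fractTail (-s) := by
  have isOpen_halfPlane (a : ℝ) : IsOpen {s : ℂ | a < s.re} :=
    isOpen_lt continuous_const continuous_re
  have differentiableOn_rhs : DifferentiableOn ℂ
      (fun s : ℂ => s - s * (s - 1) * mellin fractTail (-s)) {s : ℂ | 0 < s.re} := fun w hw => by
    have : DifferentiableAt ℂ (fun s : ℂ => mellin fractTail (-s)) w :=
      (differentiableAt_mellin_fractTail (by simpa using hw)).comp w (by fun_prop)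
    exact DifferentiableAt.differentiableWithinAt (by fun_prop)
  refine (differentiable_riemannZeta₁.differentiableOn.analyticOnNhd
    (isOpen_halfPlane 0)).eqOn_of_preconnected_of_eventuallyEq
    (differentiableOn_rhs.analyticOnNhd (isOpen_halfPlane 0))
    (convex_halfSpace_re_gt 0).isPreconnected (z₀ := 2) (by simp) ?_ hs
  filter_upwards [(isOpen_halfPlane 1).mem_nhds (by simp : (2 : ℂ) ∈ {s : ℂ | 1 < s.re})] with w hw
  exact riemannZeta₁_eq_of_one_lt_re hw

theorem norm_mellin_fractTail_neg_le {s : ℂ} (hs : 1 / 2 ≤ s.re) :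
    ‖mellin fractTail (-s)‖ ≤ 2 := by
  have integral_rpow : ∫ t in Ioi (1 : ℝ), t ^ (-(3 / 2) : ℝ) = 2 := by
    rw [integral_Ioi_rpow_of_lt (by norm_num) one_pos]; norm_num
  rw [mellin_fractTail_neg, ← integral_rpow]
  refine norm_integral_le_of_norm_le (integrableOn_Ioi_rpow_of_lt (by norm_num) one_pos) ?_
  refine (ae_restrict_mem measurableSet_Ioi).mono fun t ht => ?_
  have one_lt_t : (1 : ℝ) < t := ht
  rw [norm_mul, norm_cpow_eq_rpow_re_of_pos (by linarith)]
  calc ‖((Int.fract t : ℝ) : ℂ)‖ * t ^ (-(s + 1)).re ≤ 1 * t ^ (-(3 / 2) : ℝ) := by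
        gcongr
        · exact norm_ofReal_fract_le t
        · exact one_lt_t.le
        · simp only [neg_re, add_re, one_re]; linarith
    _ = _ := one_mul _

theorem norm_riemannZeta₁_le {s : ℂ} (hs : 1 / 2 ≤ s.re) :
    ‖riemannZeta₁ s‖ ≤ 4 * (1 + ‖s‖) ^ 2 := by
  rw [riemannZeta₁_eq_of_re_pos (by linarith)]
  have norm_sub_one_le : ‖s - 1‖ ≤ ‖s‖ + 1 := (norm_sub_le _ _).trans_eq (by rw [norm_one])
  calc ‖s - s * (s - 1) * mellin fractTail (-s)‖
      ≤ ‖s‖ + ‖s‖ * (‖s‖ + 1) * 2 := by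
        refine (norm_sub_le _ _).trans ?_
        rw [norm_mul, norm_mul]
        gcongr
        exact norm_mellin_fractTail_neg_le hs
    _ ≤ 4 * (1 + ‖s‖) ^ 2 := by nlinarith [norm_nonneg s]

theorem norm_Gamma_le_Gamma_re {s : ℂ} (hs : 0 < s.re) :
    ‖Complex.Gamma s‖ ≤ Real.Gamma s.re := by
  rw [Complex.Gamma_eq_integral hs, Real.Gamma_eq_integral hs, Complex.GammaIntegral]
  refine norm_integral_le_of_norm_le (Real.GammaIntegral_convergent hs) ?_
  refine (ae_restrict_mem measurableSet_Ioi).mono fun t ht => ?_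
  rw [norm_mul, norm_cpow_eq_rpow_re_of_pos ht, norm_real, Real.norm_of_nonneg (Real.exp_pos _).le,
    sub_re, one_re]

theorem norm_Gamma_le_exp_of_two_le_re {s : ℂ} (hs : 2 ≤ s.re) :
    ‖Complex.Gamma s‖ ≤ Real.exp (‖s‖ ^ 2) := by
  set n := ⌊s.re⌋₊
  have re_le : s.re ≤ n + 1 := (Nat.lt_floor_add_one _).le
  have n_le : (n : ℝ) ≤ ‖s‖ := (Nat.floor_le (by linarith)).trans (re_le_norm s)
  calc ‖Complex.Gamma s‖ ≤ Real.Gamma s.re := norm_Gamma_le_Gamma_re (by linarith)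
    _ ≤ Real.Gamma (n + 1) :=
        Real.Gamma_strictMonoOn_Ici.monotoneOn hs (hs.trans re_le) re_le
    _ = (n.factorial : ℝ) := Real.Gamma_nat_eq_factorial n
    _ ≤ (n : ℝ) ^ n := by exact_mod_cast Nat.factorial_le_pow n
    _ ≤ Real.exp n ^ n := by gcongr; linarith [Real.add_one_le_exp (n : ℝ)]
    _ = Real.exp ((n : ℝ) ^ 2) := by rw [← Real.exp_nat_mul, sq]
    _ ≤ Real.exp (‖s‖ ^ 2) := by gcongr

theorem norm_Gamma_le_exp {s : ℂ} (hs : 1 / 2 ≤ s.re) :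
    ‖Complex.Gamma s‖ ≤ Real.exp (5 * (1 + ‖s‖) ^ 2) := by
  have s_ne_zero : s ≠ 0 := fun h => by norm_num [h] at hs
  have re_add_one : (s + 1).re = s.re + 1 := by simp
  have re_add_two : (s + 2).re = s.re + 2 := by simp
  have s_add_one_ne_zero : s + 1 ≠ 0 := fun h => by
    rw [h, zero_re] at re_add_one
    linarith
  have Gamma_add_two : Complex.Gamma (s + 2) = (s + 1) * (s * Complex.Gamma s) := by
    rw [← Complex.Gamma_add_one s s_ne_zero, ← Complex.Gamma_add_one (s + 1) s_add_one_ne_zero]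
    ring_nf
  have half_le : 1 / 2 ≤ ‖s + 1‖ * ‖s‖ := by
    nlinarith [re_le_norm s, re_le_norm (s + 1)]
  have norm_add_two_le : ‖s + 2‖ ≤ 2 * (1 + ‖s‖) :=
    (norm_add_le _ _).trans (by rw [Complex.norm_ofNat]; linarith [norm_nonneg s])
  calc ‖Complex.Gamma s‖ = 2 * (1 / 2 * ‖Complex.Gamma s‖) := by ring
    _ ≤ 2 * (‖s + 1‖ * ‖s‖ * ‖Complex.Gamma s‖) := by gcongr
    _ = 2 * ‖Complex.Gamma (s + 2)‖ := by rw [Gamma_add_two, norm_mul, norm_mul, mul_assoc]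
    _ ≤ Real.exp 1 * Real.exp (‖s + 2‖ ^ 2) := by
        gcongr
        · linarith [Real.add_one_le_exp 1]
        · exact norm_Gamma_le_exp_of_two_le_re (by linarith)
    _ ≤ Real.exp (5 * (1 + ‖s‖) ^ 2) := by
        rw [← Real.exp_add, Real.exp_le_exp]
        nlinarith [norm_nonneg s, norm_nonneg (s + 2)]

theorem entireOfGrowth_cos : EntireOfGrowth 1 Complex.cos := by
  have exp_mul (a : ℂ) : EntireOfGrowth 1 fun w => cexp (a * w) := by
    simpa using entireOfGrowth_exp.comp_affine a 0
  convert ((exp_mul I).add (exp_mul (-I))).mul (.const 1 2⁻¹) using 2 with w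
  rw [Complex.cos, ← div_eq_mul_inv, mul_comm w, neg_mul_comm, mul_comm w]

theorem entireOfGrowth_id : EntireOfGrowth 1 fun w => w :=
  .of_norm_le (C := 1) (R := 0) differentiable_id fun w _ => by
    linarith [Real.add_one_le_exp (1 * (1 + ‖w‖) ^ 1)]

theorem entireOfGrowth_const_cpow {b : ℂ} (hb : b ≠ 0) : EntireOfGrowth 1 fun w => b ^ w := by
  simpa only [cpow_def_of_ne_zero hb, add_zero] using
    entireOfGrowth_exp.comp_affine (Complex.log b) 0

/-- The zero-free part of the functional equation of `ζ(s) (s - 1)`, see `riemannZeta₁_one_sub`. -/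
noncomputable def reflectionFactor (w : ℂ) : ℂ :=
  -w * (2 * (2 * Real.pi) ^ (-w)) * Complex.Gamma w

theorem ne_neg_natCast_of_re_pos {s : ℂ} (hs : 0 < s.re) (n : ℕ) : s ≠ -n := fun h => by
  rw [h, neg_re, natCast_re, neg_pos] at hs
  exact (Nat.cast_nonneg n).not_gt hs

theorem riemannZeta₁_one_sub {w : ℂ} (hw : 0 < w.re) :
    (w - 1) * riemannZeta₁ (1 - w) =
      reflectionFactor w * Complex.cos (Real.pi * w / 2) * riemannZeta₁ w := by
  by_cases hw1 : w = 1
  · simp [hw1, Complex.cos_pi_div_two]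
  have w_ne_zero : 1 - w ≠ 1 := fun h => by
    rw [sub_eq_self.1 h] at hw
    simp at hw
  rw [riemannZeta₁_eq_sub_one_mul w_ne_zero, riemannZeta₁_eq_sub_one_mul hw1,
    riemannZeta_one_sub (ne_neg_natCast_of_re_pos hw) hw1, reflectionFactor]
  ring

theorem two_mul_pi_cpow_ne_zero (w : ℂ) : (2 * Real.pi : ℂ) ^ w ≠ 0 := by
  simp [cpow_eq_zero_iff, Real.pi_ne_zero]

theorem reflectionFactor_ne_zero {w : ℂ} (hw : 0 < w.re) : reflectionFactor w ≠ 0 :=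
  mul_ne_zero (mul_ne_zero (neg_ne_zero.2 fun h => by simp [h] at hw)
    (mul_ne_zero two_ne_zero (two_mul_pi_cpow_ne_zero _))) (Complex.Gamma_ne_zero_of_re_pos hw)

theorem analyticAt_reflectionFactor {w : ℂ} (hw : 0 < w.re) : AnalyticAt ℂ reflectionFactor w := by
  have hd : DifferentiableOn ℂ reflectionFactor {w | 0 < w.re} := fun t ht => by
    have differentiableAt_Gamma := differentiableAt_Gamma t (ne_neg_natCast_of_re_pos ht)
    have differentiableAt_cpow : DifferentiableAt ℂ (fun w : ℂ => (2 * Real.pi : ℂ) ^ (-w)) t :=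
      DifferentiableAt.const_cpow (by fun_prop) (Or.inl (by simp [Real.pi_ne_zero]))
    unfold reflectionFactor
    exact DifferentiableAt.differentiableWithinAt (by fun_prop)
  exact hd.analyticAt ((isOpen_lt continuous_const continuous_re).mem_nhds hw)

theorem exists_norm_reflectionFactor_mul_cos_le :
    ∃ C, 0 ≤ C ∧ ∀ w : ℂ, 1 / 2 ≤ w.re →
      ‖reflectionFactor w * Complex.cos (Real.pi * w / 2)‖ ≤ Real.exp (C * (1 + ‖w‖) ^ 2) := by
  have two_pi_ne_zero : (2 * Real.pi : ℂ) ≠ 0 := by simp [Real.pi_ne_zero]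
  have growth_cpow : EntireOfGrowth 1 fun w => (2 * Real.pi : ℂ) ^ (-w) := by
    simpa using (entireOfGrowth_const_cpow two_pi_ne_zero).comp_affine (-1) 0
  have growth_cos : EntireOfGrowth 1 fun w : ℂ => Complex.cos (Real.pi * w / 2) := by
    convert entireOfGrowth_cos.comp_affine (Real.pi / 2) 0 using 3
    ring
  have growth := ((entireOfGrowth_id.neg.mul ((EntireOfGrowth.const 1 2).mul growth_cpow)).mul
    growth_cos).mono one_le_two
  obtain ⟨C, hC, hle⟩ := growth.norm_le
  refine ⟨C + 5, by positivity, fun w hw => ?_⟩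
  rw [reflectionFactor, mul_right_comm, norm_mul, add_mul, Real.exp_add]
  gcongr
  exacts [hle w, norm_Gamma_le_exp hw]

theorem entireOfGrowth_riemannZeta₁ : EntireOfGrowth 2 riemannZeta₁ := by
  obtain ⟨C, hC, hle⟩ := exists_norm_reflectionFactor_mul_cos_le
  have norm_le_exp {s : ℂ} (hs : 1 / 2 ≤ s.re) :
      ‖riemannZeta₁ s‖ ≤ Real.exp (4 * (1 + ‖s‖) ^ 2) := by
    linarith [norm_riemannZeta₁_le hs, Real.add_one_le_exp (4 * (1 + ‖s‖) ^ 2)]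
  refine .of_norm_le differentiable_riemannZeta₁ (C := 4 * (C + 4)) (R := 1) fun s one_le => ?_
  rcases le_total (1 / 2) s.re with hs | hs
  · refine (norm_le_exp hs).trans (Real.exp_le_exp.2 ?_)
    gcongr
    linarith
  · have hw : 1 / 2 ≤ (1 - s).re := by simp only [sub_re, one_re]; linarith
    have norm_one_sub_le : 1 + ‖1 - s‖ ≤ 2 * (1 + ‖s‖) := by
      linarith [norm_sub_le 1 s, norm_one (α := ℂ), norm_nonneg s]
    have reflection := riemannZeta₁_one_sub (w := 1 - s) (by linarith)
    rw [sub_sub_cancel, sub_sub_cancel_left] at reflection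
    calc ‖riemannZeta₁ s‖ ≤ ‖-s‖ * ‖riemannZeta₁ s‖ := by
          rw [norm_neg]; exact le_mul_of_one_le_left (norm_nonneg _) one_le
      _ = _ := by rw [← norm_mul, reflection, norm_mul]
      _ ≤ Real.exp (C * (1 + ‖1 - s‖) ^ 2) * Real.exp (4 * (1 + ‖1 - s‖) ^ 2) :=
          mul_le_mul (hle _ hw) (norm_le_exp hw) (norm_nonneg _) (Real.exp_pos _).le
      _ = Real.exp ((C + 4) * (1 + ‖1 - s‖) ^ 2) := by rw [← Real.exp_add, add_mul]
      _ ≤ Real.exp ((C + 4) * (2 * (1 + ‖s‖)) ^ 2) := by gcongr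
      _ = Real.exp (4 * (C + 4) * (1 + ‖s‖) ^ 2) := by ring_nf

theorem riemannZeta₁_ne_zero_of_one_le_re {s : ℂ} (hs : 1 ≤ s.re) : riemannZeta₁ s ≠ 0 := by
  by_cases h : s = 1
  · rw [h, riemannZeta₁_one]
    exact one_ne_zero
  · rw [riemannZeta₁_eq_sub_one_mul h]
    exact mul_ne_zero (sub_ne_zero.2 h) (riemannZeta_ne_zero_of_one_le_re hs)

theorem trivialZero_re_neg (q : ℕ+) : (trivialZero q).re < 0 := by
  simp [trivialZero]

theorem exists_eq_trivialZero {s : ℂ} (h : riemannZeta s = 0) (hs : s.re ≤ 0) :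
    ∃ q : ℕ+, s = trivialZero q := by
  have s_ne_zero : s ≠ 0 := fun h0 => by norm_num [h0, riemannZeta_zero] at h
  have s_ne_one : s ≠ 1 := fun h1 => by norm_num [h1] at hs
  have one_le_re : 1 ≤ (1 - s).re := by simpa using hs
  have re_pos : 0 < (1 - s).re := by linarith
  have cos_eq_zero : Complex.cos (Real.pi * (1 - s) / 2) = 0 := by
    have reflection := riemannZeta₁_one_sub re_pos
    rw [sub_sub_cancel, riemannZeta₁_eq_sub_one_mul s_ne_one, h, mul_zero, mul_zero, eq_comm,
      mul_eq_zero_iff_right (riemannZeta₁_ne_zero_of_one_le_re one_le_re)] at reflection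
    exact (mul_eq_zero.1 reflection).resolve_left (reflectionFactor_ne_zero re_pos)
  obtain ⟨k, hk⟩ := Complex.cos_eq_zero_iff.1 cos_eq_zero
  have s_eq : s = -2 * k := by
    have : (Real.pi : ℂ) ≠ 0 := by exact_mod_cast Real.pi_ne_zero
    field_simp at hk
    linear_combination -hk
  have k_pos : 0 < k := by
    have re_eq : s.re = -2 * k := by rw [s_eq]; simp
    have k_nonneg : 0 ≤ k := by
      have : (0 : ℝ) ≤ k := by linarith
      exact_mod_cast this
    exact k_nonneg.lt_of_ne' fun hk0 => s_ne_zero (by rw [s_eq, hk0]; simp)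
  lift k to ℕ using k_pos.le
  exact ⟨⟨k, by exact_mod_cast k_pos⟩, s_eq⟩

theorem analyticOrderAt_cos_eq_one {u : ℂ} (hu : Complex.cos u = 0) :
    analyticOrderAt Complex.cos u = 1 := by
  refine AnalyticAt.analyticOrderAt_eq_one_of_zero_deriv_ne_zero analyticAt_cos hu ?_
  rw [Complex.deriv_cos, neg_ne_zero]
  intro sin_eq_zero
  simpa [sin_eq_zero, hu] using Complex.sin_sq_add_cos_sq u

theorem analyticOrderNatAt_mul_of_ne_zero {f g : ℂ → ℂ} {u : ℂ} (hf : AnalyticAt ℂ f u)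
    (hg : AnalyticAt ℂ g u) (hfu : f u ≠ 0) :
    analyticOrderNatAt (fun w => f w * g w) u = analyticOrderNatAt g u := by
  have := analyticOrderAt_mul hf hg
  rw [hf.analyticOrderAt_eq_zero.2 hfu, zero_add] at this
  exact congrArg ENat.toNat this

theorem analyticOrderNatAt_riemannZeta₁_trivialZero (q : ℕ+) :
    analyticOrderNatAt riemannZeta₁ (trivialZero q) = 1 := by
  have one_lt_re : 1 < (1 - trivialZero q).re := by
    rw [sub_re, one_re]
    linarith [trivialZero_re_neg q]
  have re_pos : 0 < (1 - trivialZero q).re := by linarith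
  generalize hw : 1 - trivialZero q = w at *
  have w_ne_one : w - 1 ≠ 0 := sub_ne_zero.2 fun h => by simp [h] at one_lt_re
  have half_pi_ne_zero : (Real.pi / 2 : ℂ) ≠ 0 := by simp [Real.pi_ne_zero]
  have cos_eq_zero : Complex.cos (Real.pi / 2 * w + 0) = 0 :=
    Complex.cos_eq_zero_iff.2 ⟨(q : ℕ), by rw [← hw, trivialZero]; push_cast; ring⟩
  have reflection : (fun t => (t - 1) * riemannZeta₁ (-1 * t + 1)) =ᶠ[𝓝 w] fun t =>
      reflectionFactor t * riemannZeta₁ t * Complex.cos (Real.pi / 2 * t + 0) := by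
    filter_upwards [(isOpen_lt continuous_const continuous_re).mem_nhds re_pos] with t ht
    rw [neg_one_mul, neg_add_eq_sub, riemannZeta₁_one_sub ht]
    ring_nf
  have differentiable_reflected : Differentiable ℂ fun t => riemannZeta₁ (-1 * t + 1) :=
    differentiable_riemannZeta₁.comp (by fun_prop)
  calc analyticOrderNatAt riemannZeta₁ (trivialZero q)
      = analyticOrderNatAt (fun t => riemannZeta₁ (-1 * t + 1)) w := by
        rw [analyticOrderNatAt_comp_affine riemannZeta₁ (neg_ne_zero.2 one_ne_zero), ← hw]
        ring_nf
    _ = analyticOrderNatAt (fun t => (t - 1) * riemannZeta₁ (-1 * t + 1)) w :=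
        (analyticOrderNatAt_mul_of_ne_zero (by fun_prop) (differentiable_reflected.analyticAt w)
          w_ne_one).symm
    _ = analyticOrderNatAt (fun t => Complex.cos (Real.pi / 2 * t + 0)) w := by
        rw [analyticOrderNatAt, analyticOrderAt_congr reflection]
        exact analyticOrderNatAt_mul_of_ne_zero
          ((analyticAt_reflectionFactor re_pos).mul (differentiable_riemannZeta₁.analyticAt w))
          (by fun_prop)
          (mul_ne_zero (reflectionFactor_ne_zero re_pos)
            (riemannZeta₁_ne_zero_of_one_le_re one_lt_re.le))
    _ = 1 := by
        rw [analyticOrderNatAt_comp_affine Complex.cos half_pi_ne_zero, analyticOrderNatAt,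
          analyticOrderAt_cos_eq_one cos_eq_zero, ENat.toNat_one]

theorem zeroMult_riemannZeta {ρ : ℂ} (hρ : ρ ≠ 1) :
    zeroMult riemannZeta ρ = analyticOrderNatAt riemannZeta₁ ρ := by
  have analyticAt_inv : AnalyticAt ℂ (fun s : ℂ => (s - 1)⁻¹) ρ :=
    AnalyticAt.inv (by fun_prop) (sub_ne_zero.2 hρ)
  have riemannZeta_eq : riemannZeta =ᶠ[𝓝[≠] ρ] (fun s : ℂ => (s - 1)⁻¹) * riemannZeta₁ := by
    filter_upwards [mem_nhdsWithin_of_mem_nhds (isOpen_ne.mem_nhds hρ)] with s hs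
    exact riemannZeta_eq_inv_sub_mul hs
  have order_ne_top := analyticOrderAt_ne_top_of_apply_ne_zero differentiable_riemannZeta₁
    (z := 1) (by simp) ρ
  rw [zeroMult, meromorphicOrderAt_congr riemannZeta_eq,
    meromorphicOrderAt_mul_of_ne_zero analyticAt_inv (inv_ne_zero (sub_ne_zero.2 hρ)),
    (differentiable_riemannZeta₁.analyticAt ρ).meromorphicOrderAt_eq,
    ← Nat.cast_analyticOrderNatAt order_ne_top, ENat.map_natCast]
  simp

end RiemannZeta

section DirichletSeries

open LSeries LSeries.notation

/-- On some half-plane `F` is the sum of an absolutely convergent Dirichlet series with first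
coefficient `v`. Recording `v` is what makes inversion possible (`v = 1`) and shows that the
coefficients of a logarithmic derivative start at `n = 2` (`v = 0`). -/
def HasDirichletSeries (F : ℂ → ℂ) (v : ℂ) : Prop :=
  ∃ a : ℕ → ℂ, a 1 = v ∧ ∃ σ : ℝ, ∀ s : ℂ, σ < s.re → LSeriesHasSum a s (F s)

theorem LSeriesSummable_delta (s : ℂ) : LSeriesSummable δ s :=
  summable_of_ne_finset_zero (s := {1}) fun n hn => by
    rw [term_delta, if_neg (Finset.notMem_singleton.1 hn)]

namespace HasDirichletSeries

variable {F G : ℂ → ℂ} {v w : ℂ}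

theorem congr (hF : HasDirichletSeries F v) (σ : ℝ) (h : ∀ s : ℂ, σ < s.re → G s = F s) :
    HasDirichletSeries G v := by
  obtain ⟨a, ha, τ, hτ⟩ := hF
  refine ⟨a, ha, max σ τ, fun s hs => ?_⟩
  rw [h s (lt_of_le_of_lt (le_max_left _ _) hs)]
  exact hτ s (lt_of_le_of_lt (le_max_right _ _) hs)

theorem value (hF : HasDirichletSeries F v) (h : v = w) : HasDirichletSeries F w := h ▸ hF

theorem add (hF : HasDirichletSeries F v) (hG : HasDirichletSeries G w) :
    HasDirichletSeries (fun s => F s + G s) (v + w) := by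
  obtain ⟨a, rfl, σ, hσ⟩ := hF
  obtain ⟨b, rfl, τ, hτ⟩ := hG
  exact ⟨a + b, rfl, max σ τ, fun s hs =>
    (hσ s (lt_of_le_of_lt (le_max_left _ _) hs)).add (hτ s (lt_of_le_of_lt (le_max_right _ _) hs))⟩

theorem const_mul (c : ℂ) (hF : HasDirichletSeries F v) :
    HasDirichletSeries (fun s => c * F s) (c * v) := by
  obtain ⟨a, rfl, σ, hσ⟩ := hF
  exact ⟨c • a, rfl, σ, fun s hs => (hσ s hs).smul c⟩

theorem sub (hF : HasDirichletSeries F v) (hG : HasDirichletSeries G w) :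
    HasDirichletSeries (fun s => F s - G s) (v - w) := by
  simpa only [neg_mul, one_mul, ← sub_eq_add_neg] using hF.add (hG.const_mul (-1))

theorem mul (hF : HasDirichletSeries F v) (hG : HasDirichletSeries G w) :
    HasDirichletSeries (fun s => F s * G s) (v * w) := by
  obtain ⟨a, rfl, σ, hσ⟩ := hF
  obtain ⟨b, rfl, τ, hτ⟩ := hG
  refine ⟨a ⍟ b, by simp [convolution_def], max σ τ, fun s hs => ?_⟩
  exact (hσ s (lt_of_le_of_lt (le_max_left _ _) hs)).convolution
    (hτ s (lt_of_le_of_lt (le_max_right _ _) hs))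

theorem one : HasDirichletSeries (fun _ => 1) 1 := by
  refine ⟨δ, by simp [delta], 1, fun s _ => ?_⟩
  have hsum : LSeries δ s = 1 := by rw [LSeries_delta, Pi.one_apply]
  exact hsum ▸ (LSeriesSummable_delta s).LSeriesHasSum

theorem const (c : ℂ) : HasDirichletSeries (fun _ => c) c := by
  simpa using one.const_mul c

theorem sum {ι : Type*} (S : Finset ι) {F : ι → ℂ → ℂ} {v : ι → ℂ}
    (h : ∀ i ∈ S, HasDirichletSeries (F i) (v i)) :
    HasDirichletSeries (fun s => ∑ i ∈ S, F i s) (∑ i ∈ S, v i) := by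
  classical
  induction S using Finset.induction_on with
  | empty => simpa using const 0
  | insert i S hi ih =>
    simp only [Finset.sum_insert hi]
    exact (h i (Finset.mem_insert_self _ _)).add
      (ih fun j hj => h j (Finset.mem_insert_of_mem hj))

theorem prod {ι : Type*} (S : Finset ι) {F : ι → ℂ → ℂ} {v : ι → ℂ}
    (h : ∀ i ∈ S, HasDirichletSeries (F i) (v i)) :
    HasDirichletSeries (fun s => ∏ i ∈ S, F i s) (∏ i ∈ S, v i) := by
  classical
  induction S using Finset.induction_on with
  | empty => simpa using one
  | insert i S hi ih =>
    simp only [Finset.prod_insert hi]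
    exact (h i (Finset.mem_insert_self _ _)).mul
      (ih fun j hj => h j (Finset.mem_insert_of_mem hj))

theorem comp_add (hF : HasDirichletSeries F v) (b : ℂ) :
    HasDirichletSeries (fun s => F (s + b)) v := by
  obtain ⟨a, rfl, σ, hσ⟩ := hF
  refine ⟨fun n => a n * (n : ℂ) ^ (-b), by simp, σ - b.re, fun s hs => ?_⟩
  have h := hσ (s + b) (by rw [add_re]; linarith)
  refine hasSum_of_eq h (fun n => ?_) rfl
  rcases eq_or_ne n 0 with rfl | hn
  · simp
  · rw [term_of_ne_zero hn, term_of_ne_zero hn, cpow_add _ _ (by exact_mod_cast hn), cpow_neg]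
    field_simp

theorem comp_two_mul (hF : HasDirichletSeries F v) :
    HasDirichletSeries (fun s => F (2 * s)) v := by
  classical
  obtain ⟨a, rfl, σ, hσ⟩ := hF
  refine ⟨fun n => if IsSquare n then a (Nat.sqrt n) else 0, by simp, σ / 2, fun s hs => ?_⟩
  have h := hσ (2 * s) (by simp; linarith)
  have mul_self_injective : Function.Injective fun n : ℕ => n * n := fun m n h =>
    Nat.mul_self_inj.1 h
  refine (mul_self_injective.hasSum_iff fun n hn => ?_).1 (hasSum_of_eq h (fun n => ?_) rfl)
  · have hns : ¬ IsSquare n := fun ⟨r, hr⟩ => hn ⟨r, hr.symm⟩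
    simp [term_def, hns]
  · rcases eq_or_ne n 0 with rfl | hn
    · simp
    · simp only [Function.comp_apply]
      rw [term_of_ne_zero hn, term_of_ne_zero (mul_ne_zero hn hn), if_pos ⟨n, rfl⟩, Nat.sqrt_eq,
        two_mul, cpow_add _ _ (by exact_mod_cast hn), Nat.cast_mul, natCast_mul_natCast_cpow]

theorem one_div_natCast_cpow {p : ℕ} (hp : 1 < p) :
    HasDirichletSeries (fun s => 1 / (p : ℂ) ^ s) 0 := by
  refine ⟨Pi.single p 1, by rw [Pi.single_eq_of_ne hp.ne], 0, fun s _ => ?_⟩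
  refine hasSum_of_eq (hasSum_ite_eq p (1 / (p : ℂ) ^ s)) (fun n => ?_) rfl
  rcases eq_or_ne n p with rfl | hn
  · rw [term_of_ne_zero (by omega)]; simp
  · simp [term_def, hn]

theorem zeta : HasDirichletSeries riemannZeta 1 :=
  ⟨1, rfl, 1, fun _ hs => LSeriesHasSum_one hs⟩

theorem deriv (hF : HasDirichletSeries F v) : HasDirichletSeries (deriv F) 0 := by
  obtain ⟨a, rfl, σ, hσ⟩ := hF
  have ha : abscissaOfAbsConv a ≤ σ := by
    refine abscissaOfAbsConv_le_of_forall_lt_LSeriesSummable fun y hy => ?_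
    exact (hσ y (by simpa using hy)).LSeriesSummable
  refine ⟨-logMul a, by simp [logMul], σ, fun s hs => ?_⟩
  have hs' : abscissaOfAbsConv a < s.re := lt_of_le_of_lt ha (by exact_mod_cast hs)
  have hderiv : _root_.deriv F s = _root_.deriv (LSeries a) s := by
    refine EventuallyEq.deriv_eq ?_
    filter_upwards [(isOpen_lt continuous_const continuous_re).mem_nhds hs] with w hw
    exact (hσ w hw).LSeries_eq.symm
  rw [hderiv, LSeries_deriv hs', ← LSeries_neg]
  exact (LSeriesSummable_logMul_of_lt_re hs').neg.LSeriesHasSum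

end HasDirichletSeries

section Inverse

theorem sum_divisorsAntidiagonal_le {η β : ℕ → ℝ} (hη : ∀ n, 0 ≤ η n) (hβ : ∀ n, 0 ≤ β n)
    (N : ℕ) :
    ∑ n ∈ Finset.range N, ∑ p ∈ n.divisorsAntidiagonal, η p.1 * β p.2
      ≤ (∑ n ∈ Finset.range N, η n) * ∑ n ∈ Finset.range N, β n := by
  rw [Finset.sum_mul_sum, ← Finset.sum_product']
  have hnonneg : ∀ p : ℕ × ℕ, 0 ≤ η p.1 * β p.2 := fun p => mul_nonneg (hη _) (hβ _)
  refine le_trans (Finset.sum_le_sum fun n hn => ?_)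
    (Finset.sum_fiberwise_le_sum_of_sum_fiber_nonneg (s := Finset.range N ×ˢ Finset.range N)
      (t := Finset.range N) (g := fun p => p.1 * p.2) (f := fun p => η p.1 * β p.2)
      fun _ _ => Finset.sum_nonneg fun p _ => hnonneg p)
  refine Finset.sum_le_sum_of_subset_of_nonneg (fun p hp => ?_) fun p _ _ => hnonneg p
  obtain ⟨rfl, hne⟩ := Nat.mem_divisorsAntidiagonal.1 hp
  obtain ⟨hne₁, hne₂⟩ := mul_ne_zero_iff.1 hne
  have hn' := Finset.mem_range.1 hn
  simp only [Finset.mem_filter, Finset.mem_product, Finset.mem_range, and_true]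
  exact ⟨(Nat.le_mul_of_pos_right _ (Nat.pos_of_ne_zero hne₂)).trans_lt hn',
    (Nat.le_mul_of_pos_left _ (Nat.pos_of_ne_zero hne₁)).trans_lt hn'⟩

theorem norm_term_add_nat_le {h : ℕ → ℂ} (h1 : h 1 = 0) (σ : ℝ) (k n : ℕ) :
    ‖term h ((σ + k : ℝ) : ℂ) n‖ ≤ (1 / 2) ^ k * ‖term h (σ : ℂ) n‖ := by
  rw [norm_term_eq, norm_term_eq]
  rcases eq_or_ne n 0 with rfl | hn
  · simp
  rcases eq_or_ne n 1 with rfl | hn1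
  · simp [h1]
  rw [if_neg hn, if_neg hn, ofReal_re, ofReal_re]
  have hn0 : (0 : ℝ) < n := by exact_mod_cast Nat.pos_of_ne_zero hn
  have hn2 : (2 : ℝ) ≤ n := by exact_mod_cast (by omega : 2 ≤ n)
  rw [Real.rpow_add hn0, Real.rpow_natCast, ← div_div, div_eq_mul_inv _ ((n : ℝ) ^ k), mul_comm,
    one_div, inv_pow]
  exact mul_le_mul_of_nonneg_right
    (inv_anti₀ (by positivity) (pow_le_pow_left₀ (by norm_num) hn2 k)) (by positivity)

theorem exists_sum_norm_term_le_half {h : ℕ → ℂ} (h1 : h 1 = 0) {σ : ℝ}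
    (hs : LSeriesSummable h σ) :
    ∃ τ : ℝ, ∀ N, ∑ n ∈ Finset.range N, ‖term h (τ : ℂ) n‖ ≤ 1 / 2 := by
  set A : ℝ := ∑' n, ‖term h (σ : ℂ) n‖
  have htendsto : Tendsto (fun k : ℕ => (1 / 2 : ℝ) ^ k * A) atTop (𝓝 0) := by
    simpa only [zero_mul] using
      (tendsto_pow_atTop_nhds_zero_of_lt_one (by norm_num) (by norm_num)).mul_const A
  obtain ⟨k, hk⟩ :=
    (htendsto.eventually (Iic_mem_nhds (by norm_num : (0 : ℝ) < 1 / 2))).exists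
  refine ⟨σ + k, fun N => ?_⟩
  calc ∑ n ∈ Finset.range N, ‖term h ((σ + k : ℝ) : ℂ) n‖
      ≤ ∑ n ∈ Finset.range N, (1 / 2) ^ k * ‖term h (σ : ℂ) n‖ :=
        Finset.sum_le_sum fun n _ => norm_term_add_nat_le h1 σ k n
    _ = (1 / 2) ^ k * ∑ n ∈ Finset.range N, ‖term h (σ : ℂ) n‖ := (Finset.mul_sum ..).symm
    _ ≤ (1 / 2) ^ k * A := mul_le_mul_of_nonneg_left
        (hs.norm.sum_le_tsum _ fun _ _ => norm_nonneg _) (by positivity)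
    _ ≤ 1 / 2 := hk

theorem sum_le_two_of_le_delta_add_convolution {η β : ℕ → ℝ} (hη : ∀ n, 0 ≤ η n)
    (hβ : ∀ n, 0 ≤ β n) (hsum : ∀ N, ∑ n ∈ Finset.range N, η n ≤ 1 / 2)
    (hle : ∀ n, β n ≤ (if n = 1 then 1 else 0) + ∑ p ∈ n.divisorsAntidiagonal, η p.1 * β p.2)
    (N : ℕ) : ∑ n ∈ Finset.range N, β n ≤ 2 := by
  have hdelta : ∑ n ∈ Finset.range N, (if n = 1 then (1 : ℝ) else 0) ≤ 1 := by
    rw [Finset.sum_ite_eq']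
    split_ifs <;> norm_num
  have hconv := (sum_divisorsAntidiagonal_le hη hβ N).trans
    (mul_le_mul_of_nonneg_right (hsum N) (Finset.sum_nonneg fun n _ => hβ n))
  have htotal := Finset.sum_le_sum fun n (_ : n ∈ Finset.range N) => hle n
  rw [Finset.sum_add_distrib] at htotal
  linarith

theorem sum_divisorsAntidiagonal_term_delta_mul (b : ℕ → ℂ) (s : ℂ) (n : ℕ) :
    ∑ p ∈ n.divisorsAntidiagonal, term δ s p.1 * term b s p.2 = term b s n := by
  rcases eq_or_ne n 0 with rfl | hn
  · simp
  rw [Finset.sum_eq_single (1, n)]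
  · simp [delta]
  · rintro ⟨k, m⟩ hkm hne
    have hk : k ≠ 1 := by
      rintro rfl
      exact hne (by simpa using (Nat.mem_divisorsAntidiagonal.1 hkm).1)
    simp [term_delta, hk]
  · simp [hn]

theorem norm_term_le_of_convolution_eq_delta {a b : ℕ → ℂ} (hab : a ⍟ b = δ) (s : ℂ) (n : ℕ) :
    ‖term b s n‖ ≤ (if n = 1 then 1 else 0)
      + ∑ p ∈ n.divisorsAntidiagonal, ‖term (a - δ) s p.1‖ * ‖term b s p.2‖ := by
  have hsplit : term b s n
      = term δ s n - ∑ p ∈ n.divisorsAntidiagonal, term (a - δ) s p.1 * term b s p.2 := by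
    simp only [term_sub, Pi.sub_apply, sub_mul, Finset.sum_sub_distrib]
    rw [sum_divisorsAntidiagonal_term_delta_mul, ← term_convolution, hab, sub_sub_cancel]
  rw [hsplit]
  refine (norm_sub_le _ _).trans (add_le_add ?_ ?_)
  · rw [term_delta]
    split_ifs <;> simp
  · exact (norm_sum_le _ _).trans (Finset.sum_le_sum fun p _ => (norm_mul _ _).le)

/- Far enough to the right `a - δ` has `ℓ¹` norm at most `1/2`, and the Neumann series bounds the
norm of `b = (δ + (a - δ))⁻¹` by `2`. -/
theorem LSeriesSummable_of_convolution_eq_delta {a b : ℕ → ℂ} (h1 : a 1 = 1) {σ : ℝ}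
    (ha : LSeriesSummable a σ) (hab : a ⍟ b = δ) : ∃ τ : ℝ, LSeriesSummable b τ := by
  have hδ : LSeriesSummable δ (σ : ℂ) := LSeriesSummable_delta _
  obtain ⟨τ, hτ⟩ := exists_sum_norm_term_le_half (h := a - δ) (by simp [h1, delta]) (ha.sub hδ)
  exact ⟨τ, (summable_of_sum_range_le (fun _ => norm_nonneg _)
    (sum_le_two_of_le_delta_add_convolution (fun _ => norm_nonneg _) (fun _ => norm_nonneg _) hτ
      (norm_term_le_of_convolution_eq_delta hab τ))).of_norm⟩

theorem exists_convolution_eq_delta {a : ℕ → ℂ} (h1 : a 1 = 1) : ∃ b : ℕ → ℂ, a ⍟ b = δ := by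
  obtain ⟨u, hu⟩ := ArithmeticFunction.isUnit_iff_isUnit_apply_one.2
    (show IsUnit (toArithmeticFunction a 1) by simp [toArithmeticFunction, h1])
  refine ⟨(↑u⁻¹ : ArithmeticFunction ℂ), ?_⟩
  have hinv : toArithmeticFunction (↑u⁻¹ : ArithmeticFunction ℂ) = ↑u⁻¹ := by simp
  have hmul : a ⍟ ⇑(↑u⁻¹ : ArithmeticFunction ℂ)
      = ⇑(toArithmeticFunction a * toArithmeticFunction (↑u⁻¹ : ArithmeticFunction ℂ)) := rfl
  rw [hmul, hinv, ← hu, u.mul_inv]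
  exact ArithmeticFunction.one_eq_delta

theorem HasDirichletSeries.exists_mul_eq_one {F : ℂ → ℂ} (hF : HasDirichletSeries F 1) :
    ∃ G, HasDirichletSeries G 1 ∧ ∃ σ : ℝ, ∀ s : ℂ, σ < s.re → F s * G s = 1 := by
  obtain ⟨a, h1, σ, hσ⟩ := hF
  obtain ⟨b, hab⟩ := exists_convolution_eq_delta h1
  have hb1 : b 1 = 1 := by simpa [convolution_def, delta, h1] using congrFun hab 1
  obtain ⟨τ, hτ⟩ := LSeriesSummable_of_convolution_eq_delta h1
    (hσ (σ + 1 : ℝ) (by simp)).LSeriesSummable hab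
  have hb : ∀ s : ℂ, τ < s.re → LSeriesHasSum b s (LSeries b s) := fun s hs =>
    (hτ.of_re_le_re (by simpa using hs.le)).LSeriesHasSum
  refine ⟨LSeries b, ⟨b, hb1, τ, hb⟩, max σ τ, fun s hs => ?_⟩
  obtain ⟨hσs, hτs⟩ := max_lt_iff.1 hs
  rw [← ((hσ s hσs).convolution (hb s hτs)).LSeries_eq, hab, LSeries_delta, Pi.one_apply]

theorem HasDirichletSeries.inv {F : ℂ → ℂ} (hF : HasDirichletSeries F 1) :
    HasDirichletSeries (fun s => (F s)⁻¹) 1 :=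
  let ⟨_, hG, σ, hFG⟩ := hF.exists_mul_eq_one
  hG.congr σ fun s hs => (eq_inv_of_mul_eq_one_right (hFG s hs)).symm

theorem HasDirichletSeries.exists_forall_ne_zero {F : ℂ → ℂ} (hF : HasDirichletSeries F 1) :
    ∃ σ : ℝ, ∀ s : ℂ, σ < s.re → F s ≠ 0 :=
  let ⟨_, _, σ, hFG⟩ := hF.exists_mul_eq_one
  ⟨σ, fun s hs => left_ne_zero_of_mul_eq_one (hFG s hs)⟩

theorem HasDirichletSeries.logDeriv {F : ℂ → ℂ} (hF : HasDirichletSeries F 1) :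
    HasDirichletSeries (logDeriv F) 0 :=
  ((hF.deriv.mul hF.inv).value (zero_mul _)).congr 0 fun s _ => by
    rw [logDeriv_apply, div_eq_mul_inv]

end Inverse

end DirichletSeries

section EntireQuotient

theorem eventually_ne_zero_nhdsNE {f : ℂ → ℂ} {z : ℂ} (hf : Differentiable ℂ f) (hz : f z ≠ 0)
    (u : ℂ) : ∀ᶠ w in 𝓝[≠] u, f w ≠ 0 :=
  (hf.analyticAt u).eventually_eq_zero_or_eventually_ne_zero.resolve_left fun h =>
    analyticOrderAt_ne_top_of_apply_ne_zero hf hz u (analyticOrderAt_eq_top.2 h)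

theorem meromorphicOrderAt_eq_analyticOrderNatAt {f : ℂ → ℂ} {z : ℂ} (hf : Differentiable ℂ f)
    (hz : f z ≠ 0) (u : ℂ) : meromorphicOrderAt f u = (analyticOrderNatAt f u : ℤ) := by
  rw [(hf.analyticAt u).meromorphicOrderAt_eq,
    ← Nat.cast_analyticOrderNatAt (analyticOrderAt_ne_top_of_apply_ne_zero hf hz u)]
  rfl

theorem meromorphicOrderAt_div_eq_sub {f g : ℂ → ℂ} {y z : ℂ} (hf : Differentiable ℂ f)
    (hfy : f y ≠ 0) (hg : Differentiable ℂ g) (hgz : g z ≠ 0) (u : ℂ) :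
    meromorphicOrderAt (fun w => f w / g w) u
      = ((analyticOrderNatAt f u - analyticOrderNatAt g u : ℤ) : WithTop ℤ) := by
  change meromorphicOrderAt (f / g) u = _
  rw [div_eq_mul_inv, meromorphicOrderAt_mul (hf.analyticAt u).meromorphicAt
    (hg.analyticAt u).meromorphicAt.inv, meromorphicOrderAt_inv,
    meromorphicOrderAt_eq_analyticOrderNatAt hf hfy,
    meromorphicOrderAt_eq_analyticOrderNatAt hg hgz, sub_eq_add_neg]
  rfl

theorem EntireOfGrowth.exists_eq_sub_pow_mul {k : ℕ} {f : ℂ → ℂ} {z : ℂ} (hf : EntireOfGrowth k f)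
    (hz : f z ≠ 0) (a : ℂ) : ∃ g : ℂ → ℂ, EntireOfGrowth k g ∧ g a ≠ 0 ∧
      ∀ w, f w = (w - a) ^ analyticOrderNatAt f a * g w := by
  set n := analyticOrderNatAt f a with hn
  have htop := analyticOrderAt_ne_top_of_apply_ne_zero hf.differentiable hz a
  have hpow : Differentiable ℂ fun w : ℂ => (w - a) ^ n := by fun_prop
  have hpow_ne : ∀ w, w ≠ a → (w - a) ^ n ≠ 0 := fun w hw => pow_ne_zero _ (sub_ne_zero.2 hw)
  have hpow_order : analyticOrderAt (fun w : ℂ => (w - a) ^ n) a = n :=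
    ((hpow.analyticAt a).analyticOrderAt_eq_natCast).2
      ⟨fun _ => 1, analyticAt_const, one_ne_zero, by simp⟩
  have hle : ∀ w, analyticOrderAt (fun w : ℂ => (w - a) ^ n) w ≤ analyticOrderAt f w := by
    intro w
    rcases eq_or_ne w a with rfl | hw
    · rw [hpow_order, hn, Nat.cast_analyticOrderNatAt htop]
    · rw [(hpow.analyticAt w).analyticOrderAt_eq_zero.2 (hpow_ne w hw)]
      exact zero_le
  obtain ⟨g, hg, hfg⟩ := exists_eq_mul_of_analyticOrderAt_le hf.differentiable hpow
    (hpow_ne (a + 1) (by simp)) hle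
  obtain ⟨C, -, hfC⟩ := hf.norm_le
  refine ⟨g, .of_norm_le hg (C := C) (R := ‖a‖ + 1) fun w hw => ?_, ?_, hfg⟩
  · refine le_trans ?_ (hfC w)
    have one_le : 1 ≤ ‖w - a‖ := by linarith [norm_sub_norm_le w a]
    rw [hfg, norm_mul, norm_pow]
    exact le_mul_of_one_le_left (norm_nonneg _) (one_le_pow₀ one_le)
  · have hmul : f = (fun w => (w - a) ^ n) * g := funext hfg
    have horder : (n : ℕ∞) + analyticOrderAt g a = n + 0 := by
      rw [← hpow_order, ← analyticOrderAt_mul (hpow.analyticAt a) (hg.analyticAt a), ← hmul,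
        hpow_order, add_zero, hn, Nat.cast_analyticOrderNatAt htop]
    exact (hg.analyticAt a).analyticOrderAt_eq_zero.1
      (WithTop.add_left_cancel (ENat.natCast_ne_top n) horder)

/-- On the complement of the zeros of an entire function `g`, and in particular on a half-plane
`Re w > σ`, the function `F` is the quotient of an entire function by `g`; both have growth
exponent `k`. The values of `F` at the zeros of `g` are arbitrary, which makes the notion
insensitive to the junk values of `F` at its poles. -/
def IsEntireQuotient (k : ℕ) (F : ℂ → ℂ) : Prop :=
  ∃ f g : ℂ → ℂ, EntireOfGrowth k f ∧ EntireOfGrowth k g ∧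
    (∃ σ : ℝ, ∀ w : ℂ, σ < w.re → g w ≠ 0) ∧ ∀ w, g w ≠ 0 → F w = f w / g w

namespace IsEntireQuotient

variable {k : ℕ} {F G : ℂ → ℂ}

theorem of_entireOfGrowth (hF : EntireOfGrowth k F) : IsEntireQuotient k F :=
  ⟨F, fun _ => 1, hF, .const k 1, ⟨0, fun _ _ => one_ne_zero⟩, fun _ _ => (div_one _).symm⟩

theorem add (hF : IsEntireQuotient k F) (hG : IsEntireQuotient k G) :
    IsEntireQuotient k (F + G) := by
  obtain ⟨f₁, g₁, hf₁, hg₁, ⟨σ, hσ⟩, hF⟩ := hF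
  obtain ⟨f₂, g₂, hf₂, hg₂, ⟨τ, hτ⟩, hG⟩ := hG
  refine ⟨_, _, (hf₁.mul hg₂).add (hg₁.mul hf₂), hg₁.mul hg₂,
    ⟨max σ τ, fun w hw => ?_⟩, fun w hw => ?_⟩
  · exact mul_ne_zero (hσ w (max_lt_iff.1 hw).1) (hτ w (max_lt_iff.1 hw).2)
  · obtain ⟨h₁, h₂⟩ := mul_ne_zero_iff.1 hw
    rw [Pi.add_apply, hF w h₁, hG w h₂, div_add_div _ _ h₁ h₂]

theorem mul (hF : IsEntireQuotient k F) (hG : IsEntireQuotient k G) :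
    IsEntireQuotient k (F * G) := by
  obtain ⟨f₁, g₁, hf₁, hg₁, ⟨σ, hσ⟩, hF⟩ := hF
  obtain ⟨f₂, g₂, hf₂, hg₂, ⟨τ, hτ⟩, hG⟩ := hG
  refine ⟨_, _, hf₁.mul hf₂, hg₁.mul hg₂, ⟨max σ τ, fun w hw => ?_⟩, fun w hw => ?_⟩
  · exact mul_ne_zero (hσ w (max_lt_iff.1 hw).1) (hτ w (max_lt_iff.1 hw).2)
  · obtain ⟨h₁, h₂⟩ := mul_ne_zero_iff.1 hw
    rw [Pi.mul_apply, hF w h₁, hG w h₂, div_mul_div_comm]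

theorem sum {ι : Type*} (S : Finset ι) {F : ι → ℂ → ℂ}
    (hF : ∀ i ∈ S, IsEntireQuotient k (F i)) : IsEntireQuotient k fun w => ∑ i ∈ S, F i w := by
  simpa only [Finset.sum_fn] using
    Finset.sum_induction F _ (fun _ _ => add) (of_entireOfGrowth (.const k 0)) hF

theorem prod {ι : Type*} (S : Finset ι) {F : ι → ℂ → ℂ}
    (hF : ∀ i ∈ S, IsEntireQuotient k (F i)) : IsEntireQuotient k fun w => ∏ i ∈ S, F i w := by
  simpa only [Finset.prod_fn] using
    Finset.prod_induction F _ (fun _ _ => mul) (of_entireOfGrowth (.const k 1)) hF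

/- Cancelling the common power of `w - s` from the numerator and the denominator leaves two
functions that do not vanish at `s`. -/
theorem exists_div (hF : IsEntireQuotient k F) {σ : ℝ} (hσ : ∀ w : ℂ, σ < w.re → F w ≠ 0) {s : ℂ}
    (hs : meromorphicOrderAt F s = 0) :
    ∃ f g : ℂ → ℂ, EntireOfGrowth k f ∧ EntireOfGrowth k g ∧ f s ≠ 0 ∧ g s ≠ 0 ∧
      (∃ τ : ℝ, ∀ w : ℂ, τ < w.re → f w ≠ 0 ∧ g w ≠ 0) ∧
      ∀ u, F =ᶠ[𝓝[≠] u] fun w => f w / g w := by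
  obtain ⟨f, g, hf, hg, ⟨τ, hτ⟩, hFfg⟩ := hF
  have hne : ∀ w : ℂ, max σ τ < w.re → f w ≠ 0 ∧ g w ≠ 0 := fun w hw => by
    have hgw := hτ w (max_lt_iff.1 hw).2
    have hFw := hσ w (max_lt_iff.1 hw).1
    rw [hFfg w hgw] at hFw
    exact ⟨(div_ne_zero_iff.1 hFw).1, hgw⟩
  obtain ⟨hfy, hgy⟩ := hne ((max σ τ + 1 : ℝ) : ℂ) (by rw [ofReal_re]; linarith)
  have hFfg_near : ∀ u, F =ᶠ[𝓝[≠] u] fun w => f w / g w := fun u =>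
    (eventually_ne_zero_nhdsNE hg.differentiable hgy u).mono hFfg
  obtain ⟨f₁, hf₁, hf₁s, hff₁⟩ := hf.exists_eq_sub_pow_mul hfy s
  obtain ⟨g₁, hg₁, hg₁s, hgg₁⟩ := hg.exists_eq_sub_pow_mul hgy s
  have horder : analyticOrderNatAt f s = analyticOrderNatAt g s := by
    rw [meromorphicOrderAt_congr (hFfg_near s),
      meromorphicOrderAt_div_eq_sub hf.differentiable hfy hg.differentiable hgy] at hs
    have := WithTop.coe_eq_zero.1 hs
    omega
  refine ⟨f₁, g₁, hf₁, hg₁, hf₁s, hg₁s, ⟨max σ τ, fun w hw => ?_⟩, fun u => ?_⟩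
  · obtain ⟨hfw, hgw⟩ := hne w hw
    rw [hff₁] at hfw
    rw [hgg₁] at hgw
    exact ⟨right_ne_zero_of_mul hfw, right_ne_zero_of_mul hgw⟩
  · filter_upwards [hFfg_near u, eventually_ne_zero_nhdsNE hg.differentiable hgy u] with w hFw hgw
    rw [hgg₁] at hgw
    rw [hFw, hff₁, hgg₁, horder, mul_div_mul_left _ _ (left_ne_zero_of_mul hgw)]

end IsEntireQuotient

end EntireQuotient

section FiniteFactor

/-- The product of the four Euler factors at `p` in the numerator of `J`. -/
noncomputable def eulerNum (T₁ T₂ : ℝ) (p : ℕ) (s : ℂ) : ℂ :=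
  (1 - 1 / (p : ℂ) ^ s) * (1 - 1 / (p : ℂ) ^ (s - I * T₁))
    * (1 - 1 / (p : ℂ) ^ (s + I * T₂)) * (1 - 1 / (p : ℂ) ^ (s - I * (T₁ - T₂)))

/-- The Euler factor at `p` in the denominator of `J`. -/
noncomputable def eulerDen (T₁ T₂ : ℝ) (p : ℕ) (s : ℂ) : ℂ :=
  1 - 1 / (p : ℂ) ^ (2 * s - I * (T₁ - T₂))

theorem P_eq_prod (T₁ T₂ : ℝ) (d : ℕ) : P T₁ T₂ d = fun s => ∏ p ∈ d.primeFactors,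
    (1 - eulerNum T₁ T₂ p s * (eulerDen T₁ T₂ p s)⁻¹) := rfl

theorem entireOfGrowth_one_sub_one_div_cpow {p : ℕ} (hp : p ≠ 0) (a b : ℂ) :
    EntireOfGrowth 1 fun s => 1 - 1 / (p : ℂ) ^ (a * s + b) := by
  have hneg : ∀ s : ℂ, 1 / (p : ℂ) ^ (a * s + b) = (p : ℂ) ^ (-a * s + -b) := fun s => by
    rw [one_div, ← cpow_neg, neg_add, neg_mul]
  simp only [hneg]
  exact (EntireOfGrowth.const 1 1).sub
    ((entireOfGrowth_const_cpow (by exact_mod_cast hp)).comp_affine (-a) (-b))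

theorem entireOfGrowth_eulerDen (T₁ T₂ : ℝ) {p : ℕ} (hp : p ≠ 0) :
    EntireOfGrowth 1 (eulerDen T₁ T₂ p) :=
  entireOfGrowth_one_sub_one_div_cpow hp 2 (-(I * (T₁ - T₂)))

theorem entireOfGrowth_eulerNum (T₁ T₂ : ℝ) {p : ℕ} (hp : p ≠ 0) :
    EntireOfGrowth 1 (eulerNum T₁ T₂ p) := by
  have factor (b : ℂ) : EntireOfGrowth 1 fun s => 1 - 1 / (p : ℂ) ^ (s + b) := by
    simpa only [one_mul] using entireOfGrowth_one_sub_one_div_cpow hp 1 b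
  have factor_zero : EntireOfGrowth 1 fun s => 1 - 1 / (p : ℂ) ^ s := by
    simpa only [add_zero] using factor 0
  exact ((factor_zero.mul (factor (-(I * T₁)))).mul (factor (I * T₂))).mul
    (factor (-(I * (T₁ - T₂))))

theorem hasDirichletSeries_one_sub_one_div_cpow {p : ℕ} (hp : 1 < p) (b : ℂ) :
    HasDirichletSeries (fun s => 1 - 1 / (p : ℂ) ^ (s + b)) 1 :=
  (HasDirichletSeries.one.sub ((HasDirichletSeries.one_div_natCast_cpow hp).comp_add b)).value
    (sub_zero _)

theorem hasDirichletSeries_eulerDen (T₁ T₂ : ℝ) {p : ℕ} (hp : 1 < p) :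
    HasDirichletSeries (eulerDen T₁ T₂ p) 1 :=
  (hasDirichletSeries_one_sub_one_div_cpow hp (-(I * (T₁ - T₂)))).comp_two_mul

theorem hasDirichletSeries_eulerNum (T₁ T₂ : ℝ) {p : ℕ} (hp : 1 < p) :
    HasDirichletSeries (eulerNum T₁ T₂ p) 1 := by
  have factor (b : ℂ) := hasDirichletSeries_one_sub_one_div_cpow hp b
  have factor_zero : HasDirichletSeries (fun s => 1 - 1 / (p : ℂ) ^ s) 1 := by
    simpa only [add_zero] using factor 0
  exact (((factor_zero.mul (factor (-(I * T₁)))).mul (factor (I * T₂))).mul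
    (factor (-(I * (T₁ - T₂))))).value (by simp)

theorem hasDirichletSeries_P (T₁ T₂ : ℝ) (d : ℕ) :
    HasDirichletSeries (P T₁ T₂ d) (∏ _p ∈ d.primeFactors, 0) := by
  refine HasDirichletSeries.prod _ fun p hp => ?_
  have hp1 : 1 < p := (Nat.prime_of_mem_primeFactors hp).one_lt
  exact (HasDirichletSeries.one.sub ((hasDirichletSeries_eulerNum T₁ T₂ hp1).mul
    (hasDirichletSeries_eulerDen T₁ T₂ hp1).inv)).value (by simp)

theorem hasDirichletSeries_K (T₁ T₂ : ℝ) {z : ℝ} (hz : 1 < z) :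
    HasDirichletSeries (K T₁ T₂ z) 1 := by
  refine (HasDirichletSeries.sum (Finset.Icc 1 ⌊z ^ 2⌋₊) fun d _ =>
    (hasDirichletSeries_P T₁ T₂ d).const_mul (lam z d)).value ?_
  have one_le_floor : 1 ≤ ⌊z ^ 2⌋₊ := Nat.le_floor (by push_cast; nlinarith)
  rw [Finset.sum_eq_single 1]
  · simp [lam, hz]
  · intro d hd hd1
    have hd2 : 1 < d := lt_of_le_of_ne (Finset.mem_Icc.1 hd).1 hd1.symm
    rw [Finset.prod_const, zero_pow (Finset.card_pos.2 (Nat.nonempty_primeFactors.2 hd2)).ne',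
      mul_zero]
  · simp [one_le_floor]

theorem isEntireQuotient_P (T₁ T₂ : ℝ) (d : ℕ) : IsEntireQuotient 1 (P T₁ T₂ d) := by
  refine IsEntireQuotient.prod _ fun p hp => ?_
  have hp' := Nat.prime_of_mem_primeFactors hp
  have hden := entireOfGrowth_eulerDen T₁ T₂ hp'.ne_zero
  refine ⟨_, _, hden.sub (entireOfGrowth_eulerNum T₁ T₂ hp'.ne_zero), hden,
    (hasDirichletSeries_eulerDen T₁ T₂ hp'.one_lt).exists_forall_ne_zero, fun w hw => ?_⟩
  rw [sub_div, div_self hw]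
  rfl

theorem isEntireQuotient_K (T₁ T₂ z : ℝ) : IsEntireQuotient 1 (K T₁ T₂ z) :=
  IsEntireQuotient.sum _ fun d _ =>
    (IsEntireQuotient.of_entireOfGrowth (.const 1 (lam z d : ℂ))).mul (isEntireQuotient_P T₁ T₂ d)

theorem meromorphicOrderAt_K_eq_zero {T₁ T₂ z : ℝ} {s : ℂ} (hpole : s ∉ polesK T₁ T₂ z)
    (hzero : s ∉ zerosK T₁ T₂ z) : meromorphicOrderAt (K T₁ T₂ z) s = 0 :=
  le_antisymm (not_lt.1 hzero) (not_lt.1 hpole)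

theorem exists_entireOfGrowth_K_eventuallyEq_div {T₁ T₂ z : ℝ} (hz : 1 < z) {s : ℂ}
    (hpole : s ∉ polesK T₁ T₂ z) (hzero : s ∉ zerosK T₁ T₂ z) :
    ∃ f g : ℂ → ℂ, EntireOfGrowth 2 f ∧ EntireOfGrowth 2 g ∧ f s ≠ 0 ∧ g s ≠ 0 ∧
      (∃ τ : ℝ, 1 ≤ τ ∧ ∀ w : ℂ, τ < w.re → f w ≠ 0 ∧ g w ≠ 0) ∧
      ∀ u, K T₁ T₂ z =ᶠ[𝓝[≠] u] fun w => f w / g w := by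
  obtain ⟨σ, hσ⟩ := (hasDirichletSeries_K T₁ T₂ hz).exists_forall_ne_zero
  obtain ⟨f, g, hf, hg, hfs, hgs, ⟨τ, hτ⟩, hK⟩ := (isEntireQuotient_K T₁ T₂ z).exists_div hσ
    (meromorphicOrderAt_K_eq_zero hpole hzero)
  exact ⟨f, g, hf.mono one_le_two, hg.mono one_le_two, hfs, hgs, ⟨max τ 1, le_max_right τ 1,
    fun w hw => hτ w ((le_max_left τ 1).trans_lt hw)⟩, hK⟩

theorem analyticAt_P {T₁ T₂ : ℝ} {d : ℕ} {u : ℂ}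
    (h : ∀ p ∈ d.primeFactors, eulerDen T₁ T₂ p u ≠ 0) : AnalyticAt ℂ (P T₁ T₂ d) u := by
  rw [P_eq_prod]
  refine Finset.analyticAt_fun_prod _ fun p hp => ?_
  have hp0 := (Nat.prime_of_mem_primeFactors hp).ne_zero
  exact analyticAt_const.sub
    (((entireOfGrowth_eulerNum T₁ T₂ hp0).differentiable.analyticAt u).mul
      (((entireOfGrowth_eulerDen T₁ T₂ hp0).differentiable.analyticAt u).inv (h p hp)))

theorem lam_eq_zero {z : ℝ} {d : ℕ} (hd : 1 ≤ d) (hzd : z ^ 2 ≤ d) : lam z d = 0 := by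
  have one_le : (1 : ℝ) ≤ d := by exact_mod_cast hd
  have hzd' : z ≤ d := by nlinarith
  rw [lam, if_neg (not_lt.2 hzd'), if_neg (not_lt.2 hzd)]

theorem analyticAt_K {T₁ T₂ z : ℝ} {u : ℂ}
    (h : ∀ p : ℕ, p.Prime → (p : ℝ) < z ^ 2 → eulerDen T₁ T₂ p u ≠ 0) :
    AnalyticAt ℂ (K T₁ T₂ z) u := by
  refine Finset.analyticAt_fun_sum _ fun d hd => ?_
  rcases lt_or_ge (d : ℝ) (z ^ 2) with hdz | hzd
  · refine analyticAt_const.mul (analyticAt_P fun p hp => ?_)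
    have hpd : (p : ℝ) ≤ d := by
      exact_mod_cast Nat.le_of_dvd (Finset.mem_Icc.1 hd).1 (Nat.dvd_of_mem_primeFactors hp)
    exact h p (Nat.prime_of_mem_primeFactors hp) (hpd.trans_lt hdz)
  · simpa only [lam_eq_zero (Finset.mem_Icc.1 hd).1 hzd, ofReal_zero, zero_mul] using
      analyticAt_const

theorem eq_of_eulerDen_eq_zero {T₁ T₂ : ℝ} {p : ℕ} (hp : 1 < p) {u : ℂ}
    (h : eulerDen T₁ T₂ p u = 0) :
    ∃ k : ℤ, u = I * (Real.pi * k / Real.log p + 1 / 2 * (T₁ - T₂)) := by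
  have hp0 : (p : ℂ) ≠ 0 := by exact_mod_cast (by omega : p ≠ 0)
  have hpow : (p : ℂ) ^ (2 * u - I * (T₁ - T₂)) = 1 := by
    rw [← inv_eq_one, ← one_div]
    exact (sub_eq_zero.1 h).symm
  rw [cpow_def_of_ne_zero hp0, exp_eq_one_iff] at hpow
  obtain ⟨k, hk⟩ := hpow
  refine ⟨k, ?_⟩
  have hlog : (Real.log p : ℂ) ≠ 0 := by
    exact_mod_cast (Real.log_pos (by exact_mod_cast hp)).ne'
  rw [← ofReal_natCast, ← ofReal_log (Nat.cast_nonneg p)] at hk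
  field_simp
  linear_combination hk

theorem exists_prime_of_mem_polesK {T₁ T₂ z : ℝ} {ν : ℂ} (hν : ν ∈ polesK T₁ T₂ z) :
    ∃ (p : ℕ) (k : ℤ), p.Prime ∧ (p : ℝ) < z ^ 2 ∧
      ν = I * (Real.pi * k / Real.log p + 1 / 2 * (T₁ - T₂)) := by
  obtain ⟨p, hp, hpz, hzero⟩ : ∃ p : ℕ, p.Prime ∧ (p : ℝ) < z ^ 2 ∧ eulerDen T₁ T₂ p ν = 0 := by
    by_contra! h
    exact (analyticAt_K h).meromorphicOrderAt_nonneg.not_gt hν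
  obtain ⟨k, hk⟩ := eq_of_eulerDen_eq_zero hp.one_lt hzero
  exact ⟨p, k, hp, hpz, hk⟩

end FiniteFactor

section MotohashiProduct

theorem shift_re (T₁ T₂ : ℝ) (j : Fin 4) : (shift T₁ T₂ j).re = 0 := by
  fin_cases j <;> simp [shift]

theorem half_re (T₁ T₂ : ℝ) (w : ℂ) : (half T₁ T₂ w).re = w.re / 2 := by
  simp [half]

theorem two_mul_sub_re (T₁ T₂ : ℝ) (w : ℂ) : (2 * w - I * (T₁ - T₂)).re = 2 * w.re := by
  simp

theorem ne_one_add_shift_of_one_lt_re {T₁ T₂ : ℝ} {w : ℂ} (hw : 1 < w.re) (j : Fin 4) :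
    w ≠ 1 + shift T₁ T₂ j := by
  rintro rfl
  simp [shift_re] at hw

theorem ne_half_one_of_one_lt_re {T₁ T₂ : ℝ} {w : ℂ} (hw : 1 < w.re) : w ≠ half T₁ T₂ 1 := by
  rintro rfl
  norm_num [half_re] at hw

theorem J_eq_prod_div (T₁ T₂ : ℝ) (s : ℂ) :
    J T₁ T₂ s
      = (∏ j, riemannZeta (s - shift T₁ T₂ j)) / riemannZeta (2 * s - I * (T₁ - T₂)) := by
  simp [J, Fin.prod_univ_four, shift]

theorem hasDirichletSeries_J (T₁ T₂ : ℝ) : HasDirichletSeries (J T₁ T₂) 1 := by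
  have hnum := HasDirichletSeries.prod Finset.univ fun j _ =>
    HasDirichletSeries.zeta.comp_add (-(shift T₁ T₂ j))
  have hden := (HasDirichletSeries.zeta.comp_add (-(I * (T₁ - T₂)))).comp_two_mul
  refine ((hnum.mul hden.inv).value (by simp)).congr 0 fun s _ => ?_
  simp only [J_eq_prod_div, sub_eq_add_neg, div_eq_mul_inv]

/-- The numerator of a quotient of entire functions that represents `Z` wherever `K = f / g`:
the zeta factors of `J` are cleared of their poles, which move to `denZ`, and the pole of the
denominator of `J` becomes the factor `w - half T₁ T₂ 1`. -/
noncomputable def numZ (T₁ T₂ : ℝ) (f : ℂ → ℂ) (w : ℂ) : ℂ :=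
  (∏ j, riemannZeta₁ (w - shift T₁ T₂ j)) * (w - half T₁ T₂ 1) * f w

/-- The denominator that goes with `numZ`. -/
noncomputable def denZ (T₁ T₂ : ℝ) (g : ℂ → ℂ) (w : ℂ) : ℂ :=
  (∏ j, (w - (1 + shift T₁ T₂ j))) * (riemannZeta₁ (2 * w - I * (T₁ - T₂)) / 2) * g w

theorem riemannZeta_sub_shift {T₁ T₂ : ℝ} {w : ℂ} {j : Fin 4} (hw : w ≠ 1 + shift T₁ T₂ j) :
    riemannZeta (w - shift T₁ T₂ j)
      = riemannZeta₁ (w - shift T₁ T₂ j) / (w - (1 + shift T₁ T₂ j)) := by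
  have hne : w - shift T₁ T₂ j ≠ 1 := fun h => hw (sub_eq_iff_eq_add.1 h)
  rw [riemannZeta₁_eq_sub_one_mul hne, eq_div_iff (sub_ne_zero.2 hw)]
  ring

theorem riemannZeta_two_mul_sub {T₁ T₂ : ℝ} {w : ℂ} (hw : w ≠ half T₁ T₂ 1) :
    riemannZeta (2 * w - I * (T₁ - T₂))
      = riemannZeta₁ (2 * w - I * (T₁ - T₂)) / 2 / (w - half T₁ T₂ 1) := by
  have hne : 2 * w - I * (T₁ - T₂) ≠ 1 := fun h => hw (by rw [half, ← h]; ring)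
  rw [riemannZeta₁_eq_sub_one_mul hne, eq_div_iff (sub_ne_zero.2 hw), half]
  ring

theorem J_mul_div_eq {T₁ T₂ : ℝ} (f g : ℂ → ℂ) {w : ℂ} (hpole : ∀ j, w ≠ 1 + shift T₁ T₂ j)
    (hhalf : w ≠ half T₁ T₂ 1) :
    J T₁ T₂ w * (f w / g w) = numZ T₁ T₂ f w / denZ T₁ T₂ g w := by
  rw [J_eq_prod_div, numZ, denZ, riemannZeta_two_mul_sub hhalf,
    Finset.prod_congr rfl fun j _ => riemannZeta_sub_shift (hpole j), Finset.prod_div_distrib]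
  simp only [div_eq_mul_inv, mul_inv, inv_inv]
  ring

theorem differentiable_numZ {T₁ T₂ : ℝ} {f : ℂ → ℂ} (hf : Differentiable ℂ f) :
    Differentiable ℂ (numZ T₁ T₂ f) := by
  have := differentiable_riemannZeta₁
  unfold numZ
  fun_prop

theorem differentiable_denZ {T₁ T₂ : ℝ} {g : ℂ → ℂ} (hg : Differentiable ℂ g) :
    Differentiable ℂ (denZ T₁ T₂ g) := by
  have := differentiable_riemannZeta₁
  unfold denZ
  fun_prop

/- Both sides are meromorphic in normal form at `w`, so agreement near `w` extends to `w`. -/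
theorem Z_eventuallyEq {T₁ T₂ z : ℝ} {f g : ℂ → ℂ} {w : ℂ} (hf : Differentiable ℂ f)
    (hg : Differentiable ℂ g) (hK : K T₁ T₂ z =ᶠ[𝓝[≠] w] fun t => f t / g t)
    (hw : denZ T₁ T₂ g w ≠ 0) :
    Z T₁ T₂ z =ᶠ[𝓝 w] fun t => numZ T₁ T₂ f t / denZ T₁ T₂ g t := by
  have hquot : AnalyticAt ℂ (fun t => numZ T₁ T₂ f t / denZ T₁ T₂ g t) w :=
    ((differentiable_numZ hf).analyticAt w).div ((differentiable_denZ hg).analyticAt w) hw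
  refine (MeromorphicNFAt.eventuallyEq_nhdsNE_iff_eventuallyEq_nhds
    (meromorphicNFOn_toMeromorphicNFOn _ _ (Set.mem_univ w)) hquot.meromorphicNFAt).1 ?_
  refine ((meromorphicOn_J_mul_K T₁ T₂ z).toMeromorphicNFOn_eq_self_on_nhdsNE
    (Set.mem_univ w)).trans ?_
  have hne (a : ℂ) : ∀ᶠ t in 𝓝[≠] w, t ≠ a :=
    (Set.finite_singleton a).eventually_cofinite_notMem.filter_mono (nhdsNE_le_cofinite w)
  filter_upwards [hK, eventually_all.2 fun j => hne (1 + shift T₁ T₂ j), hne (half T₁ T₂ 1)]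
    with t hKt hpole hhalf
  rw [hKt, J_mul_div_eq f g hpole hhalf]

theorem denZ_ne_zero {T₁ T₂ : ℝ} {g : ℂ → ℂ} {w : ℂ} (hpole : ∀ j, w ≠ 1 + shift T₁ T₂ j)
    (hζ : riemannZeta₁ (2 * w - I * (T₁ - T₂)) ≠ 0) (hg : g w ≠ 0) : denZ T₁ T₂ g w ≠ 0 :=
  mul_ne_zero (mul_ne_zero (Finset.prod_ne_zero_iff.2 fun j _ => sub_ne_zero.2 (hpole j))
    (div_ne_zero hζ two_ne_zero)) hg

theorem riemannZeta₁_sub_shift_ne_zero_of_one_le_re {T₁ T₂ : ℝ} {w : ℂ} (hw : 1 ≤ w.re)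
    (j : Fin 4) : riemannZeta₁ (w - shift T₁ T₂ j) ≠ 0 :=
  riemannZeta₁_ne_zero_of_one_le_re (by rwa [sub_re, shift_re, sub_zero])

theorem riemannZeta₁_two_mul_sub_ne_zero_of_one_le_re {T₁ T₂ : ℝ} {w : ℂ} (hw : 1 ≤ w.re) :
    riemannZeta₁ (2 * w - I * (T₁ - T₂)) ≠ 0 :=
  riemannZeta₁_ne_zero_of_one_le_re (by rw [two_mul_sub_re]; linarith)

theorem hasDirichletSeries_Z (T₁ T₂ : ℝ) {z : ℝ} (hz : 1 < z) :
    HasDirichletSeries (Z T₁ T₂ z) 1 := by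
  obtain ⟨f, g, hf, hg, ⟨σ, hσ⟩, hK⟩ := isEntireQuotient_K T₁ T₂ z
  refine (((hasDirichletSeries_J T₁ T₂).mul (hasDirichletSeries_K T₁ T₂ hz)).value
    (one_mul 1)).congr (max σ 1) fun w hw => ?_
  have hgw : g w ≠ 0 := hσ w (max_lt_iff.1 hw).1
  have hw1 : 1 < w.re := (max_lt_iff.1 hw).2
  have hKw : K T₁ T₂ z =ᶠ[𝓝[≠] w] fun t => f t / g t :=
    (eventually_ne_zero_nhdsNE hg.differentiable hgw w).mono hK
  rw [(Z_eventuallyEq hf.differentiable hg.differentiable hKw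
    (denZ_ne_zero (ne_one_add_shift_of_one_lt_re hw1)
      (riemannZeta₁_two_mul_sub_ne_zero_of_one_le_re hw1.le) hgw)).eq_of_nhds,
    ← J_mul_div_eq _ _ (ne_one_add_shift_of_one_lt_re hw1) (ne_half_one_of_one_lt_re hw1),
    hK w hgw]

theorem exists_isLogDerivCoeff (T₁ T₂ : ℝ) {z : ℝ} (hz : 1 < z) :
    ∃ c : ℕ → ℂ, c 1 = 0 ∧ IsLogDerivCoeff T₁ T₂ z c :=
  (hasDirichletSeries_Z T₁ T₂ hz).logDeriv

theorem logDeriv_sub_const (a w : ℂ) : logDeriv (fun t : ℂ => t - a) w = 1 / (w - a) := by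
  simp [logDeriv_apply]

theorem logDeriv_numZ {T₁ T₂ : ℝ} {f : ℂ → ℂ} {w : ℂ} (hf : Differentiable ℂ f)
    (hhalf : w ≠ half T₁ T₂ 1) (hζ : ∀ j, riemannZeta₁ (w - shift T₁ T₂ j) ≠ 0) (hfw : f w ≠ 0) :
    logDeriv (numZ T₁ T₂ f) w =
      (∑ j, logDeriv (fun t => riemannZeta₁ (t - shift T₁ T₂ j)) w) + 1 / (w - half T₁ T₂ 1)
        + logDeriv f w := by
  have := differentiable_riemannZeta₁
  have hprod : ∏ j, riemannZeta₁ (w - shift T₁ T₂ j) ≠ 0 :=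
    Finset.prod_ne_zero_iff.2 fun j _ => hζ j
  have hlin : w - half T₁ T₂ 1 ≠ 0 := sub_ne_zero.2 hhalf
  unfold numZ
  rw [logDeriv_mul, logDeriv_mul, logDeriv_prod, logDeriv_sub_const]
  exacts [fun j _ => hζ j, fun j _ => by fun_prop, hprod, hlin, by fun_prop, by fun_prop,
    mul_ne_zero hprod hlin, hfw, by fun_prop, hf w]

theorem logDeriv_denZ {T₁ T₂ : ℝ} {g : ℂ → ℂ} {w : ℂ} (hg : Differentiable ℂ g)
    (hpole : ∀ j, w ≠ 1 + shift T₁ T₂ j) (hζ : riemannZeta₁ (2 * w - I * (T₁ - T₂)) ≠ 0)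
    (hgw : g w ≠ 0) :
    logDeriv (denZ T₁ T₂ g) w =
      (∑ j, 1 / (w - (1 + shift T₁ T₂ j)))
        + logDeriv (fun t => riemannZeta₁ (2 * t - I * (T₁ - T₂))) w + logDeriv g w := by
  have := differentiable_riemannZeta₁
  have hfac (j : Fin 4) : w - (1 + shift T₁ T₂ j) ≠ 0 := sub_ne_zero.2 (hpole j)
  have hprod : ∏ j, (w - (1 + shift T₁ T₂ j)) ≠ 0 := Finset.prod_ne_zero_iff.2 fun j _ => hfac j
  have hζ_half : riemannZeta₁ (2 * w - I * (T₁ - T₂)) * 2⁻¹ ≠ 0 :=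
    mul_ne_zero hζ (inv_ne_zero two_ne_zero)
  unfold denZ
  simp only [div_eq_mul_inv _ (2 : ℂ)]
  rw [logDeriv_mul, logDeriv_mul, logDeriv_prod, logDeriv_mul_const w _ (inv_ne_zero two_ne_zero)]
  · simp only [logDeriv_sub_const]
  exacts [fun j _ => hfac j, fun j _ => by fun_prop, hprod, hζ_half, by fun_prop, by fun_prop,
    mul_ne_zero hprod hζ_half, hgw, by fun_prop, hg w]

theorem logDeriv_Z {T₁ T₂ z : ℝ} {f g : ℂ → ℂ} {w : ℂ} (hf : Differentiable ℂ f)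
    (hg : Differentiable ℂ g) (hK : K T₁ T₂ z =ᶠ[𝓝[≠] w] fun t => f t / g t)
    (hnum : numZ T₁ T₂ f w ≠ 0) (hden : denZ T₁ T₂ g w ≠ 0) :
    logDeriv (Z T₁ T₂ z) w = logDeriv (numZ T₁ T₂ f) w - logDeriv (denZ T₁ T₂ g) w := by
  rw [(logDeriv_congr_nhds (Z_eventuallyEq hf hg hK hden)).eq_of_nhds,
    logDeriv_div w hnum hden (differentiable_numZ hf w) (differentiable_denZ hg w)]

theorem numZ_ne_zero {T₁ T₂ : ℝ} {f : ℂ → ℂ} {w : ℂ} (hhalf : w ≠ half T₁ T₂ 1)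
    (hζ : ∀ j, riemannZeta₁ (w - shift T₁ T₂ j) ≠ 0) (hf : f w ≠ 0) : numZ T₁ T₂ f w ≠ 0 :=
  mul_ne_zero (mul_ne_zero (Finset.prod_ne_zero_iff.2 fun j _ => hζ j) (sub_ne_zero.2 hhalf)) hf

end MotohashiProduct

section ZerosOfZeta

theorem ne_one_of_mem_zetaZeros {ρ : ℂ} (hρ : ρ ∈ zetaZeros) : ρ ≠ 1 := by
  rintro rfl
  exact absurd hρ.2.2 (by simp)

theorem mem_zetaZeros_or_exists_eq_trivialZero {r : ℂ} (hr : riemannZeta₁ r = 0) :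
    r ∈ zetaZeros ∨ ∃ q, r = trivialZero q := by
  have hre : r.re < 1 := by
    by_contra! h
    exact riemannZeta₁_ne_zero_of_one_le_re h hr
  have hr1 : r ≠ 1 := by
    rintro rfl
    simp at hre
  have hζ : riemannZeta r = 0 := by
    rw [riemannZeta₁_eq_sub_one_mul hr1] at hr
    exact (mul_eq_zero.1 hr).resolve_left (sub_ne_zero.2 hr1)
  rcases le_or_gt r.re 0 with h | h
  · exact Or.inr (exists_eq_trivialZero hζ h)
  · exact Or.inl ⟨hζ, h, hre⟩

theorem trivialZero_injective : Function.Injective trivialZero := fun p q h =>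
  PNat.coe_injective (Nat.cast_injective (mul_left_cancel₀ (by norm_num) h))

theorem disjoint_zetaZeros_range_trivialZero : Disjoint zetaZeros (Set.range trivialZero) := by
  rw [Set.disjoint_right]
  rintro _ ⟨q, rfl⟩ hq
  exact hq.2.1.not_gt (trivialZero_re_neg q)

variable {φ : ℂ → ℂ}

theorem zeroMult_riemannZeta_mul (φ : ℂ → ℂ) :
    (fun ρ : zetaZeros => (zeroMult riemannZeta ρ : ℂ) * φ ρ)
      = (fun r => (analyticOrderNatAt riemannZeta₁ r : ℂ) * φ r) ∘ (↑) :=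
  funext fun ρ => by simp [zeroMult_riemannZeta (ne_one_of_mem_zetaZeros ρ.2)]

theorem apply_trivialZero (φ : ℂ → ℂ) :
    (fun q => φ (trivialZero q))
      = (fun r => (analyticOrderNatAt riemannZeta₁ r : ℂ) * φ r) ∘ trivialZero :=
  funext fun q => by simp [analyticOrderNatAt_riemannZeta₁_trivialZero q]

theorem summable_zetaZeros_mul (e : ℂ ≃ ℂ)
    (h : Summable fun u => (analyticOrderNatAt riemannZeta₁ (e.symm u) : ℂ) * φ u) :
    Summable fun ρ : zetaZeros => (zeroMult riemannZeta ρ : ℂ) * φ (e ρ) := by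
  rw [zeroMult_riemannZeta_mul fun u => φ (e u)]
  refine Summable.subtype ?_ zetaZeros
  simpa [Function.comp_def] using e.summable_iff.2 h

theorem summable_trivialZero (e : ℂ ≃ ℂ)
    (h : Summable fun u => (analyticOrderNatAt riemannZeta₁ (e.symm u) : ℂ) * φ u) :
    Summable fun q => φ (e (trivialZero q)) := by
  rw [apply_trivialZero fun u => φ (e u)]
  refine Summable.comp_injective ?_ trivialZero_injective
  simpa [Function.comp_def] using e.summable_iff.2 h

theorem hasSum_order_riemannZeta₁_mul (e : ℂ ≃ ℂ)
    (h : Summable fun u => (analyticOrderNatAt riemannZeta₁ (e.symm u) : ℂ) * φ u) :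
    HasSum (fun u => (analyticOrderNatAt riemannZeta₁ (e.symm u) : ℂ) * φ u)
      ((∑' ρ : zetaZeros, (zeroMult riemannZeta ρ : ℂ) * φ (e ρ))
        + ∑' q, φ (e (trivialZero q))) := by
  set Φ : ℂ → ℂ := fun r => (analyticOrderNatAt riemannZeta₁ r : ℂ) * φ (e r) with hΦ
  have hzeros := (summable_zetaZeros_mul e h).hasSum
  have htrivial := (summable_trivialZero e h).hasSum
  rw [show (fun ρ : zetaZeros => (zeroMult riemannZeta ρ : ℂ) * φ (e ρ)) = Φ ∘ (↑) from
    zeroMult_riemannZeta_mul fun u => φ (e u)] at hzeros ⊢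
  rw [show (fun q => φ (e (trivialZero q))) = Φ ∘ trivialZero from
    apply_trivialZero fun u => φ (e u)] at htrivial ⊢
  have hsupport : Function.support Φ ⊆ zetaZeros ∪ Set.range trivialZero := fun r hr => by
    by_contra hmem
    have hζ : riemannZeta₁ r ≠ 0 := fun h0 => hmem <|
      (mem_zetaZeros_or_exists_eq_trivialZero h0).imp_right fun ⟨q, hq⟩ => ⟨q, hq.symm⟩
    exact hr (by simp [hΦ, analyticOrderNatAt_eq_zero_of_apply_ne_zero hζ])
  have hΦ_comp : (fun u => (analyticOrderNatAt riemannZeta₁ (e.symm u) : ℂ) * φ u) ∘ e = Φ :=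
    funext fun r => by simp [hΦ]
  rw [← e.hasSum_iff, hΦ_comp]
  exact (hasSum_subtype_iff_of_support_subset hsupport).1
    (hzeros.add_disjoint disjoint_zetaZeros_range_trivialZero
      ((Equiv.ofInjective _ trivialZero_injective).hasSum_iff.1 htrivial))

end ZerosOfZeta

section ZerosAndPoles

variable {F φ : ℂ → ℂ} {m n : ℂ → ℕ}

theorem zeroMult_le {u : ℂ} (h : meromorphicOrderAt F u = ((m u - n u : ℤ) : WithTop ℤ)) :
    zeroMult F u ≤ m u := by
  rw [zeroMult, h, WithTop.untop₀_coe]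
  omega

theorem poleMult_le {u : ℂ} (h : meromorphicOrderAt F u = ((m u - n u : ℤ) : WithTop ℤ)) :
    poleMult F u ≤ n u := by
  rw [poleMult, h, WithTop.untop₀_coe]
  omega

theorem zeroMult_sub_poleMult {u : ℂ}
    (h : meromorphicOrderAt F u = ((m u - n u : ℤ) : WithTop ℤ)) :
    (zeroMult F u : ℂ) - poleMult F u = m u - n u := by
  have : (zeroMult F u : ℤ) - poleMult F u = m u - n u := by
    rw [zeroMult, poleMult, h, WithTop.untop₀_coe]
    omega
  exact_mod_cast congrArg (Int.cast : ℤ → ℂ) this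

theorem summable_natCast_mul_of_le (hnm : ∀ u, n u ≤ m u)
    (hm : Summable fun u => (m u : ℂ) * φ u) :
    Summable fun u => (n u : ℂ) * φ u := by
  refine hm.norm.of_norm_bounded fun u => ?_
  rw [norm_mul, norm_mul, norm_natCast, norm_natCast]
  exact mul_le_mul_of_nonneg_right (by exact_mod_cast hnm u) (norm_nonneg _)

theorem summable_zeroMult_mul (S : Set ℂ)
    (hF : ∀ u, meromorphicOrderAt F u = ((m u - n u : ℤ) : WithTop ℤ))
    (hm : Summable fun u => (m u : ℂ) * φ u) :
    Summable fun r : S => (zeroMult F r : ℂ) * φ r :=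
  (summable_natCast_mul_of_le (fun u => zeroMult_le (hF u)) hm).subtype S

theorem summable_poleMult_mul (S : Set ℂ)
    (hF : ∀ u, meromorphicOrderAt F u = ((m u - n u : ℤ) : WithTop ℤ))
    (hn : Summable fun u => (n u : ℂ) * φ u) :
    Summable fun ν : S => (poleMult F ν : ℂ) * φ ν :=
  (summable_natCast_mul_of_le (fun u => poleMult_le (hF u)) hn).subtype S

theorem tsum_zeroMult_mul (F φ : ℂ → ℂ) :
    ∑' r : {r | 0 < meromorphicOrderAt F r}, (zeroMult F r : ℂ) * φ r
      = ∑' u, (zeroMult F u : ℂ) * φ u := by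
  refine tsum_subtype_eq_of_support_subset (f := fun u => (zeroMult F u : ℂ) * φ u) fun u hu => ?_
  have hmult : zeroMult F u ≠ 0 := fun h => hu (by simp [h])
  rw [zeroMult] at hmult
  rw [Set.mem_ofPred_eq]
  cases horder : meromorphicOrderAt F u with
  | top => simp
  | coe k =>
    rw [horder, WithTop.untop₀_coe] at hmult
    exact_mod_cast (by omega : 0 < k)

theorem tsum_poleMult_mul (F φ : ℂ → ℂ) :
    ∑' r : {r | meromorphicOrderAt F r < 0}, (poleMult F r : ℂ) * φ r
      = ∑' u, (poleMult F u : ℂ) * φ u := by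
  refine tsum_subtype_eq_of_support_subset (f := fun u => (poleMult F u : ℂ) * φ u) fun u hu => ?_
  have hmult : poleMult F u ≠ 0 := fun h => hu (by simp [h])
  rw [poleMult] at hmult
  rw [Set.mem_ofPred_eq]
  cases horder : meromorphicOrderAt F u with
  | top => simp [horder] at hmult
  | coe k =>
    rw [horder, WithTop.untop₀_coe] at hmult
    exact_mod_cast (by omega : k < 0)

theorem hasSum_sub_mul_of_meromorphicOrderAt
    (hF : ∀ u, meromorphicOrderAt F u = ((m u - n u : ℤ) : WithTop ℤ))
    (hm : Summable fun u => (m u : ℂ) * φ u) (hn : Summable fun u => (n u : ℂ) * φ u) :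
    HasSum (fun u => (m u : ℂ) * φ u - (n u : ℂ) * φ u)
      ((∑' r : {r | 0 < meromorphicOrderAt F r}, (zeroMult F r : ℂ) * φ r)
        - ∑' ν : {ν | meromorphicOrderAt F ν < 0}, (poleMult F ν : ℂ) * φ ν) := by
  have hzeros := summable_natCast_mul_of_le (fun u => zeroMult_le (hF u)) hm
  have hpoles := summable_natCast_mul_of_le (fun u => poleMult_le (hF u)) hn
  rw [tsum_zeroMult_mul, tsum_poleMult_mul]
  refine hasSum_of_eq (hzeros.hasSum.sub hpoles.hasSum) (fun u => ?_) rfl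
  rw [← sub_mul, ← sub_mul, zeroMult_sub_poleMult (hF u)]

end ZerosAndPoles

section LogDerivExpansion

theorem hasMittagLefflerExpansion_riemannZeta₁_comp_affine {a b s : ℂ} {B : ℝ} (ha : a ≠ 0)
    (hs : riemannZeta₁ (a * s + b) ≠ 0) (hB : ∀ w : ℂ, B < w.re → 1 ≤ (a * w + b).re) :
    HasMittagLefflerExpansion s B (logDeriv fun w => riemannZeta₁ (a * w + b))
      fun u => (analyticOrderNatAt riemannZeta₁ (a * u + b) : ℂ) :=
  ((entireOfGrowth_riemannZeta₁.comp_affine a b).hasMittagLefflerExpansion hs fun w hw =>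
    riemannZeta₁_ne_zero_of_one_le_re (hB w hw)).congr rfl (fun _ _ => rfl) fun u => by
      rw [analyticOrderNatAt_comp_affine _ ha]

theorem hasMittagLefflerExpansion_riemannZeta₁_sub_shift {T₁ T₂ B : ℝ} {s : ℂ} (hB : 1 ≤ B)
    {j : Fin 4} (hs : riemannZeta₁ (s - shift T₁ T₂ j) ≠ 0) :
    HasMittagLefflerExpansion s B (logDeriv fun w => riemannZeta₁ (w - shift T₁ T₂ j))
      fun u => (analyticOrderNatAt riemannZeta₁ (u - shift T₁ T₂ j) : ℂ) := by
  have h := hasMittagLefflerExpansion_riemannZeta₁_comp_affine (B := B) (s := s)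
    (b := -shift T₁ T₂ j) one_ne_zero (by rwa [one_mul, ← sub_eq_add_neg]) fun w hw => by
      rw [one_mul, ← sub_eq_add_neg, sub_re, shift_re]
      linarith
  simpa only [one_mul, ← sub_eq_add_neg] using h

theorem hasMittagLefflerExpansion_riemannZeta₁_two_mul_sub {T₁ T₂ B : ℝ} {s : ℂ} (hB : 1 ≤ B)
    (hs : riemannZeta₁ (2 * s - I * (T₁ - T₂)) ≠ 0) :
    HasMittagLefflerExpansion s B (logDeriv fun w => riemannZeta₁ (2 * w - I * (T₁ - T₂)))
      fun u => (analyticOrderNatAt riemannZeta₁ (2 * u - I * (T₁ - T₂)) : ℂ) := by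
  simp only [sub_eq_add_neg _ (I * (T₁ - T₂ : ℂ))] at hs ⊢
  refine hasMittagLefflerExpansion_riemannZeta₁_comp_affine two_ne_zero hs fun w hw => ?_
  rw [← sub_eq_add_neg, two_mul_sub_re]
  linarith

/-- The order of `Z` at `u`, written through the orders of the entire factors of `numZ T₁ T₂ f`
and `denZ T₁ T₂ g`. -/
noncomputable def orderZ (T₁ T₂ : ℝ) (f g : ℂ → ℂ) (u : ℂ) : ℂ :=
  (∑ j, (analyticOrderNatAt riemannZeta₁ (u - shift T₁ T₂ j) : ℂ))
      + (if u = half T₁ T₂ 1 then 1 else 0) + analyticOrderNatAt f u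
    - ((∑ j, if u = 1 + shift T₁ T₂ j then 1 else 0)
      + analyticOrderNatAt riemannZeta₁ (2 * u - I * (T₁ - T₂)) + analyticOrderNatAt g u)

theorem hasMittagLefflerExpansion_logDeriv_numZ {T₁ T₂ B : ℝ} {f : ℂ → ℂ} {s : ℂ}
    (hf : EntireOfGrowth 2 f) (hB : 1 ≤ B) (hfB : ∀ w : ℂ, B < w.re → f w ≠ 0)
    (hhalf : s ≠ half T₁ T₂ 1) (hζ : ∀ j, riemannZeta₁ (s - shift T₁ T₂ j) ≠ 0) (hfs : f s ≠ 0) :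
    HasMittagLefflerExpansion s B (logDeriv (numZ T₁ T₂ f)) fun u =>
      (∑ j, (analyticOrderNatAt riemannZeta₁ (u - shift T₁ T₂ j) : ℂ))
        + (if u = half T₁ T₂ 1 then 1 else 0) + analyticOrderNatAt f u := by
  have hshift := HasMittagLefflerExpansion.sum Finset.univ fun j _ =>
    hasMittagLefflerExpansion_riemannZeta₁_sub_shift hB (hζ j)
  have hpole := hasMittagLefflerExpansion_one_div_sub (B := B) hhalf
    (by rw [half_re, one_re]; linarith)
  refine ((hshift.add hpole).add (hf.hasMittagLefflerExpansion hfs hfB)).congr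
    (logDeriv_numZ hf.differentiable hhalf hζ hfs) (fun w hw => ?_) fun _ => rfl
  exact logDeriv_numZ hf.differentiable (ne_half_one_of_one_lt_re (hB.trans_lt hw))
    (riemannZeta₁_sub_shift_ne_zero_of_one_le_re (hB.trans hw.le)) (hfB w hw)

theorem hasMittagLefflerExpansion_logDeriv_denZ {T₁ T₂ B : ℝ} {g : ℂ → ℂ} {s : ℂ}
    (hg : EntireOfGrowth 2 g) (hB : 1 ≤ B) (hgB : ∀ w : ℂ, B < w.re → g w ≠ 0)
    (hpole : ∀ j, s ≠ 1 + shift T₁ T₂ j) (hζ : riemannZeta₁ (2 * s - I * (T₁ - T₂)) ≠ 0)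
    (hgs : g s ≠ 0) :
    HasMittagLefflerExpansion s B (logDeriv (denZ T₁ T₂ g)) fun u =>
      (∑ j, if u = 1 + shift T₁ T₂ j then 1 else 0)
        + analyticOrderNatAt riemannZeta₁ (2 * u - I * (T₁ - T₂)) + analyticOrderNatAt g u := by
  have hpoles := HasMittagLefflerExpansion.sum Finset.univ fun j _ =>
    hasMittagLefflerExpansion_one_div_sub (B := B) (hpole j)
      (by rwa [add_re, shift_re, one_re, add_zero])
  have hhalf := hasMittagLefflerExpansion_riemannZeta₁_two_mul_sub hB hζ
  refine ((hpoles.add hhalf).add (hg.hasMittagLefflerExpansion hgs hgB)).congr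
    (logDeriv_denZ hg.differentiable hpole hζ hgs) (fun w hw => ?_) fun _ => rfl
  exact logDeriv_denZ hg.differentiable (ne_one_add_shift_of_one_lt_re (hB.trans_lt hw))
    (riemannZeta₁_two_mul_sub_ne_zero_of_one_le_re (hB.trans hw.le)) (hgB w hw)

theorem hasMittagLefflerExpansion_logDeriv_Z {T₁ T₂ z B : ℝ} {f g : ℂ → ℂ} {s : ℂ}
    (hf : EntireOfGrowth 2 f) (hg : EntireOfGrowth 2 g) (hB : 1 ≤ B)
    (hfgB : ∀ w : ℂ, B < w.re → f w ≠ 0 ∧ g w ≠ 0)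
    (hK : ∀ u, K T₁ T₂ z =ᶠ[𝓝[≠] u] fun w => f w / g w)
    (hpole : ∀ j, s ≠ 1 + shift T₁ T₂ j) (hhalf : s ≠ half T₁ T₂ 1)
    (hζ_shift : ∀ j, riemannZeta₁ (s - shift T₁ T₂ j) ≠ 0)
    (hζ_half : riemannZeta₁ (2 * s - I * (T₁ - T₂)) ≠ 0) (hfs : f s ≠ 0) (hgs : g s ≠ 0) :
    HasMittagLefflerExpansion s B (logDeriv (Z T₁ T₂ z)) (orderZ T₁ T₂ f g) := by
  refine ((hasMittagLefflerExpansion_logDeriv_numZ hf hB (fun w hw => (hfgB w hw).1) hhalf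
    hζ_shift hfs).sub (hasMittagLefflerExpansion_logDeriv_denZ hg hB (fun w hw => (hfgB w hw).2)
    hpole hζ_half hgs)).congr ?_ (fun w hw => ?_) fun _ => rfl
  · exact logDeriv_Z hf.differentiable hg.differentiable (hK s)
      (numZ_ne_zero hhalf hζ_shift hfs) (denZ_ne_zero hpole hζ_half hgs)
  · have hw1 : 1 < w.re := hB.trans_lt hw
    exact logDeriv_Z hf.differentiable hg.differentiable (hK w)
      (numZ_ne_zero (ne_half_one_of_one_lt_re hw1)
        (riemannZeta₁_sub_shift_ne_zero_of_one_le_re hw1.le) (hfgB w hw).1)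
      (denZ_ne_zero (ne_one_add_shift_of_one_lt_re hw1)
        (riemannZeta₁_two_mul_sub_ne_zero_of_one_le_re hw1.le) (hfgB w hw).2)

theorem riemannZeta₁_sub_shift_ne_zero {T₁ T₂ : ℝ} {s : ℂ}
    (hρ : ∀ ρ ∈ zetaZeros, ∀ j, s ≠ ρ + shift T₁ T₂ j)
    (hq : ∀ q : ℕ+, ∀ j, s ≠ trivialZero q + shift T₁ T₂ j) (j : Fin 4) :
    riemannZeta₁ (s - shift T₁ T₂ j) ≠ 0 := fun h => by
  rcases mem_zetaZeros_or_exists_eq_trivialZero h with hmem | ⟨q, hsq⟩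
  · exact hρ _ hmem j (sub_add_cancel _ _).symm
  · exact hq q j (sub_eq_iff_eq_add.1 hsq)

theorem riemannZeta₁_two_mul_sub_ne_zero {T₁ T₂ : ℝ} {s : ℂ}
    (hρ : ∀ ρ ∈ zetaZeros, s ≠ half T₁ T₂ ρ) (hq : ∀ q : ℕ+, s ≠ half T₁ T₂ (trivialZero q)) :
    riemannZeta₁ (2 * s - I * (T₁ - T₂)) ≠ 0 := fun h => by
  have hs : s = half T₁ T₂ (2 * s - I * (T₁ - T₂)) := by rw [half]; ring
  rcases mem_zetaZeros_or_exists_eq_trivialZero h with hmem | ⟨q, hsq⟩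
  · exact hρ _ hmem hs
  · exact hq q (hsq ▸ hs)

end LogDerivExpansion

section SumOverOrders

variable {T₁ T₂ : ℝ} {φ : ℂ → ℂ}

theorem hasSum_ite_eq_mul (φ : ℂ → ℂ) (a : ℂ) :
    HasSum (fun u => (if u = a then 1 else 0) * φ u) (φ a) :=
  hasSum_of_eq (hasSum_ite_eq a (φ a)) (fun u => by split_ifs with h <;> simp [h]) rfl

theorem summable_prod_fin {α : Type*} {n : ℕ} {F : α × Fin n → ℂ}
    (h : ∀ j, Summable fun a => F (a, j)) : Summable F := by
  rw [← (Equiv.prodComm (Fin n) α).summable_iff]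
  exact .of_norm ((summable_prod_of_nonneg fun _ => norm_nonneg _).2
    ⟨fun j => (h j).norm, .of_finite⟩)

theorem tsum_prod_fin {α : Type*} {n : ℕ} {F : α × Fin n → ℂ}
    (h : ∀ j, Summable fun a => F (a, j)) : ∑' p, F p = ∑ j, ∑' a, F (a, j) := by
  rw [← (Equiv.prodComm (Fin n) α).tsum_eq F]
  exact (((Equiv.prodComm _ _).summable_iff.2 (summable_prod_fin h)).tsum_prod' h).trans
    (tsum_fintype _)

/-- The map `half T₁ T₂` as a bijection of `ℂ`, for reindexing sums over zeros of zeta. -/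
noncomputable def halfEquiv (T₁ T₂ : ℝ) : ℂ ≃ ℂ where
  toFun := half T₁ T₂
  invFun u := 2 * u - I * (T₁ - T₂)
  left_inv w := by rw [half]; ring
  right_inv u := by rw [half]; ring

theorem hasSum_order_two_mul_sub_mul
    (h : Summable fun u => (analyticOrderNatAt riemannZeta₁ (2 * u - I * (T₁ - T₂)) : ℂ) * φ u) :
    HasSum (fun u => (analyticOrderNatAt riemannZeta₁ (2 * u - I * (T₁ - T₂)) : ℂ) * φ u)
      ((∑' ρ : zetaZeros, (zeroMult riemannZeta ρ : ℂ) * φ (half T₁ T₂ ρ))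
        + ∑' q, φ (half T₁ T₂ (trivialZero q))) :=
  hasSum_order_riemannZeta₁_mul (halfEquiv T₁ T₂) h

theorem summable_zetaZeros_mul_shift
    (hshift : ∀ j, Summable fun u =>
      (analyticOrderNatAt riemannZeta₁ (u - shift T₁ T₂ j) : ℂ) * φ u) :
    Summable fun a : zetaZeros × Fin 4 =>
      (zeroMult riemannZeta a.1 : ℂ) * φ (a.1 + shift T₁ T₂ a.2) :=
  summable_prod_fin fun j =>
    summable_zetaZeros_mul (Equiv.subRight (shift T₁ T₂ j)).symm (hshift j)

theorem summable_trivialZero_shift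
    (hshift : ∀ j, Summable fun u =>
      (analyticOrderNatAt riemannZeta₁ (u - shift T₁ T₂ j) : ℂ) * φ u) :
    Summable fun a : ℕ+ × Fin 4 => φ (trivialZero a.1 + shift T₁ T₂ a.2) :=
  summable_prod_fin fun j =>
    summable_trivialZero (Equiv.subRight (shift T₁ T₂ j)).symm (hshift j)

theorem hasSum_sum_order_sub_shift_mul
    (hshift : ∀ j, Summable fun u =>
      (analyticOrderNatAt riemannZeta₁ (u - shift T₁ T₂ j) : ℂ) * φ u) :
    HasSum (fun u => ∑ j, (analyticOrderNatAt riemannZeta₁ (u - shift T₁ T₂ j) : ℂ) * φ u)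
      ((∑' a : zetaZeros × Fin 4, (zeroMult riemannZeta a.1 : ℂ) * φ (a.1 + shift T₁ T₂ a.2))
        + ∑' a : ℕ+ × Fin 4, φ (trivialZero a.1 + shift T₁ T₂ a.2)) := by
  have hsum := hasSum_sum fun j (_ : j ∈ Finset.univ) =>
    hasSum_order_riemannZeta₁_mul (Equiv.subRight (shift T₁ T₂ j)).symm (hshift j)
  rw [Finset.sum_add_distrib] at hsum
  have hzeros := tsum_prod_fin
    (F := fun a : zetaZeros × Fin 4 =>
      (zeroMult riemannZeta a.1 : ℂ) * φ (a.1 + shift T₁ T₂ a.2)) fun j =>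
    summable_zetaZeros_mul (Equiv.subRight (shift T₁ T₂ j)).symm (hshift j)
  have htrivial := tsum_prod_fin
    (F := fun a : ℕ+ × Fin 4 => φ (trivialZero a.1 + shift T₁ T₂ a.2)) fun j =>
    summable_trivialZero (Equiv.subRight (shift T₁ T₂ j)).symm (hshift j)
  rw [hzeros, htrivial]
  exact hsum

theorem tsum_orderZ_mul {z : ℝ} {f g : ℂ → ℂ}
    (hK : ∀ u, meromorphicOrderAt (K T₁ T₂ z) u
      = ((analyticOrderNatAt f u - analyticOrderNatAt g u : ℤ) : WithTop ℤ))
    (hf : Summable fun u => (analyticOrderNatAt f u : ℂ) * φ u)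
    (hg : Summable fun u => (analyticOrderNatAt g u : ℂ) * φ u)
    (hshift : ∀ j, Summable fun u =>
      (analyticOrderNatAt riemannZeta₁ (u - shift T₁ T₂ j) : ℂ) * φ u)
    (hhalf : Summable fun u =>
      (analyticOrderNatAt riemannZeta₁ (2 * u - I * (T₁ - T₂)) : ℂ) * φ u) :
    ∑' u, orderZ T₁ T₂ f g u * φ u =
      (φ (half T₁ T₂ 1)
        + (∑' a : zetaZeros × Fin 4, (zeroMult riemannZeta a.1 : ℂ) * φ (a.1 + shift T₁ T₂ a.2))
        + (∑' a : ℕ+ × Fin 4, φ (trivialZero a.1 + shift T₁ T₂ a.2))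
        + ∑' r : zerosK T₁ T₂ z, (zeroMult (K T₁ T₂ z) r : ℂ) * φ r)
      - ((∑ j, φ (1 + shift T₁ T₂ j))
        + (∑' ρ : zetaZeros, (zeroMult riemannZeta ρ : ℂ) * φ (half T₁ T₂ ρ))
        + (∑' q : ℕ+, φ (half T₁ T₂ (trivialZero q)))
        + ∑' ν : polesK T₁ T₂ z, (poleMult (K T₁ T₂ z) ν : ℂ) * φ ν) := by
  have hnum := ((hasSum_sum_order_sub_shift_mul hshift).add
    (hasSum_ite_eq_mul φ (half T₁ T₂ 1))).add (hasSum_sub_mul_of_meromorphicOrderAt hK hf hg)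
  have hden := (hasSum_sum fun j (_ : j ∈ Finset.univ) =>
    hasSum_ite_eq_mul φ (1 + shift T₁ T₂ j)).add (hasSum_order_two_mul_sub_mul hhalf)
  refine (hasSum_of_eq (hnum.sub hden) (fun u => ?_) ?_).tsum_eq
  · simp only [orderZ, ← Finset.sum_mul]
    ring
  · simp only [zerosK, polesK]
    ring

end SumOverOrders

end Motohashi

theorem mainTheorem1 (T₁ T₂ z : ℝ) (hz : 1 < z) :
    -- the logarithmic derivative of `Z` has a Dirichlet series, starting at `n = 2`
    (∃ c : ℕ → ℂ, c 1 = 0 ∧ Motohashi.IsLogDerivCoeff T₁ T₂ z c) ∧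
    -- the shape of the poles of `K`
    (∀ ν ∈ Motohashi.polesK T₁ T₂ z, ∃ (p : ℕ) (k : ℤ), p.Prime ∧ (p : ℝ) < z ^ 2 ∧
      ν = Complex.I * (Real.pi * k / Real.log p + 1 / 2 * (T₁ - T₂))) ∧
    -- the explicit formula
    ∀ c : ℕ → ℂ, Motohashi.IsLogDerivCoeff T₁ T₂ z c →
      ∀ x : ℝ, 1 < x → ∀ s : ℂ,
        (∀ j, s ≠ 1 + Motohashi.shift T₁ T₂ j) →
        s ≠ Motohashi.half T₁ T₂ 1 →
        (∀ ρ ∈ Motohashi.zetaZeros, ∀ j, s ≠ ρ + Motohashi.shift T₁ T₂ j) →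
        (∀ ρ ∈ Motohashi.zetaZeros, s ≠ Motohashi.half T₁ T₂ ρ) →
        (∀ q : ℕ+, ∀ j, s ≠ Motohashi.trivialZero q + Motohashi.shift T₁ T₂ j) →
        (∀ q : ℕ+, s ≠ Motohashi.half T₁ T₂ (Motohashi.trivialZero q)) →
        s ∉ Motohashi.polesK T₁ T₂ z →
        s ∉ Motohashi.zerosK T₁ T₂ z →
        -- all the infinite sums converge absolutely
        Summable (fun ρ : Motohashi.zetaZeros =>
          (Motohashi.zeroMult riemannZeta ρ : ℂ) *
            Motohashi.kernel x s (Motohashi.half T₁ T₂ ρ)) ∧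
        Summable (fun q : ℕ+ =>
          Motohashi.kernel x s (Motohashi.half T₁ T₂ (Motohashi.trivialZero q))) ∧
        Summable (fun ν : Motohashi.polesK T₁ T₂ z =>
          (Motohashi.poleMult (Motohashi.K T₁ T₂ z) ν : ℂ) * Motohashi.kernel x s ν) ∧
        Summable (fun a : Motohashi.zetaZeros × Fin 4 =>
          (Motohashi.zeroMult riemannZeta a.1 : ℂ) *
            Motohashi.kernel x s (a.1 + Motohashi.shift T₁ T₂ a.2)) ∧
        Summable (fun a : ℕ+ × Fin 4 =>
          Motohashi.kernel x s (Motohashi.trivialZero a.1 + Motohashi.shift T₁ T₂ a.2)) ∧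
        Summable (fun r : Motohashi.zerosK T₁ T₂ z =>
          (Motohashi.zeroMult (Motohashi.K T₁ T₂ z) r : ℂ) * Motohashi.kernel x s r) ∧
        logDeriv (Motohashi.Z T₁ T₂ z) s =
          (∑ n ∈ Finset.Ico 1 ⌈x ^ 3⌉₊, Motohashi.smoothed x c n / (n : ℂ) ^ s)
          + ((∑ j : Fin 4, Motohashi.kernel x s (1 + Motohashi.shift T₁ T₂ j))
            + (∑' ρ : Motohashi.zetaZeros, (Motohashi.zeroMult riemannZeta ρ : ℂ) *
                Motohashi.kernel x s (Motohashi.half T₁ T₂ ρ))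
            + (∑' q : ℕ+, Motohashi.kernel x s
                (Motohashi.half T₁ T₂ (Motohashi.trivialZero q)))
            + ∑' ν : Motohashi.polesK T₁ T₂ z,
                (Motohashi.poleMult (Motohashi.K T₁ T₂ z) ν : ℂ) * Motohashi.kernel x s ν)
          - (Motohashi.kernel x s (Motohashi.half T₁ T₂ 1)
            + (∑' a : Motohashi.zetaZeros × Fin 4, (Motohashi.zeroMult riemannZeta a.1 : ℂ) *
                Motohashi.kernel x s (a.1 + Motohashi.shift T₁ T₂ a.2))
            + (∑' a : ℕ+ × Fin 4, Motohashi.kernel x s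
                (Motohashi.trivialZero a.1 + Motohashi.shift T₁ T₂ a.2))
            + ∑' r : Motohashi.zerosK T₁ T₂ z,
                (Motohashi.zeroMult (Motohashi.K T₁ T₂ z) r : ℂ) * Motohashi.kernel x s r) := by
  refine ⟨Motohashi.exists_isLogDerivCoeff T₁ T₂ hz,
    fun ν hν => Motohashi.exists_prime_of_mem_polesK hν, ?_⟩
  rintro c ⟨σ, hc⟩ x hx s hone hone_half hρ_shift hρ_half hq_shift hq_half hpole hzero
  obtain ⟨f, g, hf, hg, hfs, hgs, ⟨τ, hτ1, hτ⟩, hK⟩ :=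
    Motohashi.exists_entireOfGrowth_K_eventuallyEq_div hz hpole hzero
  have horder u := (meromorphicOrderAt_congr (hK u)).trans
    (Motohashi.meromorphicOrderAt_div_eq_sub hf.differentiable hfs hg.differentiable hgs u)
  have hζ_shift := Motohashi.riemannZeta₁_sub_shift_ne_zero hρ_shift hq_shift
  have hζ_half := Motohashi.riemannZeta₁_two_mul_sub_ne_zero hρ_half hq_half
  have hf_sum := (hf.hasMittagLefflerExpansion hfs fun w hw => (hτ w hw).1).summable_kernel hx
  have hg_sum := (hg.hasMittagLefflerExpansion hgs fun w hw => (hτ w hw).2).summable_kernel hx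
  have hshift_sum j := (Motohashi.hasMittagLefflerExpansion_riemannZeta₁_sub_shift le_rfl
    (hζ_shift j)).summable_kernel hx
  have hhalf_sum := (Motohashi.hasMittagLefflerExpansion_riemannZeta₁_two_mul_sub le_rfl
    hζ_half).summable_kernel hx
  have hZ := Motohashi.hasMittagLefflerExpansion_logDeriv_Z hf hg hτ1 hτ hK hone hone_half
    hζ_shift hζ_half hfs hgs
  refine ⟨Motohashi.summable_zetaZeros_mul (Motohashi.halfEquiv T₁ T₂) hhalf_sum,
    Motohashi.summable_trivialZero (Motohashi.halfEquiv T₁ T₂) hhalf_sum,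
    Motohashi.summable_poleMult_mul _ horder hg_sum,
    Motohashi.summable_zetaZeros_mul_shift hshift_sum,
    Motohashi.summable_trivialZero_shift hshift_sum,
    Motohashi.summable_zeroMult_mul _ horder hf_sum, ?_⟩
  rw [hZ.explicit_formula hc hx,
    Motohashi.tsum_orderZ_mul horder hf_sum hg_sum hshift_sum hhalf_sum]
  ring
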